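/- **Setting.** Let $\Gamma$ be a connected oriented multigraph (loops and multiple edges allowed) with vertex set $V$, edge set $E$ and finite degrees. For $v\in V$ let $E_v^-$ (resp. $E_v^+$) be the set of edges starting (resp. ending) at $v$, and $E_v=E_v^-\cup E_v^+$. *Norms.* Let $\|\cdot\|_E$, $\|\cdot\|_V$ be norms on subspaces $\mathcal B_E\subset\mathbb C^E$, $\mathcal B_V\subset\mathbb C^V$ (norm $=+\infty$ outside these subspaces) which are admissible: $\mathcal B_E$, $\mathcal B_V$ are Banach spaces; the norms are monotonic ($|a_i|\le|b_i|$ for all $i$ implies $\|a\|\le\|b\|$; in particular $b$ in the subspace implies $a$ in the subspace); $\alpha\mapsto(\sum_{e\in E_v}|\alpha_e|)_{v}$ is bounded from $\mathcal B_E$ to $\mathcal B_V$; $u\mapsto(|u_v|+|u_{v'}|)_{e=vv'}$ is bounded from $\mathcal B_V$ to $\mathcal B_E$; and the space of families $(\lambda_{e,n})_{e\in E,n\in\mathbb N}$ with $\|(\sup_n|\lambda_{e,n}|)_e\|_E<\infty$ is complete. *Parameters.* For each edge $e$ and sign $\pm$ let $X_e^\pm$ be a finite-dimensional normed complex space, of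 dimension bounded independently of $(e,\pm)$. The parameters are $p=(p_e^\pm)$ with $p_e^\pm\in\mathbb C$, $t=(t_e)_{e\in E}$ with $t_e\in\mathbb C$, and $\xi=(\xi_e^\pm)$ with $\xi_e^\pm\in X_e^\pm$. Fix central values $p_0=(\underline p_e^\pm)$, $\xi_0=(\underline\xi_e^\pm)$. The local coordinates have the form $z_e^\pm(z)=\zeta_e^\pm(z-p_e^\pm,\xi_e^\pm)$ on $D_e^\pm=p_e^\pm+U_e^\pm(\xi_e^\pm)$, where $\zeta_e^\pm$ is holomorphic in both variables at every $(u,x)$ with $\|x-\underline\xi_e^\pm\|<\delta_0$ and $u\in U_e^\pm(x)$. There are constants $\rho,c_1,c_2,\delta_0>0$ such that for $p=p_0$ and every $\xi$ with $\|\xi-\xi_0\|_\infty<\delta_0$ the coordinates are admissible: $D_e^\pm\subset\mathbb C$ is open and contains $p_e^\pm$; $z_e^\pm$ is a biholomorphism from $D_e^\pm$ onto $D(0,\rho)$ with $z_e^\pm(p_e^\pm)=0$; for each $v$ the disks $D_e^-$ ($e\in E_v^-$) and $D_e^+$ ($e\in E_v^+$) are pairwise disjoint; and $c_1|z_e^\pm(z)|\le|z-p_e^\pm|\le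 c_2|z_e^\pm(z)|$ on $D_e^\pm$. *Regular differentials.* Given $(p,t,\xi)$, take a Riemann sphere $S_v=\mathbb C\cup\{\infty\}$ for each $v$; for each edge $e$ from $v$ to $v'$ remove $\{|z_e^-|\le|t_e|/\rho\}$ from $S_v$ and $\{|z_e^+|\le|t_e|/\rho\}$ from $S_{v'}$; if $t_e\ne0$ identify the remaining points $z\in D_e^-$ and $z'\in D_e^+$ with $z_e^-(z)z_e^+(z')=t_e$, and if $t_e=0$ identify $p_e^-$ with $p_e^+$ (a node). This gives $\Sigma_{p,t,\xi}$. A regular differential on it is a family of holomorphic differentials on the remaining parts of the spheres $S_v$ (including the points $\infty$) which agree under these identifications and which, whenever $t_e=0$, have at most simple poles at $p_e^-$, $p_e^+$ with opposite residues. (These conditions are used as they stand for all $(p,t,\xi)$ near $(p_0,0,\xi_0)$.) Let $\gamma_e$ be the class of the positively oriented circles centred at $p_e^+$ contained in the annulus $\{z\in D_e^+:|z_e^+(z)|>|t_e|/\rho\}$. Fix $0<\epsilon\le\rho c_1$. Let $\Omega_{v,\epsilon}$ be $S_v$ minus the open disks $D(\underline p_e^-,\epsilon)$, $e\in E_v^-$,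 and $D(\underline p_e^+,\epsilon)$, $e\in E_v^+$; let $\Omega_\epsilon$ be the disjoint union of the $\Omega_{v,\epsilon}$, let $\|w\|_\Omega=\big\|\big(\sup_{\Omega_{v,\epsilon}}|w/dz|\big)_{v}\big\|_V$, and let $\mathcal H^1(\Omega_\epsilon)$ be the space of differentials $w$ on $\Omega_\epsilon$, continuous and holomorphic in the interior, with $\|w\|_\Omega<\infty$. **Theorem 4.** There is $\delta>0$ such that, for every $\alpha\in\mathcal B_E$ with $\sum_{e\in E_v^-}\alpha_e=\sum_{e\in E_v^+}\alpha_e$ for all $v\in V$, the following holds. For all $(p,t,\xi)$ with $\|p-p_0\|_\infty<\delta$, $\|t\|_\infty<\delta$, $\|\xi-\xi_0\|_\infty<\delta$, the set $\Omega_\epsilon$ is contained in the remaining parts of the spheres, and there is a unique regular differential $\omega=\omega_{p,t,\xi}$ on $\Sigma_{p,t,\xi}$ with $\|\omega\|_\Omega<\infty$ and $\int_{\gamma_e}\omega=\alpha_e$ for all $e\in E$. Its restriction to $\Omega_\epsilon$ depends smoothly, and in fact analytically, on $(p,t,\xi)$: the map $(p,t,\xi)\mapsto\omega_{p,t,\xi}|_{\Omega_\epsilon}\in\mathcal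 H^1(\Omega_\epsilon)$ is $C^\infty$ and analytic on this open $\ell^\infty$-ball. -/

import Mathlib

open scoped ENNReal Topology

noncomputable section

namespace OpenNodes

/-- An oriented multigraph with vertex set `V` and edge set `E`: the edge `e` goes from
`src e` to `tgt e`. Loops and multiple edges are allowed. -/
structure OrientedMultigraph (V E : Type*) where
  src : E → V
  tgt : E → V

namespace OrientedMultigraph

variable {V E : Type*} (G : OrientedMultigraph V E)

/-- The edges adjacent to `v`. -/
def edgesAt (v : V) : Set E := {e | G.src e = v ∨ G.tgt e = v}

/-- The graph is connected (orientations are ignored). -/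
def Connected : Prop :=
  Nonempty V ∧ ∀ v w : V, Relation.EqvGen (fun a b => ∃ e, G.src e = a ∧ G.tgt e = b) v w

/-- All degrees are finite. -/
def LocallyFinite : Prop := ∀ v, (G.edgesAt v).Finite

/-- A half-edge is a pair `(e, σ)`, where `σ = false` stands for the sign `-` (the starting
point of `e`) and `σ = true` for the sign `+` (the endpoint of `e`). `G.base h` is the vertex
whose sphere carries the node point of the half-edge `h`. -/
def base (h : E × Bool) : V := if h.2 then G.tgt h.1 else G.src h.1

/-- The obstruction from Cauchy's theorem: at every vertex, the sum of the periods of the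
outgoing edges equals the sum of the periods of the incoming edges. -/
def Compatible (α : E → ℂ) : Prop :=
  ∀ v, ∑ᶠ e ∈ {e | G.src e = v}, α e = ∑ᶠ e ∈ {e | G.tgt e = v}, α e

end OrientedMultigraph

/-! ### Norms on spaces of sequences -/

/-- A monotonic Banach norm on a subspace of `ι → ℂ`. It is given as a function with values in
`[0, ∞]`; the subspace is the set where it is finite (where "the norm is defined"). -/
structure SeqNorm (ι : Type*) where
  toFun : (ι → ℂ) → ℝ≥0∞
  zero' : toFun 0 = 0
  eq_zero' : ∀ a, toFun a = 0 → a = 0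
  smul' : ∀ (c : ℂ) (a : ι → ℂ), toFun a < ∞ → toFun (c • a) = ‖c‖ₑ * toFun a
  add_le' : ∀ a b, toFun (a + b) ≤ toFun a + toFun b
  mono' : ∀ a b, (∀ i, ‖a i‖ ≤ ‖b i‖) → toFun a ≤ toFun b
  complete' : ∀ u : ℕ → ι → ℂ, (∀ n, toFun (u n) < ∞) →
    (∀ η : ℝ≥0∞, 0 < η → ∃ M, ∀ m ≥ M, ∀ n ≥ M, toFun (u m - u n) ≤ η) →
    ∃ a, toFun a < ∞ ∧ Filter.Tendsto (fun n => toFun (u n - a)) Filter.atTop (𝓝 0)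

namespace SeqNorm

variable {ι : Type*} (N : SeqNorm ι)

open Classical in
/-- The norm of a sequence of elements of `[0, ∞]`; it is infinite if one of them is. -/
def enorm (u : ι → ℝ≥0∞) : ℝ≥0∞ :=
  if ∀ i, u i ≠ ∞ then N.toFun (fun i => ((u i).toReal : ℂ)) else ∞

theorem enorm_of_ne_top {u : ι → ℝ≥0∞} (hu : ∀ i, u i ≠ ∞) :
    N.enorm u = N.toFun (fun i => ((u i).toReal : ℂ)) := by
  simp only [enorm, if_pos hu]

theorem ne_top_of_enorm {u : ι → ℝ≥0∞} (hu : N.enorm u < ∞) : ∀ i, u i ≠ ∞ := by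
  by_contra h
  simp only [enorm, if_neg h] at hu
  exact lt_irrefl _ hu

theorem enorm_mono {u v : ι → ℝ≥0∞} (h : ∀ i, u i ≤ v i) : N.enorm u ≤ N.enorm v := by
  by_cases hv : ∀ i, v i ≠ ∞
  · have hu : ∀ i, u i ≠ ∞ := fun i => ne_top_of_le_ne_top (hv i) (h i)
    rw [N.enorm_of_ne_top hu, N.enorm_of_ne_top hv]
    refine N.mono' _ _ fun i => ?_
    simp only [Complex.norm_real, Real.norm_eq_abs, abs_of_nonneg ENNReal.toReal_nonneg]
    exact ENNReal.toReal_mono (hv i) (h i)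
  · simp [enorm, hv]

theorem enorm_add_le (u v : ι → ℝ≥0∞) :
    N.enorm (fun i => u i + v i) ≤ N.enorm u + N.enorm v := by
  by_cases hu : ∀ i, u i ≠ ∞
  · by_cases hv : ∀ i, v i ≠ ∞
    · rw [N.enorm_of_ne_top hu, N.enorm_of_ne_top hv,
        N.enorm_of_ne_top fun i => ENNReal.add_ne_top.2 ⟨hu i, hv i⟩]
      refine le_trans (le_of_eq ?_) (N.add_le' _ _)
      congr 1
      funext i
      simp [ENNReal.toReal_add (hu i) (hv i)]
    · simp [enorm, hv]
  · simp [enorm, hu]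

theorem enorm_const_mul (c : ℂ) {u : ι → ℝ≥0∞} (hu : N.enorm u < ∞) :
    N.enorm (fun i => ‖c‖ₑ * u i) = ‖c‖ₑ * N.enorm u := by
  have hu' := N.ne_top_of_enorm hu
  rw [N.enorm_of_ne_top hu'] at hu ⊢
  rw [N.enorm_of_ne_top fun i => ENNReal.mul_ne_top enorm_ne_top (hu' i)]
  have key := N.smul' (‖c‖ : ℂ) _ hu
  have hc : ‖((‖c‖ : ℝ) : ℂ)‖ₑ = ‖c‖ₑ := by
    rw [← ofReal_norm, ← ofReal_norm]; simp
  rw [hc] at key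
  rw [← key]
  congr 1
  funext i
  simp

theorem enorm_eq_zero {u : ι → ℝ≥0∞} (hu : N.enorm u = 0) : ∀ i, u i = 0 := by
  have hu' := N.ne_top_of_enorm (hu ▸ ENNReal.zero_lt_top)
  rw [N.enorm_of_ne_top hu'] at hu
  intro i
  have := congrFun (N.eq_zero' _ hu) i
  simpa [ENNReal.toReal_eq_zero_iff, hu' i] using this

theorem enorm_zero : N.enorm (fun _ => 0) = 0 := by
  rw [N.enorm_of_ne_top fun _ => ENNReal.zero_ne_top]
  simp only [ENNReal.toReal_zero, Complex.ofReal_zero]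
  exact N.zero'

/-- The norm of the sequence `(sup_n |l_{i,n}|)_i`. -/
def supNorm (l : ι → ℕ → ℂ) : ℝ≥0∞ := N.enorm fun i => ⨆ n, ‖l i n‖ₑ

end SeqNorm

/-- The norms `NE` on sequences indexed by edges and `NV` on sequences indexed by vertices are
admissible. (That each is a monotonic Banach norm is part of `SeqNorm`.) -/
structure AdmissibleNorms {V E : Type*} (G : OrientedMultigraph V E)
    (NE : SeqNorm E) (NV : SeqNorm V) : Prop where
  sum_bounded : ∃ C : ℝ, 0 ≤ C ∧ ∀ α : E → ℂ, NE.toFun α < ∞ →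
    NV.toFun (fun v => ((∑ᶠ e ∈ G.edgesAt v, ‖α e‖ : ℝ) : ℂ)) ≤ ENNReal.ofReal C * NE.toFun α
  ends_bounded : ∃ C : ℝ, 0 ≤ C ∧ ∀ u : V → ℂ, NV.toFun u < ∞ →
    NE.toFun (fun e => ((‖u (G.src e)‖ + ‖u (G.tgt e)‖ : ℝ) : ℂ)) ≤
      ENNReal.ofReal C * NV.toFun u
  sup_complete : ∀ u : ℕ → E → ℕ → ℂ, (∀ n, NE.supNorm (u n) < ∞) →
    (∀ η : ℝ≥0∞, 0 < η → ∃ M, ∀ m ≥ M, ∀ n ≥ M, NE.supNorm (u m - u n) ≤ η) →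
    ∃ a, NE.supNorm a < ∞ ∧ Filter.Tendsto (fun n => NE.supNorm (u n - a)) Filter.atTop (𝓝 0)

/-! ### Differentials on domains of the Riemann sphere

A differential `f(z) dz` on a domain of the Riemann sphere containing `∞` is given by its
coefficient `f` at the finite points of the domain. -/

/-- `f(z) dz` extends holomorphically to the point `∞`, in the coordinate `w = 1/z`
(in which `dz = -dw / w ^ 2`). -/
def HolomorphicAtInfty (f : ℂ → ℂ) : Prop :=
  ∃ g : ℂ → ℂ, AnalyticAt ℂ g 0 ∧ ∀ᶠ w in 𝓝[≠] (0 : ℂ), g w = -(w ^ 2)⁻¹ * f w⁻¹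

/-- The `[0, ∞]`-valued norm `‖(sup_{Ω_v} |w / dz|)_v‖_V`. -/
def domNorm {V : Type*} (N : SeqNorm V) (Ω : V → Set ℂ) (w : V → ℂ → ℂ) : ℝ≥0∞ :=
  N.enorm fun v => ⨆ z ∈ Ω v, ‖w v z‖ₑ

section HoloDiff

variable {V : Type*} (N : SeqNorm V) (Ω : V → Set ℂ)

theorem domNorm_add_le (w w' : V → ℂ → ℂ) :
    domNorm N Ω (w + w') ≤ domNorm N Ω w + domNorm N Ω w' := by
  refine le_trans (N.enorm_mono fun v => ?_) (N.enorm_add_le _ _)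
  refine iSup₂_le fun z hz => le_trans (_root_.enorm_add_le _ _) ?_
  exact add_le_add (le_iSup₂ (f := fun z (_ : z ∈ Ω v) => ‖w v z‖ₑ) z hz)
    (le_iSup₂ (f := fun z (_ : z ∈ Ω v) => ‖w' v z‖ₑ) z hz)

theorem domNorm_smul (c : ℂ) {w : V → ℂ → ℂ} (hw : domNorm N Ω w < ∞) :
    domNorm N Ω (c • w) = ‖c‖ₑ * domNorm N Ω w := by
  rw [domNorm, domNorm, ← N.enorm_const_mul c hw]
  congr 1
  funext v
  simp only [Pi.smul_apply, smul_eq_mul, enorm_mul, ENNReal.mul_iSup]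

theorem domNorm_zero : domNorm N Ω 0 = 0 := by
  simp [domNorm, N.enorm_zero]

/-- The holomorphic differentials on the disjoint union of the closed domains `Ω v ∪ {∞}` of
Riemann spheres (continuous, holomorphic in the interior and at `∞`) with finite norm, as a
subspace of all families of functions; the coefficient is set to `0` outside of `Ω v`. -/
def holoDiffSubmodule : Submodule ℂ (V → ℂ → ℂ) where
  carrier := {w | (∀ v, ∀ z ∉ Ω v, w v z = 0) ∧ (∀ v, ContinuousOn (w v) (Ω v)) ∧
    (∀ v, DifferentiableOn ℂ (w v) (interior (Ω v))) ∧ (∀ v, HolomorphicAtInfty (w v)) ∧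
    domNorm N Ω w < ∞}
  zero_mem' := by
    refine ⟨fun _ _ _ => rfl, fun _ => continuousOn_const, fun _ => differentiableOn_const 0,
      fun _ => ⟨0, analyticAt_const, ?_⟩, ?_⟩
    · filter_upwards with w
      simp
    · rw [domNorm_zero]; exact ENNReal.zero_lt_top
  add_mem' := by
    rintro a b ⟨a1, a2, a3, a4, a5⟩ ⟨b1, b2, b3, b4, b5⟩
    refine ⟨fun v z hz => by simp [a1 v z hz, b1 v z hz], fun v => (a2 v).add (b2 v),
      fun v => (a3 v).add (b3 v), fun v => ?_,
      lt_of_le_of_lt (domNorm_add_le N Ω a b) (ENNReal.add_lt_top.2 ⟨a5, b5⟩)⟩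
    obtain ⟨g, hg, hg'⟩ := a4 v
    obtain ⟨k, hk, hk'⟩ := b4 v
    refine ⟨g + k, hg.add hk, ?_⟩
    filter_upwards [hg', hk'] with w h1 h2
    simp only [Pi.add_apply, h1, h2]
    ring
  smul_mem' := by
    rintro c a ⟨a1, a2, a3, a4, a5⟩
    refine ⟨fun v z hz => by simp [a1 v z hz], fun v => (a2 v).const_smul c,
      fun v => (a3 v).const_smul c, fun v => ?_, ?_⟩
    · obtain ⟨g, hg, hg'⟩ := a4 v
      refine ⟨fun w => c * g w, analyticAt_const.mul hg, ?_⟩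
      filter_upwards [hg'] with w h1
      simp only [Pi.smul_apply, smul_eq_mul, h1]
      ring
    · rw [domNorm_smul N Ω c a5]
      exact ENNReal.mul_lt_top enorm_lt_top a5

/-- The normed space of holomorphic differentials on `Ω` with finite norm. -/
def HoloDiff : Type _ := ↥(holoDiffSubmodule N Ω)

namespace HoloDiff

variable {N Ω}

instance : AddCommGroup (HoloDiff N Ω) := inferInstanceAs (AddCommGroup ↥(holoDiffSubmodule N Ω))

instance : Module ℂ (HoloDiff N Ω) := inferInstanceAs (Module ℂ ↥(holoDiffSubmodule N Ω))

/-- The coefficient `w / dz` in each domain. -/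
def coeff (w : HoloDiff N Ω) : V → ℂ → ℂ := w.1

theorem domNorm_lt_top (w : HoloDiff N Ω) : domNorm N Ω w.coeff < ∞ := w.2.2.2.2.2

instance : Norm (HoloDiff N Ω) := ⟨fun w => (domNorm N Ω w.coeff).toReal⟩

theorem norm_def (w : HoloDiff N Ω) : ‖w‖ = (domNorm N Ω w.coeff).toReal := rfl

theorem core : NormedSpace.Core ℂ (HoloDiff N Ω) where
  norm_nonneg _ := ENNReal.toReal_nonneg
  norm_smul c w := by
    have h := domNorm_smul N Ω c w.domNorm_lt_top
    change (domNorm N Ω (c • w.coeff)).toReal = ‖c‖ * (domNorm N Ω w.coeff).toReal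
    rw [h, ENNReal.toReal_mul, toReal_enorm]
  norm_triangle a b := by
    have h := domNorm_add_le N Ω a.coeff b.coeff
    have hfin : domNorm N Ω a.coeff + domNorm N Ω b.coeff ≠ ∞ :=
      ENNReal.add_ne_top.2 ⟨a.domNorm_lt_top.ne, b.domNorm_lt_top.ne⟩
    have h' := ENNReal.toReal_mono hfin h
    rw [ENNReal.toReal_add a.domNorm_lt_top.ne b.domNorm_lt_top.ne] at h'
    exact h'
  norm_eq_zero_iff w := by
    constructor
    · intro h
      rw [norm_def, ENNReal.toReal_eq_zero_iff, or_iff_left w.domNorm_lt_top.ne] at h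
      have h0 := N.enorm_eq_zero h
      refine Subtype.ext (funext fun v => funext fun z => ?_)
      by_cases hz : z ∈ Ω v
      · have := le_iSup₂ (f := fun z (_ : z ∈ Ω v) => ‖w.coeff v z‖ₑ) z hz
        rw [h0 v] at this
        have h1 : w.coeff v z = 0 := by simpa using this
        exact h1
      · exact w.2.1 v z hz
    · rintro rfl
      change (domNorm N Ω 0).toReal = 0
      rw [domNorm_zero, ENNReal.toReal_zero]

instance : NormedAddCommGroup (HoloDiff N Ω) := NormedAddCommGroup.ofCore core

instance : NormedSpace ℂ (HoloDiff N Ω) := NormedSpace.ofCore core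

end HoloDiff

end HoloDiff

/-! ### Opening nodes -/

/-- For every half-edge, the node point `p` in the complex plane, the topological disk `D`
around it and the local coordinate `z` on this disk. -/
structure NodeData (E : Type*) where
  p : E × Bool → ℂ
  D : E × Bool → Set ℂ
  z : E × Bool → ℂ → ℂ

/-- The coordinates are admissible with constants `ρ`, `c₁`, `c₂`. -/
structure Admissible {V E : Type*} (G : OrientedMultigraph V E) (ρ c₁ c₂ : ℝ)
    (S : NodeData E) : Prop where
  isOpen : ∀ h, IsOpen (S.D h)
  center_mem : ∀ h, S.p h ∈ S.D h
  differentiableOn : ∀ h, DifferentiableOn ℂ (S.z h) (S.D h)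
  bijOn : ∀ h, Set.BijOn (S.z h) (S.D h) (Metric.ball 0 ρ)
  center : ∀ h, S.z h (S.p h) = 0
  disjoint : ∀ h h', h ≠ h' → G.base h = G.base h' → Disjoint (S.D h) (S.D h')
  lower : ∀ h, ∀ x ∈ S.D h, c₁ * ‖S.z h x‖ ≤ ‖x - S.p h‖
  upper : ∀ h, ∀ x ∈ S.D h, ‖x - S.p h‖ ≤ c₂ * ‖S.z h x‖

section Surface

variable {V E : Type*} (G : OrientedMultigraph V E) (ρ : ℝ) (S : NodeData E) (t : E → ℂ)

/-- The finite points of the sphere `S_v` which remain once the disks `|z_h| ≤ |t_e| / ρ` are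
removed (if `t_e = 0`, only the node point is removed). -/
def piece (v : V) : Set ℂ :=
  {x | ∀ h : E × Bool, G.base h = v → x ∈ S.D h → ‖t h.1‖ / ρ < ‖S.z h x‖}

/-- The annulus of the half-edge `h`, along which the neck is glued if `t_e ≠ 0`. -/
def annulus (h : E × Bool) : Set ℂ := {x ∈ S.D h | ‖t h.1‖ / ρ < ‖S.z h x‖}

/-- `ω = (f v (z) dz)_v` is a regular differential on the surface (with nodes) obtained from the
spheres by identifying, for every edge `e`, the points `x` of `D_e^-` and `y` of `D_e^+` with
`z_e^-(x) z_e^+(y) = t_e` if `t_e ≠ 0`, and `p_e^-` with `p_e^+` if `t_e = 0`: a family of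
holomorphic differentials on the pieces, compatible with the identifications, having at most
simple poles with opposite residues at the two sides of each node.

In `glue`, `z_e^-(x) z_e^+(y) = t_e` gives `z_e^+(y) (z_e^-)'(x) dx = - z_e^-(x) (z_e^+)'(y) dy`,
so that the equation says `f(x) dx = f(y) dy`. -/
structure IsRegular (f : V → ℂ → ℂ) : Prop where
  holomorphic : ∀ v, DifferentiableOn ℂ (f v) (piece G ρ S t v)
  infty : ∀ v, HolomorphicAtInfty (f v)
  glue : ∀ e, t e ≠ 0 → ∀ x ∈ annulus ρ S t (e, false), ∀ y ∈ annulus ρ S t (e, true),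
    S.z (e, false) x * S.z (e, true) y = t e →
    f (G.src e) x * (S.z (e, false) x * deriv (S.z (e, true)) y) =
      -(f (G.tgt e) y * (S.z (e, true) y * deriv (S.z (e, false)) x))
  node : ∀ e, t e = 0 → ∃ a b : ℂ → ℂ,
    AnalyticAt ℂ a (S.p (e, false)) ∧ AnalyticAt ℂ b (S.p (e, true)) ∧
    (∀ᶠ x in 𝓝[≠] (S.p (e, false)), f (G.src e) x = a x / (x - S.p (e, false))) ∧
    (∀ᶠ y in 𝓝[≠] (S.p (e, true)), f (G.tgt e) y = b y / (y - S.p (e, true))) ∧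
    a (S.p (e, false)) = -b (S.p (e, true))

/-- The periods of `ω` on the cycles `γ_e` are the numbers `α e`. The homology class `γ_e` of
the boundary of `D_e^+` is represented by any circle centred at `p_e^+` in the annulus. -/
def HasPeriods (f : V → ℂ → ℂ) (α : E → ℂ) : Prop :=
  ∀ e, ∀ s : ℝ, 0 < s → Metric.sphere (S.p (e, true)) s ⊆ annulus ρ S t (e, true) →
    (∮ x in C(S.p (e, true), s), f (G.tgt e) x) = α e

/-- The plane minus the disks of radius `ε` centred at the points `p h` of the sphere `S_v`. -/
def domainΩ (p : E × Bool → ℂ) (ε : ℝ) (v : V) : Set ℂ :=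
  {x | ∀ h, G.base h = v → ε ≤ ‖x - p h‖}

end Surface

/-! ### The parameters -/

/-- Coordinates depending on parameters: `map h (z - p) ξ` for `z - p ∈ dom h ξ`, where the
parameter `ξ` of the half-edge `h` varies in the space `X h`. -/
structure CoordFamily (E : Type*) (X : E × Bool → Type*) where
  dom : ∀ h, X h → Set ℂ
  map : ∀ h, ℂ → X h → ℂ

/-- Points `p`, and the coordinates `z ↦ map h (z - p h) (ξ h)` on the disks `p h + dom h (ξ h)`. -/
def CoordFamily.nodeData {E : Type*} {X : E × Bool → Type*} (Z : CoordFamily E X)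
    (p : E × Bool → ℂ) (ξ : ∀ h, X h) : NodeData E where
  p := p
  D h := {x | x - p h ∈ Z.dom h (ξ h)}
  z h x := Z.map h (x - p h) (ξ h)

/-- The Banach space of variations of the parameters `(p, t, ξ)`, with the `ℓ^∞` norm. -/
abbrev Param (E : Type*) (X : E × Bool → Type*) [∀ h, NormedAddCommGroup (X h)] :=
  lp (fun _ : E × Bool => ℂ) ∞ × lp (fun _ : E => ℂ) ∞ × lp X ∞

/-- The node points and coordinates for the parameters `(p₀, 0, ξ₀) + x`. -/
def nodesAt {E : Type*} {X : E × Bool → Type*} [∀ h, NormedAddCommGroup (X h)]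
    (Z : CoordFamily E X) (p₀ : E × Bool → ℂ) (ξ₀ : ∀ h, X h) (x : Param E X) : NodeData E :=
  Z.nodeData (fun h => p₀ h + x.1 h) (fun h => ξ₀ h + x.2.2 h)

end OpenNodes

end

open OpenNodes

/-! All coefficients below are integrals over circles centred at the central points `p₀ h`, which do
not move with the parameters. On the neck of a half-edge `h`, a regular differential with residue
`a_h` (plus or minus the period over `2πi`) has the form `(g_h(z) + a_h / z - (t / z ^ 2) g_{h'}(t /
z)) dz`, where `h'` is the opposite half-edge and `g_h` is holomorphic on the whole disk `|z| < ρ`: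
the negative part of the Laurent series on one side of the neck is the nonnegative part on the other
side, seen through `z ↦ t / z`. For `t = 0` the same formula describes a simple pole. On a sphere,
outside the disks of radius `ε / 4` about the `p₀ h`, Liouville's theorem makes the differential
equal to the sum of its principal parts at the `p₀ h`.

A differential is therefore encoded by two families: the normalised Taylor coefficients `c` of the
`g_h` and the normalised Laurent coefficients `d` at the `p₀ h`. Regularity with the prescribed
periods becomes a linear system `c = K₂ d`, `d = K₀ a + K₁ c`. Here `K₂` is Cauchy's formula on the
circles of radius `ε / 2` and `K₁` reads the Laurent coefficients of the inverted term on the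
circles of radius `ε / 8` (`NeckConfig.taylor_coefficient_eq`,
`NeckConfig.principal_coefficient_eq`). Conversely a solution of the system yields a regular
differential (`NeckConfig.vertexForm_eq_neckForm`, `NeckConfig.solution_spec`).

The gaps between the radii give each operator a kernel of bounded entries with weights `2⁻ⁿ`, and
the operators only relate half-edges sharing a vertex or an edge. Admissibility of the norms then
makes them bounded on one Banach space `CoeffSpace` (`exists_kernelOperator`). Since `K₁` carries a
factor `t`, `‖K₁ K₂‖ < 1` for small parameters and `d = (1 - K₁ K₂)⁻¹ K₀ a`; the smallness does not
involve `α`.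

For analyticity in infinitely many parameters, each kernel entry is a contour integral analytic in
the parameters, and the entries are uniformly bounded. A bounded map whose images under a norming
family of functionals are analytic is itself analytic (`IsNorming.analyticAt`), so the kernels are
analytic with values in `ℓ^∞`, and operator inversion preserves analyticity
(`exists_analytic_coefficients`).

For uniqueness, a competing differential also yields a solution of the system; finiteness of its
norm on the thick part puts its coefficients in `CoeffSpace` (`NeckConfig.exists_coefficients`),
where the solution is unique. -/

section WeakAnalyticity

/-! ### Analyticity tested by a norming family of functionals. -/

open Metric

/-- Cauchy's estimate on the complex line through `x` in the direction `y`. The line is followed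
only up to distance `s / 2`, so that a closed disk stays inside the open ball; this is the factor 2.
-/
theorem norm_fderiv_le_of_forall_mem_ball {X F : Type*} [NormedAddCommGroup X] [NormedSpace ℂ X]
    [NormedAddCommGroup F] [NormedSpace ℂ F] {g : X → F} {x : X} {s M : ℝ} (hs : 0 < s)
    (hg : DifferentiableOn ℂ g (ball x s)) (hM : ∀ y ∈ ball x s, ‖g y‖ ≤ M) :
    ‖fderiv ℂ g x‖ ≤ M * (2 / s) := by
  have hM0 : 0 ≤ M := (norm_nonneg _).trans (hM x (mem_ball_self hs))
  refine ContinuousLinearMap.opNorm_le_bound _ (by positivity) fun y => ?_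
  rcases eq_or_ne y 0 with rfl | hy
  · simp
  have hy' : 0 < ‖y‖ := norm_pos_iff.2 hy
  have hR : 0 < s / (2 * ‖y‖) := by positivity
  have hmem : ∀ ζ ∈ closedBall (0 : ℂ) (s / (2 * ‖y‖)), x + ζ • y ∈ ball x s := by
    intro ζ hζ
    rw [mem_closedBall_zero_iff] at hζ
    rw [mem_ball_iff_norm, add_sub_cancel_left, norm_smul]
    calc ‖ζ‖ * ‖y‖ ≤ s / (2 * ‖y‖) * ‖y‖ := by gcongr
      _ = s / 2 := by field_simp
      _ < s := by linarith
  have hd : ∀ ζ ∈ closedBall (0 : ℂ) (s / (2 * ‖y‖)),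
      HasDerivAt (fun ζ : ℂ => g (x + ζ • y)) (fderiv ℂ g (x + ζ • y) y) ζ := by
    intro ζ hζ
    have h1 := (hg.differentiableAt (isOpen_ball.mem_nhds (hmem ζ hζ))).hasFDerivAt
    have h2 : HasDerivAt (fun ζ : ℂ => x + ζ • y) y ζ := by
      simpa using ((hasDerivAt_id ζ).smul_const y).const_add x
    exact h1.comp_hasDerivAt ζ h2
  have key := Complex.norm_deriv_le_of_forall_mem_sphere_norm_le (f := fun ζ : ℂ => g (x + ζ • y))
    (c := 0) (C := M) hR
    (DifferentiableOn.diffContOnCl (by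
      rw [closure_ball _ hR.ne']
      exact fun ζ hζ => (hd ζ hζ).differentiableAt.differentiableWithinAt))
    (fun ζ hζ => hM _ (hmem ζ (sphere_subset_closedBall hζ)))
  rw [(hd 0 (by simp [hR.le])).deriv] at key
  simp only [zero_smul, add_zero] at key
  refine key.trans (le_of_eq ?_)
  field_simp

/-- Cauchy's estimate is used `n` times, each use costing `s / (n + 1)` of radius, so that a ball of
that radius is left at the end. The growth like `n ^ n` is harmless once divided by `n!`. -/
theorem norm_iteratedFDeriv_le_of_forall_mem_ball {X F : Type*} [NormedAddCommGroup X]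
    [NormedSpace ℂ X] [NormedAddCommGroup F] [NormedSpace ℂ F] {g : X → F} {x : X} {s M : ℝ}
    (hs : 0 < s) (hg : AnalyticOnNhd ℂ g (ball x s)) (hM : ∀ y ∈ ball x s, ‖g y‖ ≤ M) (n : ℕ) :
    ∀ y ∈ ball x (s / (n + 1)), ‖iteratedFDeriv ℂ n g y‖ ≤ M * (2 * (n + 1) / s) ^ n := by
  have main : ∀ k : ℕ, k ≤ n → ∀ y ∈ ball x (s - k * (s / (n + 1))),
      ‖iteratedFDeriv ℂ k g y‖ ≤ M * (2 * (n + 1) / s) ^ k := by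
    intro k
    induction k with
    | zero =>
      intro _ y hy
      simpa using hM y (by simpa using hy)
    | succ k ih =>
      intro hk y hy
      have hpos : 0 < s / (n + 1 : ℝ) := by positivity
      have hsub : ball y (s / (n + 1)) ⊆ ball x (s - k * (s / (n + 1))) := by
        refine ball_subset_ball' ?_
        rw [mem_ball] at hy
        push_cast at hy
        linarith
      have hsub' : ball y (s / (n + 1)) ⊆ ball x s :=
        hsub.trans (ball_subset_ball (by
          have : 0 ≤ (k : ℝ) * (s / (n + 1)) := by positivity
          linarith))
      have hd : DifferentiableOn ℂ (iteratedFDeriv ℂ k g) (ball y (s / (n + 1))) :=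
        ((hg.iteratedFDeriv_of_isOpen isOpen_ball k).mono hsub').differentiableOn
      have := norm_fderiv_le_of_forall_mem_ball hpos hd
        (fun z hz => ih (by omega) z (hsub hz))
      rw [norm_fderiv_iteratedFDeriv] at this
      refine this.trans (le_of_eq ?_)
      rw [pow_succ]
      field_simp
  intro y hy
  refine main n le_rfl y ?_
  have : s - n * (s / (n + 1)) = s / (n + 1 : ℝ) := by field_simp; ring
  rwa [this]

/-- Restriction to the line `ζ ↦ x + ζ • y` reduces this to the one-variable Taylor series,
evaluated at `ζ = 1`; hence the need for a radius `R > 1`. -/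
theorem hasSum_iteratedFDeriv_of_analyticOnNhd {X : Type*} [NormedAddCommGroup X]
    [NormedSpace ℂ X] {g : X → ℂ} {x y : X} {s : ℝ}
    (hg : AnalyticOnNhd ℂ g (ball x s)) (hy : ‖y‖ < s) :
    HasSum (fun n : ℕ => (n.factorial : ℂ)⁻¹ * iteratedFDeriv ℂ n g x fun _ => y) (g (x + y)) := by
  have hs : 0 < s := (norm_nonneg y).trans_lt hy
  obtain ⟨R, hR1, hR⟩ : ∃ R : ℝ, 1 < R ∧ R * ‖y‖ < s := by
    rcases eq_or_ne y 0 with rfl | hy0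
    · exact ⟨2, by norm_num, by simpa using hs⟩
    · have hy' : 0 < ‖y‖ := norm_pos_iff.2 hy0
      obtain ⟨R, h1, h2⟩ := exists_between ((one_lt_div hy').2 hy)
      exact ⟨R, h1, (lt_div_iff₀ hy').1 h2⟩
  have hmem : ∀ ζ ∈ ball (0 : ℂ) R, x + ζ • y ∈ ball x s := by
    intro ζ hζ
    rw [mem_ball_zero_iff] at hζ
    rw [mem_ball_iff_norm, add_sub_cancel_left, norm_smul]
    exact (mul_le_mul_of_nonneg_right hζ.le (norm_nonneg y)).trans_lt hR
  have hline : ∀ ζ : ℂ, HasDerivAt (fun ζ : ℂ => x + ζ • y) y ζ := fun ζ => by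
    simpa using ((hasDerivAt_id ζ).smul_const y).const_add x
  have hiter : ∀ n : ℕ, ∀ ζ ∈ ball (0 : ℂ) R, iteratedDeriv n (fun ζ : ℂ => g (x + ζ • y)) ζ =
      iteratedFDeriv ℂ n g (x + ζ • y) fun _ => y := by
    intro n
    induction n with
    | zero => intro ζ _; simp
    | succ n ih =>
      intro ζ hζ
      rw [iteratedDeriv_succ]
      have h1 := ((hg.iteratedFDeriv_of_isOpen isOpen_ball n) _ (hmem ζ hζ)).differentiableAt
      have h2 := h1.hasFDerivAt.comp_hasDerivAt ζ (hline ζ)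
      have h3 := (ContinuousMultilinearMap.apply ℂ (fun _ : Fin n => X) ℂ
        (fun _ => y)).hasFDerivAt.comp_hasDerivAt ζ h2
      have heq : iteratedDeriv n (fun ζ : ℂ => g (x + ζ • y)) =ᶠ[𝓝 ζ]
          fun ζ => iteratedFDeriv ℂ n g (x + ζ • y) fun _ => y := by
        filter_upwards [isOpen_ball.mem_nhds hζ] with w hw using ih w hw
      rw [heq.deriv_eq]
      refine h3.deriv.trans ?_
      rw [iteratedFDeriv_succ_apply_left]
      rfl
  have hd : DifferentiableOn ℂ (fun ζ : ℂ => g (x + ζ • y)) (ball 0 R) := fun ζ hζ =>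
    ((hg _ (hmem ζ hζ)).differentiableAt.hasFDerivAt.comp_hasDerivAt ζ
      (hline ζ)).differentiableAt.differentiableWithinAt
  have h1 : (1 : ℂ) ∈ ball (0 : ℂ) R := by simpa using hR1
  have := Complex.hasSum_taylorSeries_on_ball hd h1
  simp only [one_smul] at this
  refine this.congr_fun fun n => ?_
  rw [hiter n 0 (mem_ball_self (by linarith))]
  simp

variable {X Y ι : Type*} [NormedAddCommGroup X] [NormedSpace ℂ X] [NormedAddCommGroup Y]
  [NormedSpace ℂ Y]

/-- A family of continuous linear functionals of norm at most one which determines the norm. -/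
structure IsNorming (φ : ι → Y →L[ℂ] ℂ) : Prop where
  norm_apply_le : ∀ i y, ‖φ i y‖ ≤ ‖y‖
  norm_le : ∀ y C, 0 ≤ C → (∀ i, ‖φ i y‖ ≤ C) → ‖y‖ ≤ C

variable {φ : ι → Y →L[ℂ] ℂ}

theorem IsNorming.ext (hφ : IsNorming φ) {y z : Y} (h : ∀ i, φ i y = φ i z) : y = z := by
  have : ‖y - z‖ ≤ 0 := hφ.norm_le _ _ le_rfl fun i => by simp [h i]
  exact sub_eq_zero.1 (norm_le_zero_iff.1 this)

variable [CompleteSpace Y]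

/-- The vector is Cauchy's integral for the derivative, taken in `Y`; the functionals commute with
the integral. Integrability needs continuity of `f`, which is not assumed: each `φ i ∘ f` is
Lipschitz with a constant independent of `i`, and the norm is recovered from the functionals. -/
theorem IsNorming.exists_fderiv (hφ : IsNorming φ) {f : X → Y} {x : X} {s M : ℝ} (hs : 0 < s)
    (hf : ∀ i, AnalyticOnNhd ℂ (fun x => φ i (f x)) (ball x s))
    (hM : ∀ y ∈ ball x s, ‖f y‖ ≤ M) (y : X) :
    ∃ a : Y, ∀ i, φ i a = fderiv ℂ (fun x => φ i (f x)) x y := by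
  have hM0 : 0 ≤ M := (norm_nonneg _).trans (hM x (mem_ball_self hs))
  have hlip : ∀ u ∈ ball x (s / 2), ∀ v ∈ ball x (s / 2), ‖f v - f u‖ ≤ M * (4 / s) * ‖v - u‖ := by
    intro u hu v hv
    refine hφ.norm_le _ _ (by positivity) fun i => ?_
    rw [map_sub]
    refine Convex.norm_image_sub_le_of_norm_fderiv_le (𝕜 := ℂ) (f := fun x => φ i (f x))
      (s := ball x (s / 2)) (fun w hw => ?_) (fun w hw => ?_) (convex_ball _ _) hu hv
    · exact ((hf i) w (ball_subset_ball (by linarith) hw)).differentiableAt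
    · have hsub : ball w (s / 2) ⊆ ball x s := ball_subset_ball' (by
        rw [mem_ball] at hw; linarith)
      refine (norm_fderiv_le_of_forall_mem_ball (half_pos hs) ((hf i).mono hsub).differentiableOn
        (fun z hz => (hφ.norm_apply_le i _).trans (hM z (hsub hz)))).trans (le_of_eq ?_)
      field_simp; ring
  have hcont : ContinuousOn f (ball x (s / 2)) := by
    have : LipschitzOnWith ⟨M * (4 / s), by positivity⟩ f (ball x (s / 2)) :=
      LipschitzOnWith.of_dist_le_mul fun u hu v hv => by
        rw [dist_eq_norm, dist_eq_norm]; exact hlip v hv u hu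
    exact this.continuousOn
  obtain ⟨R, hR, hRs⟩ : ∃ R : ℝ, 0 < R ∧ R * ‖y‖ < s / 2 := by
    refine ⟨s / (4 * (‖y‖ + 1)), by positivity, ?_⟩
    rw [div_mul_eq_mul_div, div_lt_iff₀ (by positivity)]
    nlinarith [norm_nonneg y]
  have hmem : ∀ ζ ∈ closedBall (0 : ℂ) R, x + ζ • y ∈ ball x (s / 2) := by
    intro ζ hζ
    rw [mem_closedBall_zero_iff] at hζ
    rw [mem_ball_iff_norm, add_sub_cancel_left, norm_smul]
    exact (mul_le_mul_of_nonneg_right hζ (norm_nonneg y)).trans_lt hRs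
  have hline : ∀ ζ : ℂ, HasDerivAt (fun ζ : ℂ => x + ζ • y) y ζ := fun ζ => by
    simpa using ((hasDerivAt_id ζ).smul_const y).const_add x
  have hci : CircleIntegrable (fun ζ : ℂ => ((ζ - 0) ^ 2)⁻¹ • f (x + ζ • y)) 0 R := by
    refine ContinuousOn.circleIntegrable hR.le ?_
    refine ContinuousOn.smul (ContinuousOn.inv₀ (by fun_prop) fun ζ hζ => ?_) ?_
    · have : ζ ≠ 0 := by rintro rfl; simp at hζ; exact hR.ne hζ
      simpa using this
    · exact hcont.comp (by fun_prop) fun ζ hζ => hmem ζ (sphere_subset_closedBall hζ)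
  refine ⟨(2 * Real.pi * Complex.I : ℂ)⁻¹ • ∮ ζ in C(0, R), ((ζ - 0) ^ 2)⁻¹ • f (x + ζ • y),
    fun i => ?_⟩
  have hd : ∀ ζ ∈ closedBall (0 : ℂ) R,
      HasDerivAt (fun ζ : ℂ => φ i (f (x + ζ • y))) (fderiv ℂ (fun x => φ i (f x)) (x + ζ • y) y) ζ :=
    fun ζ hζ => HasFDerivAt.comp_hasDerivAt (l := fun x => φ i (f x)) ζ
      ((hf i) _ (ball_subset_ball (by linarith) (hmem ζ hζ))).differentiableAt.hasFDerivAt (hline ζ)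
  have h0 : fderiv ℂ (fun x => φ i (f x)) x y = deriv (fun ζ : ℂ => φ i (f (x + ζ • y))) 0 := by
    rw [(hd 0 (by simp [hR.le])).deriv]; simp
  have hdiff : DiffContOnCl ℂ (fun ζ : ℂ => φ i (f (x + ζ • y))) (ball 0 R) :=
    DifferentiableOn.diffContOnCl (by
      rw [closure_ball _ hR.ne']
      exact fun ζ hζ => (hd ζ hζ).differentiableAt.differentiableWithinAt)
  have hint : φ i (∮ ζ in C(0, R), ((ζ - 0) ^ 2)⁻¹ • f (x + ζ • y)) =
      ∮ ζ in C(0, R), (1 / (ζ - 0) ^ 2) • φ i (f (x + ζ • y)) := by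
    simp only [circleIntegral]
    rw [← ContinuousLinearMap.intervalIntegral_comp_comm _ hci.out]
    simp
  rw [map_smul, hint, hdiff.deriv_eq_smul_circleIntegral hR, h0,
    inv_smul_smul₀ Complex.two_pi_I_ne_zero]

/-- Induction on `n`: near each point the vector representing the `n`-th derivative is again
bounded, by the iterated Cauchy estimates, so `exists_fderiv` applies to it. -/
theorem IsNorming.exists_iteratedFDeriv (hφ : IsNorming φ) {f : X → Y} {x : X} {s M : ℝ}
    (hf : ∀ i, AnalyticOnNhd ℂ (fun x => φ i (f x)) (ball x s))
    (hM : ∀ y ∈ ball x s, ‖f y‖ ≤ M) (n : ℕ) (m : Fin n → X) :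
    ∃ F : X → Y, ∀ y ∈ ball x s, ∀ i,
      φ i (F y) = iteratedFDeriv ℂ n (fun x => φ i (f x)) y m := by
  induction n with
  | zero => exact ⟨f, fun y _ i => by simp⟩
  | succ n ih =>
    obtain ⟨F, hF⟩ := ih (Fin.tail m)
    suffices H : ∀ y ∈ ball x s, ∃ a : Y, ∀ i,
        φ i a = iteratedFDeriv ℂ (n + 1) (fun x => φ i (f x)) y m by
      choose! F' hF' using H
      exact ⟨F', hF'⟩
    intro y hy
    have hs : 0 < s - dist y x := by rw [mem_ball] at hy; linarith
    have hs' : 0 < (s - dist y x) / (n + 1 : ℝ) := by positivity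
    have hsub : ball y (s - dist y x) ⊆ ball x s := ball_subset_ball' (by linarith)
    have hsub' : ball y ((s - dist y x) / (n + 1 : ℝ)) ⊆ ball y (s - dist y x) :=
      ball_subset_ball (div_le_self hs.le (by linarith [n.cast_nonneg (α := ℝ)]))
    have hM0 : 0 ≤ M := (norm_nonneg _).trans (hM y hy)
    have heq : ∀ i, ∀ z ∈ ball x s,
        (fun z => φ i (F z)) =ᶠ[𝓝 z] fun z => iteratedFDeriv ℂ n (fun x => φ i (f x)) z (Fin.tail m) :=
      fun i z hz => by
        filter_upwards [isOpen_ball.mem_nhds hz] with w hw using hF w hw i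
    have han : ∀ i, AnalyticOnNhd ℂ
        (fun z => iteratedFDeriv ℂ n (fun x => φ i (f x)) z (Fin.tail m)) (ball x s) := fun i =>
      (ContinuousMultilinearMap.apply ℂ (fun _ : Fin n => X) ℂ
        (Fin.tail m)).comp_analyticOnNhd ((hf i).iteratedFDeriv_of_isOpen isOpen_ball n)
    obtain ⟨a, ha⟩ := hφ.exists_fderiv (f := F) (x := y)
      (M := M * (2 * (n + 1) / (s - dist y x)) ^ n * ∏ j, ‖Fin.tail m j‖) hs'
      (fun i z hz => (han i z (hsub (hsub' hz))).congr (heq i z (hsub (hsub' hz))).symm)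
      (fun z hz => hφ.norm_le _ _ (by positivity) fun i => by
        rw [hF z (hsub (hsub' hz)) i]
        refine (ContinuousMultilinearMap.le_opNorm _ _).trans ?_
        gcongr
        exact norm_iteratedFDeriv_le_of_forall_mem_ball hs ((hf i).mono hsub)
          (fun w hw => (hφ.norm_apply_le i _).trans (hM w (hsub hw))) n z hz) (m 0)
    refine ⟨a, fun i => ?_⟩
    rw [ha i, (heq i y hy).fderiv_eq, iteratedFDeriv_succ_apply_left]
    have h1 := ((hf i).iteratedFDeriv_of_isOpen isOpen_ball n y hy).differentiableAt.hasFDerivAt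
    have h3 := (ContinuousMultilinearMap.apply ℂ (fun _ : Fin n => X) ℂ
        (Fin.tail m)).hasFDerivAt.comp y h1
    have h4 := h3.fderiv
    have h5 := congrArg (fun L : X →L[ℂ] ℂ => L (m 0)) h4
    exact h5

/-- A bounded function is analytic if its compositions with a norming family of functionals are. -/
theorem IsNorming.analyticAt (hφ : IsNorming φ) {f : X → Y} {x : X} {s M : ℝ} (hs : 0 < s)
    (hf : ∀ i, AnalyticOnNhd ℂ (fun x => φ i (f x)) (ball x s))
    (hM : ∀ y ∈ ball x s, ‖f y‖ ≤ M) : AnalyticAt ℂ f x := by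
  have hM0 : 0 ≤ M := (norm_nonneg _).trans (hM x (mem_ball_self hs))
  have hx : x ∈ ball x s := mem_ball_self hs
  have hD : ∀ (n : ℕ) (m : Fin n → X), ∃ a : Y, ∀ i,
      φ i a = iteratedFDeriv ℂ n (fun x => φ i (f x)) x m := fun n m => by
    obtain ⟨F, hF⟩ := hφ.exists_iteratedFDeriv hf hM n m
    exact ⟨F x, hF x hx⟩
  choose D hD using hD
  have hbound : ∀ n m, ‖D n m‖ ≤ M * (2 * (n + 1) / s) ^ n * ∏ j, ‖m j‖ := fun n m =>
    hφ.norm_le _ _ (by positivity) fun i => by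
      rw [hD]
      refine (ContinuousMultilinearMap.le_opNorm _ _).trans ?_
      gcongr
      exact norm_iteratedFDeriv_le_of_forall_mem_ball hs (hf i)
        (fun w hw => (hφ.norm_apply_le i _).trans (hM w hw)) n x (mem_ball_self (by positivity))
  -- The functionals separate points, so `D n` inherits multilinearity from the scalar derivatives.
  let q : ∀ n, ContinuousMultilinearMap ℂ (fun _ : Fin n => X) Y := fun n =>
    MultilinearMap.mkContinuous
      { toFun := D n
        map_update_add' := fun m j a b => hφ.ext fun i => by
          rw [map_add, hD, hD, hD]
          exact ContinuousMultilinearMap.map_update_add _ _ _ _ _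
        map_update_smul' := fun m j c a => hφ.ext fun i => by
          rw [map_smul, hD, hD]
          exact ContinuousMultilinearMap.map_update_smul _ _ _ _ _ }
      (M * (2 * (n + 1) / s) ^ n) (hbound n)
  have hq : ∀ n m, q n m = D n m := fun n m => rfl
  have hqn : ∀ n, ‖q n‖ ≤ M * (2 * (n + 1) / s) ^ n := fun n =>
    MultilinearMap.mkContinuous_norm_le _ (by positivity) _
  let p : FormalMultilinearSeries ℂ X Y := fun n => (n.factorial : ℂ)⁻¹ • q n
  -- The bound `M (2 (n + 1) / s) ^ n / n!` is at most `M e (2 e / s) ^ n`, because `(n + 1) ^ n /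
  -- n! ≤ e ^ (n + 1)`; this gives the radius `s / (2 e)`.
  let r : NNReal := ⟨s / (2 * Real.exp 1), by positivity⟩
  have hr : 0 < (r : ℝ) := by change 0 < s / (2 * Real.exp 1); positivity
  have hpr : (r : ℝ≥0∞) ≤ p.radius := by
    refine p.le_radius_of_bound (M * Real.exp 1) fun n => ?_
    have h1 : ‖p n‖ ≤ (n.factorial : ℝ)⁻¹ * (M * (2 * (n + 1) / s) ^ n) := by
      change ‖(n.factorial : ℂ)⁻¹ • q n‖ ≤ _
      rw [norm_smul, norm_inv, Complex.norm_natCast]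
      gcongr
      exact hqn n
    have h2 : ((n + 1 : ℕ) : ℝ) ^ (n + 1) / (n + 1).factorial ≤ Real.exp 1 ^ (n + 1) := by
      rw [← Real.exp_nat_mul, mul_one]
      exact Real.pow_div_factorial_le_exp _ (by positivity) _
    have h3 : ((n : ℝ) + 1) ^ n / n.factorial ≤ Real.exp 1 ^ (n + 1) := by
      refine le_trans (le_of_eq ?_) h2
      rw [Nat.factorial_succ]
      push_cast
      field_simp
      ring
    calc ‖p n‖ * (r : ℝ) ^ n
        ≤ (n.factorial : ℝ)⁻¹ * (M * (2 * (n + 1) / s) ^ n) * (s / (2 * Real.exp 1)) ^ n := by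
          gcongr
          exact le_rfl
      _ = M * (((n : ℝ) + 1) ^ n / n.factorial) * (Real.exp 1 ^ n)⁻¹ := by
          simp only [div_pow, mul_pow]
          field_simp
      _ ≤ M * Real.exp 1 ^ (n + 1) * (Real.exp 1 ^ n)⁻¹ := by gcongr
      _ = M * Real.exp 1 := by
          rw [pow_succ]
          field_simp
  refine ⟨p, r, hpr, by exact_mod_cast hr, fun {y} hy => ?_⟩
  have hsum := p.hasSum (eball_subset_eball hpr hy)
  have hys : ‖y‖ < s := by
    have h1 : ‖y‖ < r := by simpa using hy
    have h2 : (r : ℝ) ≤ s := by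
      change s / (2 * Real.exp 1) ≤ s
      refine div_le_self hs.le ?_
      have := Real.add_one_le_exp 1
      linarith
    linarith
  convert hsum using 1
  refine hφ.ext fun i => ?_
  have h1 := hsum.mapL (φ i)
  refine (hasSum_iteratedFDeriv_of_analyticOnNhd (hf i) hys).unique (h1.congr_fun fun n => ?_)
  change _ = φ i ((n.factorial : ℂ)⁻¹ • q n fun _ => y)
  rw [map_smul, hq, hD, smul_eq_mul]

theorem IsNorming.analyticOnNhd (hφ : IsNorming φ) {f : X → Y} {U : Set X} {M : ℝ} (hU : IsOpen U)
    (hf : ∀ i, AnalyticOnNhd ℂ (fun x => φ i (f x)) U)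
    (hM : ∀ y ∈ U, ‖f y‖ ≤ M) : AnalyticOnNhd ℂ f U := by
  intro x hx
  obtain ⟨s, hs, hsub⟩ := Metric.isOpen_iff.1 hU x hx
  exact hφ.analyticAt hs (fun i => (hf i).mono hsub) fun y hy => hM y (hsub hy)

theorem isNorming_boundedContinuousFunction {S : Type*} [TopologicalSpace S] :
    IsNorming fun s : S => BoundedContinuousFunction.evalCLM ℂ (β := ℂ) s where
  norm_apply_le s f := f.norm_coe_le_norm s
  norm_le _ _ hC h := (BoundedContinuousFunction.norm_le hC).2 h

/-- With this family, coordinatewise analyticity and a uniform bound give analyticity with values in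
`ℓ^∞`. -/
theorem isNorming_lp {I : Type*} :
    IsNorming fun i : I => lp.evalCLM ℂ (fun _ : I => ℂ) ∞ i where
  norm_apply_le i f := lp.norm_apply_le_norm ENNReal.top_ne_zero f i
  norm_le _ _ hC h := lp.norm_le_of_forall_le hC h

/-- Integrals of bounded analytic functions depending continuously on a real parameter. -/
theorem analyticOnNhd_intervalIntegral {F : X → ℝ → ℂ} {U : Set X} {M a b : ℝ} (hU : IsOpen U)
    (hF : ∀ θ, AnalyticOnNhd ℂ (fun x => F x θ) U) (hc : ∀ x ∈ U, Continuous (F x))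
    (hM : ∀ x ∈ U, ∀ θ, ‖F x θ‖ ≤ M) :
    AnalyticOnNhd ℂ (fun x => ∫ θ in a..b, F x θ) U := by
  classical
  -- The integrand is viewed as a point of the space of bounded continuous functions, on which
  -- evaluations are norming and integration is a continuous linear functional.
  let B : X → BoundedContinuousFunction ℝ ℂ := fun x =>
    if hx : x ∈ U then BoundedContinuousFunction.ofNormedAddCommGroup (F x) (hc x hx) M (hM x hx)
    else 0
  have hB : ∀ x ∈ U, ∀ θ, B x θ = F x θ := fun x hx θ => by simp [B, dif_pos hx]
  have hBa : AnalyticOnNhd ℂ B U := by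
    refine isNorming_boundedContinuousFunction.analyticOnNhd (M := M) hU (fun θ x hx => ?_)
      fun x hx => ?_
    · refine (hF θ x hx).congr ?_
      filter_upwards [hU.mem_nhds hx] with y hy using (hB y hy θ).symm
    · refine (BoundedContinuousFunction.norm_le ((norm_nonneg _).trans (hM x hx 0))).2 fun θ => ?_
      rw [hB x hx]
      exact hM x hx θ
  let L : BoundedContinuousFunction ℝ ℂ →L[ℂ] ℂ :=
    LinearMap.mkContinuous
      { toFun := fun f => ∫ θ in a..b, f θ
        map_add' := fun f g => intervalIntegral.integral_add
          (f.continuous.intervalIntegrable _ _) (g.continuous.intervalIntegrable _ _)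
        map_smul' := fun c f => intervalIntegral.integral_const_mul c _ }
      |b - a| fun f => by
        rw [mul_comm]
        exact intervalIntegral.norm_integral_le_of_norm_le_const fun θ _ => f.norm_coe_le_norm θ
  intro x hx
  refine ((L.comp_analyticOnNhd hBa) x hx).congr ?_
  filter_upwards [hU.mem_nhds hx] with y hy
  exact intervalIntegral.integral_congr fun θ _ => hB y hy θ

end WeakAnalyticity

noncomputable section

namespace OpenNodes

open Filter

/-! ### Banach spaces of families with finite `SeqNorm` -/

/-- If the `i`-th coordinate of `u n - a` stays of size `η`, monotonicity bounds the norm below by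
that of `η` times the `i`-th unit sequence, which is positive by definiteness. -/
theorem SeqNorm.tendsto_apply {ι : Type*} (N : SeqNorm ι) {u : ℕ → ι → ℂ} {a : ι → ℂ}
    (h : Tendsto (fun n => N.toFun (u n - a)) atTop (𝓝 0)) (i : ι) :
    Tendsto (fun n => u n i) atTop (𝓝 (a i)) := by
  classical
  rw [Metric.tendsto_atTop]
  intro η hη
  let w : ι → ℂ := fun j => if j = i then (η : ℂ) else 0
  have hw : 0 < N.toFun w := by
    refine pos_iff_ne_zero.2 fun h0 => ?_
    have := congrFun (N.eq_zero' _ h0) i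
    simp [w] at this
    exact hη.ne' this
  obtain ⟨M, hM⟩ := eventually_atTop.1 (h.eventually (gt_mem_nhds hw))
  refine ⟨M, fun n hn => ?_⟩
  by_contra hcon
  rw [not_lt, dist_eq_norm] at hcon
  refine (hM n hn).not_ge (N.mono' _ _ fun j => ?_)
  by_cases hj : j = i
  · subst hj
    simpa [w, abs_of_pos hη] using hcon
  · simp [w, hj]

section SeqSpace

variable {ι : Type*} (N : SeqNorm ι) (F : Type*) [NormedAddCommGroup F] [NormedSpace ℂ F]

/-- The families in `F` whose norms form a sequence of finite norm. -/
def seqSubmodule : Submodule ℂ (ι → F) where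
  carrier := {f | N.enorm (fun i => ‖f i‖ₑ) < ∞}
  zero_mem' := by
    simp only [Set.mem_ofPred_eq, Pi.zero_apply, enorm_zero, N.enorm_zero]
    exact ENNReal.zero_lt_top
  add_mem' := by
    intro a b ha hb
    exact ((N.enorm_mono fun i => enorm_add_le _ _).trans (N.enorm_add_le _ _)).trans_lt
      (ENNReal.add_lt_top.2 ⟨ha, hb⟩)
  smul_mem' := by
    intro c a ha
    simp only [Set.mem_ofPred_eq, Pi.smul_apply, enorm_smul] at ha ⊢
    rw [N.enorm_const_mul c ha]
    exact ENNReal.mul_lt_top enorm_lt_top ha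

/-- The normed space of families in `F` whose norms form a sequence of finite norm. -/
def SeqSpace : Type _ := ↥(seqSubmodule N F)

namespace SeqSpace

variable {N F}

instance : AddCommGroup (SeqSpace N F) := inferInstanceAs (AddCommGroup ↥(seqSubmodule N F))

instance : Module ℂ (SeqSpace N F) := inferInstanceAs (Module ℂ ↥(seqSubmodule N F))

/-- The family underlying an element of `SeqSpace`. -/
def fam (f : SeqSpace N F) : ι → F := Subtype.val f

/-- The element of `SeqSpace` given by a family of finite norm. -/
def mk (f : ι → F) (hf : N.enorm (fun i => ‖f i‖ₑ) < ∞) : SeqSpace N F := ⟨f, hf⟩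

theorem fam_mk (f : ι → F) (hf : N.enorm (fun i => ‖f i‖ₑ) < ∞) : (mk f hf).fam = f := rfl

theorem fam_sub (f g : SeqSpace N F) : (f - g).fam = f.fam - g.fam := rfl

theorem ext {f g : SeqSpace N F} (h : f.fam = g.fam) : f = g := Subtype.ext h

theorem enorm_lt_top (f : SeqSpace N F) : N.enorm (fun i => ‖f.fam i‖ₑ) < ∞ := f.2

instance : Norm (SeqSpace N F) := ⟨fun f => (N.enorm fun i => ‖f.fam i‖ₑ).toReal⟩

theorem norm_def (f : SeqSpace N F) : ‖f‖ = (N.enorm fun i => ‖f.fam i‖ₑ).toReal := rfl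

theorem core : NormedSpace.Core ℂ (SeqSpace N F) where
  norm_nonneg _ := ENNReal.toReal_nonneg
  norm_smul c f := by
    have h := N.enorm_const_mul c f.enorm_lt_top
    rw [norm_def, norm_def, ← toReal_enorm c, ← ENNReal.toReal_mul, ← h]
    congr 2
    funext i
    exact enorm_smul _ _
  norm_triangle a b := by
    have h : N.enorm (fun i => ‖(a + b).fam i‖ₑ) ≤ _ :=
      (N.enorm_mono fun i => _root_.enorm_add_le (a.fam i) (b.fam i)).trans (N.enorm_add_le _ _)
    have hfin := ENNReal.add_ne_top.2 ⟨a.enorm_lt_top.ne, b.enorm_lt_top.ne⟩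
    have h' := ENNReal.toReal_mono hfin h
    rwa [ENNReal.toReal_add a.enorm_lt_top.ne b.enorm_lt_top.ne] at h'
  norm_eq_zero_iff f := by
    constructor
    · intro h
      rw [norm_def, ENNReal.toReal_eq_zero_iff, or_iff_left f.enorm_lt_top.ne] at h
      refine ext (funext fun i => ?_)
      exact enorm_eq_zero.1 (N.enorm_eq_zero h i)
    · rintro rfl
      change (N.enorm fun i => ‖(0 : F)‖ₑ).toReal = 0
      simp [N.enorm_zero]

instance : NormedAddCommGroup (SeqSpace N F) := NormedAddCommGroup.ofCore core

instance : NormedSpace ℂ (SeqSpace N F) := NormedSpace.ofCore core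

theorem toFun_norm (f : SeqSpace N F) : N.toFun (fun i => (‖f.fam i‖ : ℂ)) = ENNReal.ofReal ‖f‖ := by
  rw [norm_def, ENNReal.ofReal_toReal f.enorm_lt_top.ne, N.enorm_of_ne_top fun i => enorm_ne_top]
  simp

theorem toFun_norm_lt_top (f : SeqSpace N F) : N.toFun (fun i => (‖f.fam i‖ : ℂ)) < ∞ := by
  rw [toFun_norm]; exact ENNReal.ofReal_lt_top

theorem enorm_le_toFun {F : Type*} [NormedAddCommGroup F] {f : ι → F} {u : ι → ℝ} (h : ∀ i, ‖f i‖ ≤ u i) :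
    N.enorm (fun i => ‖f i‖ₑ) ≤ N.toFun fun i => (u i : ℂ) := by
  rw [N.enorm_of_ne_top fun i => enorm_ne_top]
  refine N.mono' _ _ fun i => ?_
  simpa using (h i).trans (le_abs_self _)

/-- The element of `SeqSpace` given by a family bounded by a sequence of finite norm. -/
def ofBound (f : ι → F) (u : ι → ℝ) (h : ∀ i, ‖f i‖ ≤ u i) (hu : N.toFun (fun i => (u i : ℂ)) < ∞) :
    SeqSpace N F := mk f ((enorm_le_toFun h).trans_lt hu)

theorem norm_le_of_bound (f : SeqSpace N F) {u : ι → ℝ} (h : ∀ i, ‖f.fam i‖ ≤ u i) {C : ℝ}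
    (hC : 0 ≤ C) (hu : N.toFun (fun i => (u i : ℂ)) ≤ ENNReal.ofReal C) : ‖f‖ ≤ C := by
  rw [norm_def]
  exact ENNReal.toReal_le_of_le_ofReal hC ((enorm_le_toFun h).trans hu)

theorem sum_apply {s : Finset ℕ} (u : ℕ → SeqSpace N F) (i : ι) :
    (∑ n ∈ s, u n).fam i = ∑ n ∈ s, (u n).fam i := by
  have : (∑ n ∈ s, u n).fam = ∑ n ∈ s, (u n).fam :=
    map_sum (seqSubmodule N F).subtype (fun n => (u n : ↥(seqSubmodule N F))) s
  rw [this, Finset.sum_apply]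

/-- It suffices to sum absolutely convergent series. The partial sums of the scalar sequences `‖(u
n).fam i‖` are Cauchy for `N`, hence converge by completeness of the sequence space; the remainder
of the vector series is dominated coordinatewise by the remainder of the scalar one, and
monotonicity transfers the convergence. -/
instance [CompleteSpace F] : CompleteSpace (SeqSpace N F) := by
  refine NormedAddCommGroup.completeSpace_of_summable_imp_tendsto fun u hu => ?_
  let A : ℕ → ι → ℂ := fun m i => ∑ n ∈ Finset.range m, (‖(u n).fam i‖ : ℂ)
  have hA_le : ∀ s : Finset ℕ, N.toFun (fun i => ∑ n ∈ s, (‖(u n).fam i‖ : ℂ)) ≤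
      ENNReal.ofReal (∑ n ∈ s, ‖u n‖) := by
    intro s
    induction s using Finset.cons_induction with
    | empty => simpa using (show N.toFun (fun _ => 0) = 0 from N.zero')
    | cons a s ha ih =>
      simp only [Finset.sum_cons]
      rw [ENNReal.ofReal_add (norm_nonneg _) (Finset.sum_nonneg fun _ _ => norm_nonneg _),
        ← toFun_norm]
      exact (N.add_le' _ _).trans (add_le_add le_rfl ih)
  have hcs := hu.hasSum.tendsto_sum_nat.cauchySeq
  obtain ⟨a, ha, hlim⟩ := N.complete' A
    (fun m => (hA_le _).trans_lt ENNReal.ofReal_lt_top) (by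
      intro η hη
      rcases eq_or_ne η ∞ with rfl | hη'
      · exact ⟨0, fun _ _ _ _ => le_top⟩
      obtain ⟨M, hM⟩ := Metric.cauchySeq_iff.1 hcs η.toReal (ENNReal.toReal_pos hη.ne' hη')
      have key : ∀ m ≥ M, ∀ n ≥ m, N.toFun (A m - A n) ≤ η := by
        intro m hm n hn
        have h1 : N.toFun (A m - A n) ≤
            N.toFun fun i => ∑ k ∈ Finset.Ico m n, (‖(u k).fam i‖ : ℂ) := by
          refine N.mono' _ _ fun i => le_of_eq ?_
          rw [Pi.sub_apply, norm_sub_rev, Finset.sum_Ico_eq_sub _ hn]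
        refine (h1.trans (hA_le _)).trans ?_
        have h2 := (hM n (hm.trans hn) m hm).le
        rw [Real.dist_eq, ← Finset.sum_Ico_eq_sub _ hn] at h2
        rw [← ENNReal.ofReal_toReal hη']
        exact ENNReal.ofReal_le_ofReal ((le_abs_self _).trans h2)
      refine ⟨M, fun m hm n hn => ?_⟩
      rcases le_total m n with h | h
      · exact key m hm n h
      · have : N.toFun (A m - A n) ≤ N.toFun (A n - A m) :=
          N.mono' _ _ fun i => by simp only [Pi.sub_apply]; rw [norm_sub_rev]
        exact this.trans (key n hn m h))
  have hpt := fun i => N.tendsto_apply hlim i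
  have hA_real : ∀ m i, A m i = ((∑ n ∈ Finset.range m, ‖(u n).fam i‖ : ℝ) : ℂ) := fun m i => by
    simp [A]
  have hre : ∀ i, Tendsto (fun m => ∑ n ∈ Finset.range m, ‖(u n).fam i‖) atTop (𝓝 (a i).re) := by
    intro i
    have := (Complex.continuous_re.tendsto _).comp (hpt i)
    refine this.congr fun m => ?_
    simp [hA_real]
  have hhs : ∀ i, HasSum (fun n => ‖(u n).fam i‖) (a i).re := fun i =>
    (hasSum_iff_tendsto_nat_of_nonneg (fun _ => norm_nonneg _) _).2 (hre i)
  have him : ∀ i, (a i).im = 0 := fun i => by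
    refine tendsto_nhds_unique ((Complex.continuous_im.tendsto _).comp (hpt i)) ?_
    refine tendsto_const_nhds.congr fun m => ?_
    simp [hA_real]
  let f : ι → F := fun i => ∑' n, (u n).fam i
  have hdist : ∀ m i, ‖(∑ n ∈ Finset.range m, (u n).fam i) - f i‖ ≤ ‖(A m - a) i‖ := by
    intro m i
    have hs : Summable fun n => (u n).fam i := Summable.of_norm (hhs i).summable
    have h1 : (∑ n ∈ Finset.range m, (u n).fam i) - f i = -∑' n, (u (n + m)).fam i := by
      change _ - (∑' n, (u n).fam i) = _
      rw [← hs.sum_add_tsum_nat_add m]; abel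
    have h2 : (A m - a) i = -((∑' n, ‖(u (n + m)).fam i‖ : ℝ) : ℂ) := by
      have h3 := (hhs i).summable.sum_add_tsum_nat_add m
      rw [(hhs i).tsum_eq] at h3
      rw [Pi.sub_apply, hA_real, ← Complex.re_add_im (a i), him i, ← h3]
      push_cast
      ring
    have hs' : Summable fun n => ‖(u (n + m)).fam i‖ := (summable_nat_add_iff m).2 (hhs i).summable
    rw [h1, h2, norm_neg, norm_neg, Complex.norm_real, Real.norm_eq_abs]
    exact (norm_tsum_le_tsum_norm hs').trans (le_abs_self _)
  have hbd : ∀ m, N.enorm (fun i => ‖(∑ n ∈ Finset.range m, (u n).fam i) - f i‖ₑ) ≤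
      N.toFun (A m - a) := fun m =>
    (enorm_le_toFun (hdist m)).trans (N.mono' _ _ fun i => by simp)
  obtain ⟨m₀, hm₀⟩ := (hlim.eventually (gt_mem_nhds ENNReal.zero_lt_top)).exists
  have hmem : N.enorm (fun i => ‖f i‖ₑ) < ∞ := by
    change f ∈ seqSubmodule N F
    have h1 : (fun i => (∑ n ∈ Finset.range m₀, (u n).fam i) - f i) ∈ seqSubmodule N F :=
      (hbd m₀).trans_lt hm₀
    have h2 : (fun i => ∑ n ∈ Finset.range m₀, (u n).fam i) ∈ seqSubmodule N F := by
      have := (∑ n ∈ Finset.range m₀, u n).2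
      convert this using 1
      funext i
      exact (sum_apply u i).symm
    have h3 := (seqSubmodule N F).sub_mem h2 h1
    convert h3 using 1
    funext i
    simp
  refine ⟨mk f hmem, ?_⟩
  rw [tendsto_iff_norm_sub_tendsto_zero]
  have hlim' : Tendsto (fun m => (N.toFun (A m - a)).toReal) atTop (𝓝 0) := by
    have := (ENNReal.tendsto_toReal ENNReal.zero_ne_top).comp hlim
    rwa [ENNReal.toReal_zero] at this
  have hfin : ∀ᶠ m in atTop, N.toFun (A m - a) < ∞ := hlim.eventually (gt_mem_nhds ENNReal.zero_lt_top)
  refine tendsto_of_tendsto_of_tendsto_of_le_of_le' tendsto_const_nhds hlim'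
    (Eventually.of_forall fun m => norm_nonneg _) ?_
  filter_upwards [hfin] with m hm
  rw [norm_def]
  refine ENNReal.toReal_mono hm.ne (le_trans (le_of_eq ?_) (hbd m))
  congr 1
  funext i
  congr 1
  rw [fam_sub, fam_mk, Pi.sub_apply, sum_apply]

end SeqSpace

end SeqSpace

/-! ### Operators given by kernels -/

section Kernel

variable {V E : Type*} {G : OrientedMultigraph V E}

theorem OrientedMultigraph.LocallyFinite.finite_base (hfin : G.LocallyFinite) (v : V) :
    {h : E × Bool | G.base h = v}.Finite := by
  refine ((hfin v).prod (Set.finite_univ (α := Bool))).subset ?_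
  rintro ⟨e, σ⟩ h
  refine ⟨?_, Set.mem_univ _⟩
  simp only [OrientedMultigraph.base, Set.mem_ofPred_eq] at h
  simp only [OrientedMultigraph.edgesAt, Set.mem_ofPred_eq]
  cases σ
  · exact Or.inl (by simpa using h)
  · exact Or.inr (by simpa using h)

/-- The half-edges based at `v`. -/
def OrientedMultigraph.LocallyFinite.halfEdges (hfin : G.LocallyFinite) (v : V) :
    Finset (E × Bool) := (hfin.finite_base v).toFinset

theorem OrientedMultigraph.LocallyFinite.mem_halfEdges (hfin : G.LocallyFinite) {v : V}
    {h : E × Bool} : h ∈ hfin.halfEdges v ↔ G.base h = v := by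
  simp [OrientedMultigraph.LocallyFinite.halfEdges]

open Classical in
/-- The half-edges based at one of the ends of `e`. -/
def OrientedMultigraph.LocallyFinite.nearby (hfin : G.LocallyFinite) (e : E) :
    Finset (E × Bool) := hfin.halfEdges (G.src e) ∪ hfin.halfEdges (G.tgt e)

theorem OrientedMultigraph.LocallyFinite.mem_nearby_of_base_eq (hfin : G.LocallyFinite)
    {h k : E × Bool} (hk : G.base k = G.base h) : k ∈ hfin.nearby h.1 := by
  rcases h with ⟨e, _ | _⟩ <;>
  simp only [OrientedMultigraph.LocallyFinite.nearby, Finset.mem_union,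
    hfin.mem_halfEdges, hk] <;> simp [OrientedMultigraph.base]

theorem OrientedMultigraph.LocallyFinite.mem_nearby (hfin : G.LocallyFinite)
    (e : E) (σ : Bool) : (e, σ) ∈ hfin.nearby e :=
  hfin.mem_nearby_of_base_eq (h := (e, σ)) rfl

variable {NE : SeqNorm E} {NV : SeqNorm V}

theorem SeqNorm.toFun_mono_real {ι : Type*} (N : SeqNorm ι) {u v : ι → ℝ} (hu : ∀ i, 0 ≤ u i)
    (h : ∀ i, u i ≤ v i) : N.toFun (fun i => (u i : ℂ)) ≤ N.toFun fun i => (v i : ℂ) :=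
  N.mono' _ _ fun i => by
    simpa [abs_of_nonneg (hu i), abs_of_nonneg ((hu i).trans (h i))] using h i

theorem SeqNorm.toFun_const_mul {ι : Type*} (N : SeqNorm ι) {c : ℝ} (hc : 0 ≤ c) {u : ι → ℝ}
    (hu : N.toFun (fun i => (u i : ℂ)) < ∞) :
    N.toFun (fun i => ((c * u i : ℝ) : ℂ)) = ENNReal.ofReal c * N.toFun fun i => (u i : ℂ) := by
  have h := N.smul' (c : ℂ) _ hu
  have hc' : ‖(c : ℂ)‖ₑ = ENNReal.ofReal c := by
    rw [← ofReal_norm, Complex.norm_real, Real.norm_eq_abs, abs_of_nonneg hc]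
  rw [hc'] at h
  rw [← h]
  congr 1
  funext i
  simp

/-- The half-edges at `v` lie in `G.edgesAt v` times the two signs, which explains the factor 2; a
loop really does occur twice. -/
theorem AdmissibleNorms.exists_halfEdges_bound (hN : AdmissibleNorms G NE NV)
    (hfin : G.LocallyFinite) : ∃ C : ℝ, 0 ≤ C ∧ ∀ u : E → ℝ, (∀ e, 0 ≤ u e) →
      NE.toFun (fun e => (u e : ℂ)) < ∞ →
      NV.toFun (fun v => ((∑ k ∈ hfin.halfEdges v, u k.1 : ℝ) : ℂ)) ≤
        ENNReal.ofReal C * NE.toFun (fun e => (u e : ℂ)) := by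
  classical
  obtain ⟨C, hC, h⟩ := hN.sum_bounded
  refine ⟨2 * C, by positivity, fun u hu hfu => ?_⟩
  have h1 := h _ hfu
  have hfin' : NV.toFun (fun v => ((∑ᶠ e ∈ G.edgesAt v, ‖(u e : ℂ)‖ : ℝ) : ℂ)) < ∞ :=
    h1.trans_lt (ENNReal.mul_lt_top ENNReal.ofReal_lt_top hfu)
  have h2 : ∀ v, ∑ k ∈ hfin.halfEdges v, u k.1 ≤ 2 * ∑ᶠ e ∈ G.edgesAt v, ‖(u e : ℂ)‖ := by
    intro v
    rw [finsum_mem_eq_finite_toFinset_sum _ (hfin v)]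
    have hsub : hfin.halfEdges v ⊆ (hfin v).toFinset ×ˢ Finset.univ := by
      rintro ⟨e, σ⟩ hk
      rw [hfin.mem_halfEdges] at hk
      simp only [Finset.mem_product, Set.Finite.mem_toFinset, Finset.mem_univ, and_true,
        OrientedMultigraph.edgesAt, Set.mem_ofPred_eq]
      cases σ
      · exact Or.inl (by simpa [OrientedMultigraph.base] using hk)
      · exact Or.inr (by simpa [OrientedMultigraph.base] using hk)
    refine (Finset.sum_le_sum_of_subset_of_nonneg hsub fun k _ _ => hu k.1).trans (le_of_eq ?_)
    rw [Finset.sum_product, Finset.mul_sum]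
    refine Finset.sum_congr rfl fun e _ => ?_
    simp [abs_of_nonneg (hu e)]
  calc _ ≤ NV.toFun (fun v => ((2 * ∑ᶠ e ∈ G.edgesAt v, ‖(u e : ℂ)‖ : ℝ) : ℂ)) :=
        NV.toFun_mono_real (fun v => Finset.sum_nonneg fun k _ => hu k.1) h2
    _ = ENNReal.ofReal 2 * NV.toFun (fun v => ((∑ᶠ e ∈ G.edgesAt v, ‖(u e : ℂ)‖ : ℝ) : ℂ)) :=
        NV.toFun_const_mul (by norm_num) hfin'
    _ ≤ ENNReal.ofReal 2 * (ENNReal.ofReal C * NE.toFun (fun e => (u e : ℂ))) := by gcongr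
    _ = _ := by rw [ENNReal.ofReal_mul (by norm_num), mul_assoc]

theorem AdmissibleNorms.exists_ends_bound (hN : AdmissibleNorms G NE NV) :
    ∃ C : ℝ, 0 ≤ C ∧ ∀ u : V → ℝ, (∀ v, 0 ≤ u v) → NV.toFun (fun v => (u v : ℂ)) < ∞ →
      NE.toFun (fun e => ((u (G.src e) + u (G.tgt e) : ℝ) : ℂ)) ≤
        ENNReal.ofReal C * NV.toFun (fun v => (u v : ℂ)) := by
  obtain ⟨C, hC, h⟩ := hN.ends_bounded
  refine ⟨C, hC, fun u hu hfu => ?_⟩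
  refine le_trans (le_of_eq ?_) (h _ hfu)
  congr 1
  funext e
  simp [abs_of_nonneg (hu _)]

/-- The two boundedness conditions are composed, going from edges to vertices and back to edges. -/
theorem AdmissibleNorms.exists_nearby_bound (hN : AdmissibleNorms G NE NV)
    (hfin : G.LocallyFinite) : ∃ C : ℝ, 0 ≤ C ∧ ∀ u : E → ℝ, (∀ e, 0 ≤ u e) →
      NE.toFun (fun e => (u e : ℂ)) < ∞ →
      NE.toFun (fun e => ((∑ k ∈ hfin.nearby e, u k.1 : ℝ) : ℂ)) ≤
        ENNReal.ofReal C * NE.toFun (fun e => (u e : ℂ)) := by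
  classical
  obtain ⟨C₁, hC₁, h₁⟩ := hN.exists_halfEdges_bound hfin
  obtain ⟨C₂, hC₂, h₂⟩ := hN.exists_ends_bound
  refine ⟨C₂ * C₁, by positivity, fun u hu hfu => ?_⟩
  have hnn : ∀ v, 0 ≤ ∑ k ∈ hfin.halfEdges v, u k.1 := fun v => Finset.sum_nonneg fun k _ => hu k.1
  have h3 := h₂ _ hnn ((h₁ u hu hfu).trans_lt (ENNReal.mul_lt_top ENNReal.ofReal_lt_top hfu))
  calc _ ≤ NE.toFun (fun e => ((∑ k ∈ hfin.halfEdges (G.src e), u k.1 +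
          ∑ k ∈ hfin.halfEdges (G.tgt e), u k.1 : ℝ) : ℂ)) := by
        refine NE.toFun_mono_real (fun e => Finset.sum_nonneg fun k _ => hu k.1) fun e => ?_
        rw [← Finset.sum_union_inter]
        exact le_add_of_nonneg_right (Finset.sum_nonneg fun k _ => hu k.1)
    _ ≤ _ := h3
    _ ≤ ENNReal.ofReal C₂ * (ENNReal.ofReal C₁ * NE.toFun (fun e => (u e : ℂ))) := by
        gcongr; exact h₁ u hu hfu
    _ = _ := by rw [ENNReal.ofReal_mul hC₂, mul_assoc]

/-- The fibre over an edge of the space of coefficients: bounded sequences for both signs. -/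
abbrev CoeffFibre := lp (fun _ : Bool × ℕ => ℂ) ∞

/-- The Banach space of coefficients indexed by half-edges and natural numbers. -/
abbrev CoeffSpace (NE : SeqNorm E) := SeqSpace NE CoeffFibre

/-- The coefficient of index `n` at the half-edge `h`. -/
def coef (c : CoeffSpace NE) (h : E × Bool) (n : ℕ) : ℂ := c.fam h.1 (h.2, n)

theorem coef_add (c d : CoeffSpace NE) (h : E × Bool) (n : ℕ) :
    coef (c + d) h n = coef c h n + coef d h n := rfl

theorem coef_smul (a : ℂ) (c : CoeffSpace NE) (h : E × Bool) (n : ℕ) :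
    coef (a • c) h n = a * coef c h n := rfl

theorem norm_coef_le (c : CoeffSpace NE) (h : E × Bool) (n : ℕ) :
    ‖coef c h n‖ ≤ ‖c.fam h.1‖ := lp.norm_apply_le_norm ENNReal.top_ne_zero (c.fam h.1) (h.2, n)

theorem coef_ext {c d : CoeffSpace NE} (H : ∀ h n, coef c h n = coef d h n) : c = d :=
  SeqSpace.ext (funext fun e => lp.ext (funext fun x => H (e, x.1) x.2))

/-- The element of the space of coefficients with given coefficients. -/
def coeffOfBound (f : E × Bool → ℕ → ℂ) (u : E → ℝ) (hf : ∀ h n, ‖f h n‖ ≤ u h.1)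
    (hu : NE.toFun (fun e => (u e : ℂ)) < ∞) : CoeffSpace NE :=
  SeqSpace.ofBound
    (fun e => ⟨fun x => f (e, x.1) x.2, memℓp_infty ⟨u e, by rintro _ ⟨x, rfl⟩; exact hf _ _⟩⟩) u
    (fun e => lp.norm_le_of_forall_le ((norm_nonneg _).trans (hf (e, true) 0)) fun x => hf _ _) hu

theorem norm_coeffSpace_le (c : CoeffSpace NE) {u : E → ℝ} (h : ∀ k n, ‖coef c k n‖ ≤ u k.1)
    {C : ℝ} (hC : 0 ≤ C) (hu : NE.toFun (fun e => (u e : ℂ)) ≤ ENNReal.ofReal C) : ‖c‖ ≤ C :=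
  c.norm_le_of_bound (fun e => lp.norm_le_of_forall_le ((norm_nonneg _).trans (h (e, true) 0))
    fun x => h (e, x.1) x.2) hC hu

variable (E) in
/-- Bounded kernels. -/
abbrev KernelSpace := lp (fun _ : ((E × Bool) × ℕ) × ((E × Bool) × ℕ) => ℂ) ∞

theorem norm_kernel_term_le (κ : KernelSpace E) (c : CoeffSpace NE) (h k : E × Bool) (m n : ℕ) :
    ‖(2 : ℂ)⁻¹ ^ n * κ ((h, m), (k, n)) * coef c k n‖ ≤
      2⁻¹ ^ n * (‖κ‖ * ‖c.fam k.1‖) := by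
  rw [norm_mul, norm_mul, norm_pow, norm_inv, Complex.norm_ofNat, mul_assoc]
  have h1 := lp.norm_apply_le_norm ENNReal.top_ne_zero κ ((h, m), (k, n))
  have h2 := norm_coef_le c k n
  gcongr

theorem summable_half_pow_mul (C : ℝ) : Summable fun n : ℕ => (2⁻¹ : ℝ) ^ n * C :=
  (summable_geometric_of_lt_one (by norm_num) (by norm_num)).mul_right C

theorem summable_kernel_term (κ : KernelSpace E) (c : CoeffSpace NE) (h k : E × Bool) (m : ℕ) :
    Summable fun n => (2 : ℂ)⁻¹ ^ n * κ ((h, m), (k, n)) * coef c k n :=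
  Summable.of_norm_bounded (summable_half_pow_mul _) fun n => norm_kernel_term_le κ c h k m n

theorem norm_kernel_sum_le (hfin : G.LocallyFinite) (κ : KernelSpace E) (c : CoeffSpace NE)
    (h : E × Bool) (m : ℕ) :
    ‖∑ k ∈ hfin.nearby h.1, ∑' n, (2 : ℂ)⁻¹ ^ n * κ ((h, m), (k, n)) * coef c k n‖ ≤
      2 * ‖κ‖ * ∑ k ∈ hfin.nearby h.1, ‖c.fam k.1‖ := by
  rw [Finset.mul_sum]
  refine norm_sum_le_of_le _ fun k _ => ?_
  refine (tsum_of_norm_bounded (summable_half_pow_mul _).hasSum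
    fun n => norm_kernel_term_le κ c h k m n).trans (le_of_eq ?_)
  rw [tsum_mul_right, tsum_geometric_of_lt_one (by norm_num) (by norm_num)]
  ring

/-- The weights `2⁻ⁿ` make any bounded kernel summable in `n`, and the sum over `k` runs over the
finitely many half-edges at the ends of the edge, so `exists_nearby_bound` gives the norm bound `2 C
‖κ‖ ‖c‖`. Since `L` is linear and continuous in `κ`, the operator depends analytically on parameters
as soon as its kernel does. -/
theorem exists_kernelOperator (hN : AdmissibleNorms G NE NV) (hfin : G.LocallyFinite) :
    ∃ L : KernelSpace E →L[ℂ] CoeffSpace NE →L[ℂ] CoeffSpace NE, ∀ κ c h m,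
      coef (L κ c) h m =
        ∑ k ∈ hfin.nearby h.1, ∑' n, (2 : ℂ)⁻¹ ^ n * κ ((h, m), (k, n)) * coef c k n := by
  obtain ⟨C, hC, hb⟩ := hN.exists_nearby_bound hfin
  have hfinite : ∀ (κ : KernelSpace E) (c : CoeffSpace NE),
      NE.toFun (fun e => ((2 * ‖κ‖ * ∑ k ∈ hfin.nearby e, ‖c.fam k.1‖ : ℝ) : ℂ)) ≤
        ENNReal.ofReal (2 * C * ‖κ‖ * ‖c‖) := by
    intro κ c
    have h1 := hb _ (fun e => norm_nonneg (c.fam e)) c.toFun_norm_lt_top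
    rw [NE.toFun_const_mul (by positivity)
      (h1.trans_lt (ENNReal.mul_lt_top ENNReal.ofReal_lt_top c.toFun_norm_lt_top))]
    rw [c.toFun_norm] at h1
    calc _ ≤ ENNReal.ofReal (2 * ‖κ‖) * (ENNReal.ofReal C * ENNReal.ofReal ‖c‖) := by gcongr
      _ = _ := by
        rw [← ENNReal.ofReal_mul hC, ← ENNReal.ofReal_mul (by positivity)]
        congr 1
        ring
  let T : KernelSpace E → CoeffSpace NE → CoeffSpace NE := fun κ c =>
    coeffOfBound
      (fun h m => ∑ k ∈ hfin.nearby h.1, ∑' n, (2 : ℂ)⁻¹ ^ n * κ ((h, m), (k, n)) * coef c k n)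
      (fun e => 2 * ‖κ‖ * ∑ k ∈ hfin.nearby e, ‖c.fam k.1‖)
      (fun h m => norm_kernel_sum_le hfin κ c h m)
      ((hfinite κ c).trans_lt ENNReal.ofReal_lt_top)
  have hT : ∀ κ c h m, coef (T κ c) h m =
      ∑ k ∈ hfin.nearby h.1, ∑' n, (2 : ℂ)⁻¹ ^ n * κ ((h, m), (k, n)) * coef c k n :=
    fun _ _ _ _ => rfl
  refine ⟨LinearMap.mkContinuous₂ (LinearMap.mk₂ ℂ T ?_ ?_ ?_ ?_) (2 * C) fun κ c => ?_,
    fun κ c h m => hT κ c h m⟩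
  · intro κ κ' c
    refine coef_ext fun h m => ?_
    rw [coef_add, hT, hT, hT, ← Finset.sum_add_distrib]
    refine Finset.sum_congr rfl fun k _ => ?_
    rw [← (summable_kernel_term κ c h k m).tsum_add (summable_kernel_term κ' c h k m)]
    refine tsum_congr fun n => ?_
    rw [lp.coeFn_add, Pi.add_apply]
    ring
  · intro a κ c
    refine coef_ext fun h m => ?_
    rw [coef_smul, hT, hT, Finset.mul_sum]
    refine Finset.sum_congr rfl fun k _ => ?_
    rw [← tsum_mul_left]
    refine tsum_congr fun n => ?_
    rw [lp.coeFn_smul, Pi.smul_apply, smul_eq_mul]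
    ring
  · intro κ c c'
    refine coef_ext fun h m => ?_
    rw [coef_add, hT, hT, hT, ← Finset.sum_add_distrib]
    refine Finset.sum_congr rfl fun k _ => ?_
    rw [← (summable_kernel_term κ c h k m).tsum_add (summable_kernel_term κ c' h k m)]
    refine tsum_congr fun n => ?_
    rw [coef_add]
    ring
  · intro a κ c
    refine coef_ext fun h m => ?_
    rw [coef_smul, hT, hT, Finset.mul_sum]
    refine Finset.sum_congr rfl fun k _ => ?_
    rw [← tsum_mul_left]
    refine tsum_congr fun n => ?_
    rw [coef_smul]
    ring
  · refine norm_coeffSpace_le _ (fun h m => ?_) (by positivity) (hfinite κ c)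
    exact norm_kernel_sum_le hfin κ c h m

end Kernel

end OpenNodes

end

/-! ### Laurent decomposition on a round annulus. -/

section LaurentDecomposition

open Metric Filter

theorem HasSum.of_eq {f g : ℕ → ℂ} {a b : ℂ} (h : HasSum f a) (hfg : ∀ n, g n = f n) (hab : b = a) :
    HasSum g b := by
  rw [hab]
  exact h.congr_fun hfg

theorem hasSum_circleIntegral_of_bounded {f : ℕ → ℂ → ℂ} {F : ℂ → ℂ} {c : ℂ} {R : ℝ} (hR : 0 ≤ R)
    (hf : ∀ n, ContinuousOn (f n) (sphere c R)) {u : ℕ → ℝ} (hu : Summable u)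
    (hb : ∀ n, ∀ z ∈ sphere c R, ‖f n z‖ ≤ u n)
    (hF : ∀ z ∈ sphere c R, HasSum (fun n => f n z) (F z)) :
    HasSum (fun n => ∮ z in C(c, R), f n z) (∮ z in C(c, R), F z) := by
  have hmem : ∀ θ, circleMap c R θ ∈ sphere c R := fun θ => circleMap_mem_sphere c hR θ
  refine intervalIntegral.hasSum_integral_of_dominated_convergence
    (fun n _ => R * u n) (fun n => ?_) (fun n => ?_) ?_ ?_ ?_
  · refine Continuous.aestronglyMeasurable ?_
    simp only [deriv_circleMap]
    exact ((continuous_circleMap 0 R).mul continuous_const).smul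
      ((hf n).comp_continuous (continuous_circleMap c R) hmem)
  · refine Eventually.of_forall fun θ _ => ?_
    rw [norm_smul]
    simp only [deriv_circleMap, norm_mul, norm_circleMap_zero, Complex.norm_I, mul_one,
      abs_of_nonneg hR]
    gcongr
    exact hb n _ (hmem θ)
  · exact Eventually.of_forall fun θ _ => hu.mul_left R
  · exact intervalIntegrable_const
  · exact Eventually.of_forall fun θ _ => (hF _ (hmem θ)).const_smul _

/-- The difference quotient `dslope q w` has no singularity at `w`, so its integrals over the two
circles agree. What remains are the integrals of `1 / (y - w)`: `2πi` on the outer circle and `0` on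
the inner one. -/
theorem circleIntegral_div_sub_annulus {q : ℂ → ℂ} {c w : ℂ} {s₁ s₂ : ℝ} (hs₁ : 0 < s₁)
    (hc : ContinuousOn q (closedBall c s₂ \ ball c s₁))
    (hd : ∀ y ∈ ball c s₂ \ closedBall c s₁, DifferentiableAt ℂ q y)
    (hw : w ∈ ball c s₂ \ closedBall c s₁) :
    (∮ y in C(c, s₂), q y / (y - w)) - (∮ y in C(c, s₁), q y / (y - w)) =
      2 * Real.pi * Complex.I * q w := by
  have hw1 : s₁ < dist w c := by simpa using hw.2
  have hw2 : dist w c < s₂ := hw.1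
  have hs : s₁ ≤ s₂ := (hw1.trans hw2).le
  have hs₂ : 0 < s₂ := hs₁.trans_le hs
  have hsub1 : sphere c s₁ ⊆ closedBall c s₂ \ ball c s₁ := fun y hy => by
    rw [mem_sphere] at hy
    exact ⟨by simp [hy, hs], by simp [hy]⟩
  have hsub2 : sphere c s₂ ⊆ closedBall c s₂ \ ball c s₁ := fun y hy => by
    rw [mem_sphere] at hy
    exact ⟨by simp [hy], by simp [hy, hs]⟩
  have hopen : ball c s₂ \ closedBall c s₁ ∈ 𝓝 w :=
    (isOpen_ball.sdiff isClosed_closedBall).mem_nhds hw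
  have hne1 : ∀ y ∈ sphere c s₁, y - w ≠ 0 := fun y hy h => by
    rw [sub_eq_zero] at h; subst h; rw [mem_sphere] at hy; linarith
  have hne2 : ∀ y ∈ sphere c s₂, y - w ≠ 0 := fun y hy h => by
    rw [sub_eq_zero] at h; subst h; rw [mem_sphere] at hy; linarith
  have key : (∮ y in C(c, s₂), dslope q w y) = ∮ y in C(c, s₁), dslope q w y := by
    refine Complex.circleIntegral_eq_of_differentiable_on_annulus_off_countable hs₁ hs
      (Set.countable_singleton w) ?_ ?_
    · rw [continuousOn_dslope]
      · exact ⟨hc, hd w hw⟩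
      · exact mem_of_superset hopen
          (Set.sdiff_subset_sdiff ball_subset_closedBall ball_subset_closedBall)
    · intro y hy
      exact (differentiableAt_dslope_of_ne (by simpa using hy.2)).2 (hd y hy.1)
  have hexp : ∀ s : ℝ, 0 ≤ s → (∀ y ∈ sphere c s, y - w ≠ 0) → ContinuousOn q (sphere c s) →
      (∮ y in C(c, s), dslope q w y) =
        (∮ y in C(c, s), q y / (y - w)) - q w * ∮ y in C(c, s), (y - w)⁻¹ := by
    intro s hs0 hne hcs
    rw [← circleIntegral.integral_const_mul, ← circleIntegral.integral_sub]
    · refine circleIntegral.integral_congr hs0 fun y hy => ?_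
      rw [dslope_of_ne _ (sub_ne_zero.1 (hne y hy)), slope_def_field]
      have := hne y hy
      field_simp
    · exact (hcs.div (by fun_prop) hne).circleIntegrable hs0
    · exact (continuousOn_const.mul (ContinuousOn.inv₀ (by fun_prop) hne)).circleIntegrable hs0
  rw [hexp s₂ hs₂.le hne2 (hc.mono hsub2), hexp s₁ hs₁.le hne1 (hc.mono hsub1),
    circleIntegral.integral_sub_inv_of_mem_ball hw.1] at key
  have h0 : (∮ y in C(c, s₁), (y - w)⁻¹) = 0 := by
    refine Complex.circleIntegral_eq_zero_of_differentiable_on_off_countable hs₁.le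
      Set.countable_empty (ContinuousOn.inv₀ (by fun_prop) fun y hy h => ?_) fun y hy => ?_
    · rw [sub_eq_zero] at h; subst h; rw [mem_closedBall] at hy; linarith
    · refine (differentiableAt_id.sub_const w).inv fun h => ?_
      have h' : y = w := sub_eq_zero.1 h
      have := hy.1
      rw [mem_ball, h'] at this; linarith
  rw [h0] at key
  linear_combination key

theorem hasSum_circleIntegral_pow_div {q : ℂ → ℂ} {c w : ℂ} {s : ℝ} (hs : 0 < s)
    (hc : ContinuousOn q (sphere c s)) (hw : s < ‖w - c‖) :
    HasSum (fun j : ℕ => (∮ y in C(c, s), q y * (y - c) ^ j) / (w - c) ^ (j + 1))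
      (-∮ y in C(c, s), q y / (y - w)) := by
  have hw0 : w - c ≠ 0 := fun h => by rw [h, norm_zero] at hw; linarith
  obtain ⟨M, hM⟩ := (isCompact_sphere c s).exists_bound_of_continuousOn hc
  have hratio : s / ‖w - c‖ < 1 := (div_lt_one (hs.trans hw)).2 hw
  have key := hasSum_circleIntegral_of_bounded (f := fun j y => q y * (y - c) ^ j / (w - c) ^ (j + 1))
    (F := fun y => -(q y / (y - w))) (u := fun j => M / ‖w - c‖ * (s / ‖w - c‖) ^ j) hs.le
    (fun n => (hc.mul (by fun_prop)).div_const _)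
    ((summable_geometric_of_lt_one (by positivity) hratio).mul_left _)
    (fun n y hy => by
      rw [norm_div, norm_mul, norm_pow, norm_pow, mem_sphere_iff_norm.1 hy]
      calc ‖q y‖ * s ^ n / ‖w - c‖ ^ (n + 1) ≤ M * s ^ n / ‖w - c‖ ^ (n + 1) := by
            gcongr; exact hM y hy
        _ = _ := by rw [div_pow, pow_succ]; field_simp)
    (fun y hy => by
      have hlt : ‖(y - c) / (w - c)‖ < 1 := by
        rw [norm_div, mem_sphere_iff_norm.1 hy]; exact hratio
      have hne : w - y ≠ 0 := fun h => by
        rw [sub_eq_zero] at h; subst h; rw [mem_sphere_iff_norm] at hy; linarith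
      have h1 := (hasSum_geometric_of_norm_lt_one hlt).mul_left (q y / (w - c))
      refine h1.of_eq (fun j => ?_) ?_
      · rw [div_pow, pow_succ]; field_simp
      · have h2 : 1 - (y - c) / (w - c) = (w - y) / (w - c) := by field_simp; ring
        have hne' : y - w ≠ 0 := fun h => hne (by rw [← neg_sub, h, neg_zero])
        rw [h2, inv_div, ← neg_sub y w]; field_simp)
  have hneg : (∮ y in C(c, s), -(q y / (y - w))) = -∮ y in C(c, s), q y / (y - w) := by
    rw [← neg_one_mul, ← circleIntegral.integral_const_mul]
    simp
  rw [hneg] at key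
  refine key.congr_fun fun j => ?_
  simp only [div_eq_mul_inv, mul_comm _ ((w - c) ^ (j + 1))⁻¹]
  rw [circleIntegral.integral_const_mul]

/-- `F` is the Cauchy integral over the outer circle; the integral over the inner circle is expanded
in a geometric series. Only the principal part is needed as a series. -/
theorem exists_laurent_decomposition {q : ℂ → ℂ} {c : ℂ} {s₁ s₂ : ℝ} (hs₁ : 0 < s₁) (hs : s₁ < s₂)
    (hc : ContinuousOn q (closedBall c s₂ \ ball c s₁))
    (hd : ∀ y ∈ ball c s₂ \ closedBall c s₁, DifferentiableAt ℂ q y) :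
    ∃ F : ℂ → ℂ, DifferentiableOn ℂ F (ball c s₂) ∧ ∀ w ∈ ball c s₂ \ closedBall c s₁,
      HasSum (fun j : ℕ => (2 * Real.pi * Complex.I : ℂ)⁻¹ *
        (∮ y in C(c, s₁), q y * (y - c) ^ j) / (w - c) ^ (j + 1)) (q w - F w) := by
  have hs₂ : 0 < s₂ := hs₁.trans hs
  have hsub1 : sphere c s₁ ⊆ closedBall c s₂ \ ball c s₁ := fun y hy => by
    rw [mem_sphere] at hy
    exact ⟨by simp [hy, hs.le], by simp [hy]⟩
  have hsub2 : sphere c s₂ ⊆ closedBall c s₂ \ ball c s₁ := fun y hy => by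
    rw [mem_sphere] at hy
    exact ⟨by simp [hy], by simp [hy, hs.le]⟩
  refine ⟨fun w => (2 * Real.pi * Complex.I : ℂ)⁻¹ * ∮ y in C(c, s₂), q y / (y - w), ?_, ?_⟩
  · obtain ⟨R, rfl⟩ : ∃ R : NNReal, (R : ℝ) = s₂ := ⟨⟨s₂, hs₂.le⟩, rfl⟩
    have h2 := (hasFPowerSeriesOn_cauchy_integral ((hc.mono hsub2).circleIntegrable hs₂.le)
      hs₂).differentiableOn
    rw [eball_coe] at h2
    refine h2.congr fun w _ => ?_
    simp only [smul_eq_mul, div_eq_mul_inv]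
    congr 2
    funext y
    ring
  · intro w hw
    have hw1 : s₁ < ‖w - c‖ := by simpa [dist_eq_norm] using hw.2
    have h1 := circleIntegral_div_sub_annulus hs₁ hc hd hw
    have h2 := (hasSum_circleIntegral_pow_div hs₁ (hc.mono hsub1) hw1).mul_left
      (2 * Real.pi * Complex.I : ℂ)⁻¹
    refine h2.of_eq (fun j => by ring) ?_
    · have h3 := Complex.two_pi_I_ne_zero
      beta_reduce
      field_simp
      linear_combination -h1

end LaurentDecomposition

/-! ### Holomorphic disk coordinates and contour integrals expressed in them. -/

namespace OpenNodes

open Metric Filter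

/-- A biholomorphic coordinate `z` from the topological disk `D` onto a disk of radius `ρ`,
centred at `p` and comparable to `x - p`. -/
structure DiskChart (p : ℂ) (D : Set ℂ) (z : ℂ → ℂ) (ρ c₁ c₂ : ℝ) : Prop where
  isOpen : IsOpen D
  center_mem : p ∈ D
  differentiableOn : DifferentiableOn ℂ z D
  bijOn : Set.BijOn z D (ball 0 ρ)
  center : z p = 0
  lower : ∀ x ∈ D, c₁ * ‖z x‖ ≤ ‖x - p‖
  upper : ∀ x ∈ D, ‖x - p‖ ≤ c₂ * ‖z x‖

namespace DiskChart

variable {p : ℂ} {D : Set ℂ} {z : ℂ → ℂ} {ρ c₁ c₂ : ℝ}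

theorem analyticAt (C : DiskChart p D z ρ c₁ c₂) {x : ℂ} (hx : x ∈ D) : AnalyticAt ℂ z x :=
  C.differentiableOn.analyticAt (C.isOpen.mem_nhds hx)

theorem hasDerivAt (C : DiskChart p D z ρ c₁ c₂) {x : ℂ} (hx : x ∈ D) :
    HasDerivAt z (deriv z x) x := (C.analyticAt hx).differentiableAt.hasDerivAt

theorem norm_lt (C : DiskChart p D z ρ c₁ c₂) {x : ℂ} (hx : x ∈ D) : ‖z x‖ < ρ := by
  simpa using C.bijOn.mapsTo hx

theorem not_eventually_const (C : DiskChart p D z ρ c₁ c₂) {x : ℂ} (hx : x ∈ D) :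
    ¬∀ᶠ y in 𝓝 x, z y = z x := by
  intro h
  have h1 : ∀ᶠ y in 𝓝[≠] x, y = x := by
    filter_upwards [nhdsWithin_le_nhds h, nhdsWithin_le_nhds (C.isOpen.mem_nhds hx)] with y hy hyD
    exact C.bijOn.injOn hyD hx hy
  obtain ⟨y, hy, hy'⟩ := (h1.and self_mem_nhdsWithin).exists
  exact hy' hy

theorem eventually_deriv_ne_zero (C : DiskChart p D z ρ c₁ c₂) {x : ℂ} (hx : x ∈ D) :
    ∀ᶠ y in 𝓝[≠] x, deriv z y ≠ 0 := by
  rcases (C.analyticAt hx).deriv.eventually_eq_zero_or_eventually_ne_zero with h | h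
  · exfalso
    obtain ⟨s, hs, hsub⟩ := Metric.eventually_nhds_iff_ball.1
      (h.and (C.isOpen.mem_nhds hx))
    refine C.not_eventually_const hx ?_
    filter_upwards [ball_mem_nhds x hs] with y hy
    exact isOpen_ball.is_const_of_deriv_eq_zero (convex_ball x s).isPreconnected
      (C.differentiableOn.mono fun w hw => (hsub w hw).2) (fun w hw => (hsub w hw).1)
      hy (mem_ball_self hs)
  · exact h

/-- The open mapping theorem makes the inverse continuous. It is differentiable at values of points
where `deriv z` does not vanish; the other points are isolated, so they give removable
singularities. -/
theorem exists_inverse (C : DiskChart p D z ρ c₁ c₂) :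
    ∃ ψ : ℂ → ℂ, DifferentiableOn ℂ ψ (ball 0 ρ) ∧ (∀ ζ ∈ ball (0 : ℂ) ρ, ψ ζ ∈ D) ∧
      (∀ ζ ∈ ball (0 : ℂ) ρ, z (ψ ζ) = ζ) ∧ ∀ x ∈ D, ψ (z x) = x := by
  have hinv := C.bijOn.invOn_invFunOn
  have hmaps := C.bijOn.surjOn.mapsTo_invFunOn
  set ψ := Function.invFunOn z D
  refine ⟨ψ, ?_, fun ζ hζ => hmaps hζ, fun ζ hζ => hinv.2 hζ, fun x hx => hinv.1 hx⟩
  have hcont : ∀ x ∈ D, ContinuousAt ψ (z x) := by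
    intro x hx
    rw [ContinuousAt, hinv.1 hx]
    have hmap := ((C.analyticAt hx).eventually_constant_or_nhds_le_map_nhds).resolve_left
      (C.not_eventually_const hx)
    intro N hN
    have h1 : z '' (N ∩ D) ∈ 𝓝 (z x) :=
      hmap (image_mem_map (inter_mem hN (C.isOpen.mem_nhds hx)))
    refine mem_map.2 (mem_of_superset h1 ?_)
    rintro _ ⟨y, ⟨hyN, hyD⟩, rfl⟩
    rw [Set.mem_preimage, hinv.1 hyD]
    exact hyN
  have hdiff : ∀ x ∈ D, deriv z x ≠ 0 → DifferentiableAt ℂ ψ (z x) := by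
    intro x hx hne
    refine (HasDerivAt.of_local_left_inverse (f := z) (f' := deriv z x) (hcont x hx) ?_ hne
      ?_).differentiableAt
    · rw [hinv.1 hx]; exact C.hasDerivAt hx
    · filter_upwards [isOpen_ball.mem_nhds (C.bijOn.mapsTo hx)] with ζ hζ using hinv.2 hζ
  intro ζ hζ
  have hx := hmaps hζ
  have hzx : z (ψ ζ) = ζ := hinv.2 hζ
  have hca : ContinuousAt ψ ζ := hzx ▸ hcont _ hx
  refine (Complex.analyticAt_of_differentiable_on_punctured_nhds_of_continuousAt ?_
    hca).differentiableAt.differentiableWithinAt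
  have h1 : Tendsto ψ (𝓝[≠] ζ) (𝓝[≠] (ψ ζ)) := by
    refine tendsto_nhdsWithin_of_tendsto_nhds_of_eventually_within _
      (hca.tendsto.mono_left nhdsWithin_le_nhds) ?_
    filter_upwards [self_mem_nhdsWithin, nhdsWithin_le_nhds (isOpen_ball.mem_nhds hζ)] with η hη hη'
    intro h
    apply hη
    have := congrArg z h
    rwa [hinv.2 hη', hzx] at this
  filter_upwards [h1.eventually (C.eventually_deriv_ne_zero hx),
    nhdsWithin_le_nhds (isOpen_ball.mem_nhds hζ)] with η hη hη'
  have := hdiff _ (hmaps hη') hη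
  rwa [hinv.2 hη'] at this

theorem deriv_ne_zero (C : DiskChart p D z ρ c₁ c₂) {x : ℂ} (hx : x ∈ D) : deriv z x ≠ 0 := by
  obtain ⟨ψ, hψ, -, -, hinv⟩ := C.exists_inverse
  have h1 := (hψ.differentiableAt (isOpen_ball.mem_nhds (C.bijOn.mapsTo hx))).hasDerivAt
  have h2 := h1.comp x (C.hasDerivAt hx)
  have h3 : HasDerivAt (ψ ∘ z) 1 x := by
    refine (hasDerivAt_id x).congr_of_eventuallyEq ?_
    filter_upwards [C.isOpen.mem_nhds hx] with y hy using hinv y hy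
  intro h0
  rw [h0, mul_zero] at h2
  exact zero_ne_one (h2.unique h3)

theorem ne_zero (C : DiskChart p D z ρ c₁ c₂) {x : ℂ} (hx : x ∈ D) (hxp : x ≠ p) : z x ≠ 0 :=
  fun h => hxp (C.bijOn.injOn hx C.center_mem (h.trans C.center.symm))

theorem radius_pos (C : DiskChart p D z ρ c₁ c₂) : 0 < ρ :=
  (norm_nonneg _).trans_lt (C.norm_lt C.center_mem)

theorem le_of_constants (C : DiskChart p D z ρ c₁ c₂) : c₁ ≤ c₂ := by
  have hρ := C.radius_pos
  obtain ⟨x, hx, hzx⟩ := C.bijOn.surjOn (show ((ρ / 2 : ℝ) : ℂ) ∈ ball (0 : ℂ) ρ by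
    rw [mem_ball_zero_iff, Complex.norm_real, Real.norm_eq_abs, abs_of_pos (by linarith)]
    linarith)
  have h := (C.lower x hx).trans (C.upper x hx)
  rw [hzx, Complex.norm_real, Real.norm_eq_abs, abs_of_pos (by linarith)] at h
  exact le_of_mul_le_mul_right h (by linarith)

/-- By connectedness it suffices that `D` is relatively closed in the ball. A point of the closure
of `D` at distance less than `c₁ ρ` from `p` is, by the lower bound, a limit of points with `‖z‖ ≤ r
< ρ`, and these lie in a compact subset of `D`. -/
theorem ball_subset (C : DiskChart p D z ρ c₁ c₂) (hc₁ : 0 < c₁) : ball p (c₁ * ρ) ⊆ D := by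
  have hρ := C.radius_pos
  obtain ⟨ψ, hψ, hmaps, -, hinv⟩ := C.exists_inverse
  refine (convex_ball p (c₁ * ρ)).isPreconnected.subset_of_closure_inter_subset C.isOpen
    ⟨p, mem_ball_self (by positivity), C.center_mem⟩ ?_
  rintro x ⟨hx, hxb⟩
  rw [mem_ball, dist_eq_norm] at hxb
  obtain ⟨r, hr1, hr2⟩ := exists_between ((div_lt_iff₀' hc₁).2 hxb)
  have hK : IsCompact (ψ '' closedBall 0 r) :=
    (isCompact_closedBall 0 r).image_of_continuousOn
      (hψ.continuousOn.mono (closedBall_subset_ball hr2))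
  have hKD : ψ '' closedBall 0 r ⊆ D := by
    rintro _ ⟨ζ, hζ, rfl⟩
    exact hmaps ζ (closedBall_subset_ball hr2 hζ)
  refine hKD ?_
  rw [← hK.isClosed.closure_eq, mem_closure_iff_nhds]
  intro N hN
  have hb : ball p (c₁ * r) ∈ 𝓝 x := isOpen_ball.mem_nhds (by
    rw [mem_ball, dist_eq_norm]; exact (div_lt_iff₀' hc₁).1 hr1)
  obtain ⟨y, ⟨hyN, hyb⟩, hyD⟩ := mem_closure_iff_nhds.1 hx _ (inter_mem hN hb)
  refine ⟨y, hyN, z y, ?_, hinv y hyD⟩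
  rw [mem_closedBall_zero_iff]
  rw [mem_ball, dist_eq_norm] at hyb
  exact le_of_mul_le_mul_left ((C.lower y hyD).trans hyb.le) hc₁

/-- Write `z = (x - p) u` with `u` holomorphic and nowhere zero on `D`; then `L = u' / u`. -/
theorem exists_logDeriv_sub (C : DiskChart p D z ρ c₁ c₂) :
    ∃ L : ℂ → ℂ, DifferentiableOn ℂ L D ∧
      ∀ x ∈ D, x ≠ p → deriv z x / z x = (x - p)⁻¹ + L x := by
  set u := dslope z p with hu
  have hud : DifferentiableOn ℂ u D :=
    (Complex.differentiableOn_dslope (C.isOpen.mem_nhds C.center_mem)).2 C.differentiableOn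
  have hzu : ∀ x, z x = (x - p) * u x := fun x => by
    have := sub_smul_dslope z p x
    rw [C.center, sub_zero] at this
    rw [← this, smul_eq_mul]
  have hu0 : ∀ x ∈ D, u x ≠ 0 := by
    intro x hx
    rcases eq_or_ne x p with rfl | hxp
    · rw [hu, dslope_same]; exact C.deriv_ne_zero hx
    · intro h
      exact C.ne_zero hx hxp (by rw [hzu, h, mul_zero])
  refine ⟨fun x => deriv u x / u x, (hud.deriv C.isOpen).div hud hu0, fun x hx hxp => ?_⟩
  have h1 : HasDerivAt z (1 * u x + (x - p) * deriv u x) x := by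
    have h2 := ((hasDerivAt_id x).sub_const p).mul
      (hud.differentiableAt (C.isOpen.mem_nhds hx)).hasDerivAt
    refine h2.congr_of_eventuallyEq (Eventually.of_forall fun y => ?_)
    simpa using hzu y
  rw [h1.deriv, hzu x]
  have := hu0 x hx
  have := sub_ne_zero.2 hxp
  field_simp

theorem exists_pullback (C : DiskChart p D z ρ c₁ c₂) {F : ℂ → ℂ} {W : Set ℂ} (hW : IsOpen W)
    (hWD : W ⊆ D) (hF : DifferentiableOn ℂ F W) :
    ∃ g : ℂ → ℂ, (∀ ζ, ∀ x ∈ W, z x = ζ → DifferentiableAt ℂ g ζ) ∧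
      ∀ x ∈ W, F x = g (z x) * deriv z x := by
  obtain ⟨ψ, hψ, hmaps, hz, hinv⟩ := C.exists_inverse
  refine ⟨fun ζ => F (ψ ζ) * deriv ψ ζ, ?_, fun x hx => ?_⟩
  · rintro _ x hx rfl
    have hb := isOpen_ball.mem_nhds (C.bijOn.mapsTo (hWD hx))
    have h1 := hψ.differentiableAt hb
    have h2 := (hψ.deriv isOpen_ball).differentiableAt hb
    have h3 : DifferentiableAt ℂ F (ψ (z x)) := by
      rw [hinv x (hWD hx)]; exact hF.differentiableAt (hW.mem_nhds hx)
    exact (h3.comp (z x) h1).mul h2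
  · have hxD := hWD hx
    have h1 := (hψ.differentiableAt (isOpen_ball.mem_nhds (C.bijOn.mapsTo hxD))).hasDerivAt
    have h2 := h1.comp x (C.hasDerivAt hxD)
    have h3 : HasDerivAt (ψ ∘ z) 1 x := by
      refine (hasDerivAt_id x).congr_of_eventuallyEq ?_
      filter_upwards [C.isOpen.mem_nhds hxD] with y hy using hinv y hy
    beta_reduce
    rw [hinv x hxD, mul_assoc, h2.unique h3, mul_one]

theorem exists_pullback_disk (C : DiskChart p D z ρ c₁ c₂) {F : ℂ → ℂ}
    (hF : DifferentiableOn ℂ F D) :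
    ∃ g : ℂ → ℂ, DifferentiableOn ℂ g (ball 0 ρ) ∧ ∀ x ∈ D, F x = g (z x) * deriv z x := by
  obtain ⟨g, hg, h⟩ := C.exists_pullback C.isOpen subset_rfl hF
  refine ⟨g, fun ζ hζ => ?_, h⟩
  obtain ⟨x, hx, rfl⟩ := C.bijOn.surjOn hζ
  exact (hg _ x hx rfl).differentiableWithinAt

/-- Only the circle, not the disk it bounds, is known to lie in `D`. Pulling back by `z` to a round
disk provides a primitive. -/
theorem circleIntegral_eq_zero (C : DiskChart p D z ρ c₁ c₂) {F : ℂ → ℂ}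
    (hF : DifferentiableOn ℂ F D) {q : ℂ} {s : ℝ} (hs : 0 ≤ s) (hq : sphere q s ⊆ D) :
    (∮ x in C(q, s), F x) = 0 := by
  obtain ⟨g, hg, h⟩ := C.exists_pullback_disk hF
  obtain ⟨Γ, hΓ⟩ := hg.isExactOn_ball
  refine circleIntegral.integral_eq_zero_of_hasDerivWithinAt (f := Γ ∘ z) hs fun x hx => ?_
  rw [h x (hq hx)]
  exact ((hΓ _ (C.bijOn.mapsTo (hq hx))).comp x (C.hasDerivAt (hq hx))).hasDerivWithinAt

theorem continuousOn_deriv (C : DiskChart p D z ρ c₁ c₂) : ContinuousOn (deriv z) D :=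
  (C.differentiableOn.deriv C.isOpen).continuousOn

/-- For `k ≠ -1` the integrand has a primitive; for `k = -1` it differs from `(x - p)⁻¹` by a
function holomorphic on `D`. -/
theorem circleIntegral_zpow_mul_deriv (C : DiskChart p D z ρ c₁ c₂) {q : ℂ} {s : ℝ} (hs : 0 < s)
    (hq : sphere q s ⊆ D) (hp : p ∈ ball q s) (k : ℤ) :
    (∮ x in C(q, s), z x ^ k * deriv z x) = if k = -1 then 2 * Real.pi * Complex.I else 0 := by
  have hne : ∀ x ∈ sphere q s, x ≠ p := by
    rintro x hx rfl
    rw [mem_ball] at hp; rw [mem_sphere] at hx; linarith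
  split_ifs with hk
  · subst hk
    obtain ⟨L, hL, h⟩ := C.exists_logDeriv_sub
    have h1 : (∮ x in C(q, s), z x ^ (-1 : ℤ) * deriv z x) =
        ∮ x in C(q, s), ((x - p)⁻¹ + L x) := by
      refine circleIntegral.integral_congr hs.le fun x hx => ?_
      rw [← h x (hq hx) (hne x hx), zpow_neg_one, div_eq_inv_mul]
    rw [h1, circleIntegral.integral_add, C.circleIntegral_eq_zero hL hs.le hq, add_zero,
      circleIntegral.integral_sub_inv_of_mem_ball hp]
    · exact ContinuousOn.circleIntegrable hs.le (ContinuousOn.inv₀ (by fun_prop)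
        fun x hx => sub_ne_zero.2 (hne x hx))
    · exact (hL.continuousOn.mono hq).circleIntegrable hs.le
  · refine circleIntegral.integral_eq_zero_of_hasDerivWithinAt
      (f := fun x => z x ^ (k + 1) / ((k + 1 : ℤ) : ℂ)) hs.le fun x hx => ?_
    have h0 := C.ne_zero (hq hx) (hne x hx)
    have h1 := (hasDerivAt_zpow (k + 1) (z x) (Or.inl h0)).comp x (C.hasDerivAt (hq hx))
    have hk' : ((k + 1 : ℤ) : ℂ) ≠ 0 := by
      rw [Int.cast_ne_zero]; omega
    have h2 := (h1.div_const ((k + 1 : ℤ) : ℂ)).hasDerivWithinAt (s := sphere q s)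
    refine h2.congr_deriv ?_
    rw [add_sub_cancel_right]
    field_simp

/-- Taylor coefficients in the variable `z` are computed on a round circle of the `x`-plane, which
is not a level curve of `‖z‖`. On that circle `‖z‖` has a maximum, smaller than `ρ`, so the Taylor
series of `g` can be integrated term by term. -/
theorem hasSum_circleIntegral_coeff (C : DiskChart p D z ρ c₁ c₂) {g : ℂ → ℂ}
    (hg : DifferentiableOn ℂ g (ball 0 ρ)) {q : ℂ} {s : ℝ} (hs : 0 < s)
    (hq : sphere q s ⊆ D) (hp : p ∈ ball q s) {ζ : ℂ} (hζ : ζ ∈ ball (0 : ℂ) ρ) :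
    HasSum (fun m : ℕ => (2 * Real.pi * Complex.I : ℂ)⁻¹ *
      (∮ x in C(q, s), (z x ^ (m + 1))⁻¹ * (g (z x) * deriv z x)) * ζ ^ m) (g ζ) := by
  have hne : ∀ x ∈ sphere q s, x ≠ p := by
    rintro x hx rfl
    rw [mem_ball] at hp; rw [mem_sphere] at hx; linarith
  have htaylor : ∀ η ∈ ball (0 : ℂ) ρ,
      HasSum (fun n : ℕ => (n.factorial : ℂ)⁻¹ * iteratedDeriv n g 0 * η ^ n) (g η) := by
    intro η hη
    have := Complex.hasSum_taylorSeries_on_ball hg hη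
    refine this.congr_fun fun n => ?_
    simp only [smul_eq_mul, sub_zero]
    ring
  have hcz : ContinuousOn z (sphere q s) := C.differentiableOn.continuousOn.mono hq
  have hcz' := C.continuousOn_deriv.mono hq
  obtain ⟨x₀, hx₀, hmax⟩ := (isCompact_sphere q s).exists_isMaxOn
    (NormedSpace.sphere_nonempty.2 hs.le) hcz.norm
  have hzR : ∀ x ∈ sphere q s, ‖z x‖ ≤ ‖z x₀‖ := fun x hx => hmax hx
  have hRρ := C.norm_lt (hq hx₀)
  have hsumm : Summable fun n : ℕ => ‖(n.factorial : ℂ)⁻¹ * iteratedDeriv n g 0‖ * ‖z x₀‖ ^ n := by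
    have := (htaylor (z x₀) (C.bijOn.mapsTo (hq hx₀))).summable.norm
    simpa only [norm_mul, norm_pow] using this
  suffices H : ∀ m : ℕ, (2 * Real.pi * Complex.I : ℂ)⁻¹ *
      (∮ x in C(q, s), (z x ^ (m + 1))⁻¹ * (g (z x) * deriv z x)) =
        (m.factorial : ℂ)⁻¹ * iteratedDeriv m g 0 by
    simp only [H]; exact htaylor ζ hζ
  intro m
  obtain ⟨M, hM⟩ := (isCompact_sphere q s).exists_bound_of_continuousOn
    (f := fun x => (z x ^ (m + 1))⁻¹ * deriv z x)
    (((hcz.pow _).inv₀ fun x hx => pow_ne_zero _ (C.ne_zero (hq hx) (hne x hx))).mul hcz')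
  have key := hasSum_circleIntegral_of_bounded
    (f := fun n x => ((n.factorial : ℂ)⁻¹ * iteratedDeriv n g 0) *
      (z x ^ ((n : ℤ) - (m + 1)) * deriv z x))
    (F := fun x => (z x ^ (m + 1))⁻¹ * (g (z x) * deriv z x)) (R := s) (c := q)
    (u := fun n => ‖(n.factorial : ℂ)⁻¹ * iteratedDeriv n g 0‖ * ‖z x₀‖ ^ n * M) hs.le
    (fun n => continuousOn_const.mul ((hcz.zpow₀ _ fun x hx =>
      Or.inl (C.ne_zero (hq hx) (hne x hx))).mul hcz'))
    (hsumm.mul_right M)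
    (fun n x hx => by
      have h0 := C.ne_zero (hq hx) (hne x hx)
      have : z x ^ ((n : ℤ) - (m + 1)) = z x ^ n * (z x ^ (m + 1))⁻¹ := by
        rw [zpow_sub₀ h0]; norm_cast
      have h3 := hM x hx
      have h4 := hzR x hx
      calc _ = ‖(n.factorial : ℂ)⁻¹ * iteratedDeriv n g 0‖ * ‖z x‖ ^ n *
            ‖(z x ^ (m + 1))⁻¹ * deriv z x‖ := by
            rw [this, mul_assoc (z x ^ n), norm_mul, norm_mul (z x ^ n), norm_pow, mul_assoc]
        _ ≤ _ := by gcongr)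
    (fun x hx => by
      have h0 := C.ne_zero (hq hx) (hne x hx)
      have := (htaylor (z x) (C.bijOn.mapsTo (hq hx))).mul_left ((z x ^ (m + 1))⁻¹ * deriv z x)
      refine this.of_eq (fun n => ?_) (by ring)
      have h1 : z x ^ ((n : ℤ) - (m + 1)) = z x ^ n * (z x ^ (m + 1))⁻¹ := by
        rw [zpow_sub₀ h0]; norm_cast
      rw [h1]
      ring)
  have hval : ∀ n : ℕ, (∮ x in C(q, s), ((n.factorial : ℂ)⁻¹ * iteratedDeriv n g 0) *
      (z x ^ ((n : ℤ) - (m + 1)) * deriv z x)) =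
      if n = m then (m.factorial : ℂ)⁻¹ * iteratedDeriv m g 0 * (2 * Real.pi * Complex.I) else 0 := by
    intro n
    rw [circleIntegral.integral_const_mul, C.circleIntegral_zpow_mul_deriv hs hq hp]
    by_cases h : n = m
    · subst h; simp
    · rw [if_neg h, if_neg (by omega), mul_zero]
  simp only [hval] at key
  rw [← (hasSum_ite_eq m _).unique key]
  have := Complex.two_pi_I_ne_zero
  field_simp

/-- In the variable `ζ = t / z` the integrand is `-(t ^ m)⁻¹ ζ ^ m g(ζ) dζ`, which is exact on the
disk of radius `R`. -/
theorem circleIntegral_inversion_eq_zero (C : DiskChart p D z ρ c₁ c₂) {g : ℂ → ℂ} {R : ℝ}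
    (hg : DifferentiableOn ℂ g (ball 0 R)) {q : ℂ} {s : ℝ} (hs : 0 < s)
    (hq : sphere q s ⊆ D) (hp : p ∈ ball q s) (t : ℂ)
    (ht : ∀ x ∈ sphere q s, t / z x ∈ ball (0 : ℂ) R) (m : ℕ) :
    (∮ x in C(q, s), (z x ^ m)⁻¹ * (t / z x ^ 2 * g (t / z x) * deriv z x)) = 0 := by
  have hne : ∀ x ∈ sphere q s, x ≠ p := by
    rintro x hx rfl
    rw [mem_ball] at hp; rw [mem_sphere] at hx; linarith
  rcases eq_or_ne t 0 with rfl | ht0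
  · simp [circleIntegral]
  have hg' : DifferentiableOn ℂ (fun ζ => ζ ^ m * g ζ) (ball 0 R) :=
    (differentiableOn_id.pow m).mul hg
  obtain ⟨Γ, hΓ⟩ := hg'.isExactOn_ball
  refine circleIntegral.integral_eq_zero_of_hasDerivWithinAt
    (f := fun x => -(t ^ m)⁻¹ * Γ (t / z x)) hs.le fun x hx => ?_
  have h0 := C.ne_zero (hq hx) (hne x hx)
  have h1 : HasDerivAt (fun x => t / z x) (-t * deriv z x / z x ^ 2) x := by
    refine ((hasDerivAt_const x t).fun_div (C.hasDerivAt (hq hx)) h0).congr_deriv ?_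
    simp
  have h2 := ((hΓ _ (ht x hx)).comp x h1).const_mul (-(t ^ m)⁻¹)
  refine h2.hasDerivWithinAt.congr_deriv ?_
  beta_reduce
  rw [div_pow]
  field_simp

end DiskChart

end OpenNodes

noncomputable section

namespace OpenNodes

open Metric Filter

/-! ### Principal parts and power series with bounded normalised coefficients -/

/-- The principal part `∑ d_j b^j / (w - p)^(j+1)`. -/
def principalPart (p : ℂ) (b : ℝ) (d : ℕ → ℂ) (w : ℂ) : ℂ :=
  ∑' j, d j * (b : ℂ) ^ j / (w - p) ^ (j + 1)

section PrincipalPart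

variable {p : ℂ} {b B : ℝ} {d : ℕ → ℂ}

theorem norm_principalPart_term_le (hb : 0 ≤ b) (hd : ∀ j, ‖d j‖ ≤ B) {w : ℂ} {s : ℝ} (hs : 0 < s)
    (hw : s ≤ ‖w - p‖) (j : ℕ) :
    ‖d j * (b : ℂ) ^ j / (w - p) ^ (j + 1)‖ ≤ B / s * (b / s) ^ j := by
  have hB : 0 ≤ B := (norm_nonneg _).trans (hd 0)
  rw [norm_div, norm_mul, norm_pow, norm_pow, Complex.norm_real, Real.norm_eq_abs, abs_of_nonneg hb]
  calc ‖d j‖ * b ^ j / ‖w - p‖ ^ (j + 1) ≤ B * b ^ j / s ^ (j + 1) := by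
        gcongr
        exact hd j
    _ = _ := by rw [div_pow, pow_succ]; field_simp

theorem hasSum_principalPart (hb : 0 ≤ b) (hd : ∀ j, ‖d j‖ ≤ B) {w : ℂ} (hw : b < ‖w - p‖) :
    HasSum (fun j => d j * (b : ℂ) ^ j / (w - p) ^ (j + 1)) (principalPart p b d w) :=
  (Summable.of_norm_bounded ((summable_geometric_of_lt_one (by positivity)
    ((div_lt_one (hb.trans_lt hw)).2 hw)).mul_left _)
    fun j => norm_principalPart_term_le hb hd (hb.trans_lt hw) le_rfl j).hasSum

theorem norm_principalPart_le (hb : 0 ≤ b) (hd : ∀ j, ‖d j‖ ≤ B) {w : ℂ} {s : ℝ}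
    (hs : b < s) (hw : s ≤ ‖w - p‖) : ‖principalPart p b d w‖ ≤ B / (s - b) := by
  have hs0 : 0 < s := hb.trans_lt hs
  have h1 : b / s < 1 := (div_lt_one hs0).2 hs
  refine (tsum_of_norm_bounded ((hasSum_geometric_of_lt_one (by positivity) h1).mul_left _)
    fun j => norm_principalPart_term_le hb hd hs0 hw j).trans (le_of_eq ?_)
  have : s - b ≠ 0 := by linarith
  have h2 : 1 - b / s = (s - b) / s := by field_simp
  rw [h2, inv_div]
  field_simp

theorem differentiableAt_principalPart (hb : 0 ≤ b) (hd : ∀ j, ‖d j‖ ≤ B) {w : ℂ}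
    (hw : b < ‖w - p‖) : DifferentiableAt ℂ (principalPart p b d) w := by
  obtain ⟨s, hs1, hs2⟩ := exists_between hw
  have hs0 : 0 < s := hb.trans_lt hs1
  have hopen : IsOpen {w : ℂ | s < ‖w - p‖} := isOpen_lt continuous_const (by fun_prop)
  refine DifferentiableOn.differentiableAt (s := {w : ℂ | s < ‖w - p‖}) ?_ (hopen.mem_nhds hs2)
  refine Complex.differentiableOn_tsum_of_summable_norm
    ((summable_geometric_of_lt_one (by positivity) ((div_lt_one hs0).2 hs1)).mul_left (B / s))
    (fun j => ?_) hopen fun j w hw => norm_principalPart_term_le hb hd hs0 (le_of_lt hw) j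
  refine DifferentiableOn.div (by fun_prop) (by fun_prop) fun w hw => pow_ne_zero _ fun h => ?_
  have hw' : s < ‖w - p‖ := hw
  rw [h, norm_zero] at hw'
  linarith

theorem principalPart_add (hb : 0 ≤ b) (hd : ∀ j, ‖d j‖ ≤ B) {d' : ℕ → ℂ} {B' : ℝ}
    (hd' : ∀ j, ‖d' j‖ ≤ B') {w : ℂ} (hw : b < ‖w - p‖) :
    principalPart p b (fun j => d j + d' j) w =
      principalPart p b d w + principalPart p b d' w := by
  rw [principalPart, principalPart, principalPart,
    ← (hasSum_principalPart hb hd hw).summable.tsum_add (hasSum_principalPart hb hd' hw).summable]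
  exact tsum_congr fun j => by ring

theorem principalPart_smul (c : ℂ) (w : ℂ) :
    principalPart p b (fun j => c * d j) w = c * principalPart p b d w := by
  rw [principalPart, principalPart, ← tsum_mul_left]
  exact tsum_congr fun j => by ring

end PrincipalPart

/-- The power series `∑ c_m (ζ / r)^m`. -/
def scaledSeries (r : ℝ) (c : ℕ → ℂ) (ζ : ℂ) : ℂ := ∑' m, c m * (ζ / r) ^ m

section ScaledSeries

variable {r B : ℝ} {c : ℕ → ℂ}

theorem norm_scaledSeries_term_le (hc : ∀ j, ‖c j‖ ≤ B) (hr : 0 < r) {ζ : ℂ} {s : ℝ}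
    (hs : ‖ζ‖ ≤ s) (m : ℕ) : ‖c m * (ζ / r) ^ m‖ ≤ B * (s / r) ^ m := by
  have hB : 0 ≤ B := (norm_nonneg _).trans (hc 0)
  rw [norm_mul, norm_pow, norm_div, Complex.norm_real, Real.norm_eq_abs, abs_of_pos hr]
  gcongr
  exact hc m

theorem hasSum_scaledSeries (hc : ∀ j, ‖c j‖ ≤ B) (hr : 0 < r) {ζ : ℂ} (hζ : ‖ζ‖ < r) :
    HasSum (fun m => c m * (ζ / r) ^ m) (scaledSeries r c ζ) :=
  (Summable.of_norm_bounded ((summable_geometric_of_lt_one (by positivity)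
    ((div_lt_one hr).2 hζ)).mul_left B)
    fun m => norm_scaledSeries_term_le hc hr le_rfl m).hasSum

theorem differentiableOn_scaledSeries (hc : ∀ j, ‖c j‖ ≤ B) (hr : 0 < r) :
    DifferentiableOn ℂ (scaledSeries r c) (ball 0 r) := by
  intro ζ hζ
  rw [mem_ball_zero_iff] at hζ
  obtain ⟨s, hs1, hs2⟩ := exists_between hζ
  have hs0 : 0 < s := (norm_nonneg ζ).trans_lt hs1
  refine DifferentiableAt.differentiableWithinAt ?_
  refine DifferentiableOn.differentiableAt (s := ball 0 s) ?_
    (isOpen_ball.mem_nhds (by simpa using hs1))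
  refine Complex.differentiableOn_tsum_of_summable_norm
    ((summable_geometric_of_lt_one (by positivity) ((div_lt_one hr).2 hs2)).mul_left B)
    (fun j => by fun_prop) isOpen_ball fun j w hw =>
      norm_scaledSeries_term_le hc hr (by simpa using (mem_ball_zero_iff.1 hw).le) j

end ScaledSeries

/-! ### The geometry of the necks -/

/-- Node data close to the central points `p₀`, with small gluing parameters `t`. -/
structure NeckConfig {V E : Type*} (G : OrientedMultigraph V E) (S : NodeData E) (t : E → ℂ)
    (p₀ : E × Bool → ℂ) (ρ c₁ c₂ ε r : ℝ) : Prop where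
  chart : ∀ h, DiskChart (S.p h) (S.D h) (S.z h) ρ c₁ c₂
  c₁_pos : 0 < c₁
  c₂_pos : 0 < c₂
  ε_pos : 0 < ε
  ε_le : ε ≤ ρ * c₁
  r_eq : r = ε / (16 * c₂)
  close : ∀ h, ‖S.p h - p₀ h‖ ≤ ε / 16
  sep : ∀ h k, h ≠ k → G.base h = G.base k → 2 * ε ≤ ‖p₀ h - p₀ k‖
  disjoint : ∀ h k, h ≠ k → G.base h = G.base k → ∀ x ∈ S.D h, ε / 2 < ‖x - p₀ k‖
  t_small : ∀ e, 2 * ‖t e‖ ≤ r ^ 2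

/-- The opposite half-edge. -/
def opp {E : Type*} (h : E × Bool) : E × Bool := (h.1, !h.2)

theorem opp_opp {E : Type*} (h : E × Bool) : opp (opp h) = h := by simp [opp]

/-- The expression of a regular differential in the coordinate of a neck. -/
def neckForm {E : Type*} (S : NodeData E) (t : E → ℂ) (a : E × Bool → ℂ)
    (g : E × Bool → ℂ → ℂ) (h : E × Bool) (x : ℂ) : ℂ :=
  (g h (S.z h x) + a h / S.z h x - t h.1 / S.z h x ^ 2 * g (opp h) (t h.1 / S.z h x)) *
    deriv (S.z h) x

/-- The singular part of `neckForm`. -/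
def neckSingular {E : Type*} (S : NodeData E) (t : E → ℂ) (a : E × Bool → ℂ)
    (g : E × Bool → ℂ → ℂ) (h : E × Bool) (x : ℂ) : ℂ :=
  (a h / S.z h x - t h.1 / S.z h x ^ 2 * g (opp h) (t h.1 / S.z h x)) * deriv (S.z h) x

theorem neckForm_eq {E : Type*} (S : NodeData E) (t : E → ℂ) (a : E × Bool → ℂ)
    (g : E × Bool → ℂ → ℂ) (h : E × Bool) (x : ℂ) :
    neckForm S t a g h x = g h (S.z h x) * deriv (S.z h) x + neckSingular S t a g h x := by
  rw [neckForm, neckSingular]; ring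

namespace NeckConfig

variable {V E : Type*} {G : OrientedMultigraph V E} {S : NodeData E} {t : E → ℂ}
  {p₀ : E × Bool → ℂ} {ρ c₁ c₂ ε r : ℝ}

theorem r_pos (K : NeckConfig G S t p₀ ρ c₁ c₂ ε r) : 0 < r := by
  have := K.c₂_pos; have := K.ε_pos
  rw [K.r_eq]; positivity

theorem r_lt (K : NeckConfig G S t p₀ ρ c₁ c₂ ε r) (h : E × Bool) : r < ρ := by
  have h1 := K.c₂_pos; have h2 := K.ε_pos; have h3 := (K.chart h).le_of_constants
  have h4 := K.ε_le; have h5 := (K.chart h).radius_pos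
  rw [K.r_eq, div_lt_iff₀ (by positivity)]
  nlinarith

theorem norm_div_lt (K : NeckConfig G S t p₀ ρ c₁ c₂ ε r) (h : E × Bool) (e : E) :
    ‖t e‖ / ρ < r := by
  have h1 := K.r_pos; have h2 := K.r_lt h; have h3 := K.t_small e
  rw [div_lt_iff₀ (h1.trans h2)]
  nlinarith

theorem norm_t_div_lt (K : NeckConfig G S t p₀ ρ c₁ c₂ ε r) (e : E) {ζ : ℂ} (hζ : r ≤ ‖ζ‖) :
    ‖t e / ζ‖ < r := by
  have h1 := K.r_pos; have h3 := K.t_small e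
  rw [norm_div, div_lt_iff₀ (h1.trans_le hζ)]
  nlinarith

theorem ball_subset (K : NeckConfig G S t p₀ ρ c₁ c₂ ε r) (h : E × Bool) :
    ball (p₀ h) (ε * (15 / 16)) ⊆ S.D h := by
  refine Set.Subset.trans (ball_subset_ball' ?_) ((K.chart h).ball_subset K.c₁_pos)
  have h1 := K.close h
  have h2 := K.ε_le
  rw [dist_comm, dist_eq_norm]
  linarith

theorem closedBall_subset (K : NeckConfig G S t p₀ ρ c₁ c₂ ε r) (h : E × Bool) :
    closedBall (p₀ h) (ε / 2) ⊆ S.D h :=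
  (closedBall_subset_ball (by have := K.ε_pos; linarith)).trans (K.ball_subset h)

theorem sphere_subset (K : NeckConfig G S t p₀ ρ c₁ c₂ ε r) (h : E × Bool) {s : ℝ}
    (hs : s ≤ ε / 2) : sphere (p₀ h) s ⊆ S.D h :=
  (sphere_subset_closedBall.trans (closedBall_subset_closedBall hs)).trans (K.closedBall_subset h)

theorem mem_ball (K : NeckConfig G S t p₀ ρ c₁ c₂ ε r) (h : E × Bool) {s : ℝ}
    (hs : ε / 8 ≤ s) : S.p h ∈ ball (p₀ h) s := by
  have h1 := K.close h; have := K.ε_pos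
  rw [Metric.mem_ball, dist_eq_norm]; linarith

/-- This is the reason for the value of `r`: at distance at least `ε / 8` from `p₀ h` the distance
to the actual node point is at least `ε / 16`, hence `‖z‖ ≥ ε / (16 c₂)`. -/
theorem le_norm_z (K : NeckConfig G S t p₀ ρ c₁ c₂ ε r) (h : E × Bool) {x : ℂ} (hx : x ∈ S.D h)
    (hs : ε / 8 ≤ ‖x - p₀ h‖) : r ≤ ‖S.z h x‖ := by
  have h1 := K.close h
  have h2 := (K.chart h).upper x hx
  have h3 : ‖x - p₀ h‖ ≤ ‖x - S.p h‖ + ‖S.p h - p₀ h‖ := by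
    have := norm_add_le (x - S.p h) (S.p h - p₀ h)
    rwa [sub_add_sub_cancel] at this
  have h4 := K.c₂_pos
  rw [K.r_eq, div_le_iff₀ (by positivity)]
  linarith

theorem le_norm_z_of_mem_sphere (K : NeckConfig G S t p₀ ρ c₁ c₂ ε r) (h : E × Bool) {s : ℝ}
    (hs : ε / 8 ≤ s) (hs' : s ≤ ε / 2) {x : ℂ} (hx : x ∈ sphere (p₀ h) s) : r ≤ ‖S.z h x‖ :=
  K.le_norm_z h (K.sphere_subset h hs' hx) (by rw [mem_sphere_iff_norm.1 hx]; exact hs)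

theorem mem_annulus (K : NeckConfig G S t p₀ ρ c₁ c₂ ε r) (h : E × Bool) {x : ℂ} (hx : x ∈ S.D h)
    (hs : ε / 8 ≤ ‖x - p₀ h‖) : x ∈ annulus ρ S t h :=
  ⟨hx, (K.norm_div_lt h h.1).trans_le (K.le_norm_z h hx hs)⟩

theorem annulus_subset_piece (K : NeckConfig G S t p₀ ρ c₁ c₂ ε r) (h : E × Bool) :
    annulus ρ S t h ⊆ piece G ρ S t (G.base h) := by
  intro x hx k hk hxk
  by_cases hkh : k = h
  · subst hkh; exact hx.2
  · refine (K.norm_div_lt k k.1).trans_le (K.le_norm_z k hxk ?_)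
    have := K.disjoint h k (Ne.symm hkh) hk.symm x hx.1
    have := K.ε_pos
    linarith

theorem outside_subset_piece (K : NeckConfig G S t p₀ ρ c₁ c₂ ε r) {v : V} {x : ℂ}
    (hx : ∀ k, G.base k = v → ε / 8 ≤ ‖x - p₀ k‖) : x ∈ piece G ρ S t v := by
  intro k hk hxk
  exact (K.norm_div_lt k k.1).trans_le (K.le_norm_z k hxk (hx k hk))

theorem mem_annulus_of_mem_piece {h : E × Bool} {x : ℂ} (hx : x ∈ piece G ρ S t (G.base h))
    (hxD : x ∈ S.D h) : x ∈ annulus ρ S t h := ⟨hxD, hx h rfl hxD⟩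

theorem z_ne_zero_of_mem_annulus (K : NeckConfig G S t p₀ ρ c₁ c₂ ε r) {h : E × Bool} {x : ℂ}
    (hx : x ∈ annulus ρ S t h) : S.z h x ≠ 0 := by
  have h1 := (K.chart h).radius_pos
  exact norm_pos_iff.1 ((div_nonneg (norm_nonneg _) h1.le).trans_lt hx.2)

theorem isOpen_annulus (K : NeckConfig G S t p₀ ρ c₁ c₂ ε r) (h : E × Bool) :
    IsOpen (annulus ρ S t h) :=
  (K.chart h).differentiableOn.continuousOn.norm.isOpen_inter_preimage (K.chart h).isOpen
    isOpen_Ioi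

theorem t_div_mem_ball (K : NeckConfig G S t p₀ ρ c₁ c₂ ε r) {h : E × Bool} {x : ℂ}
    (hx : x ∈ annulus ρ S t h) : t h.1 / S.z h x ∈ ball (0 : ℂ) ρ := by
  have h1 := (K.chart h).radius_pos
  have h2 := norm_pos_iff.2 (K.z_ne_zero_of_mem_annulus hx)
  rw [mem_ball_zero_iff, norm_div, div_lt_iff₀ h2, mul_comm]
  exact (div_lt_iff₀ h1).1 hx.2

theorem differentiableAt_neckSingular (K : NeckConfig G S t p₀ ρ c₁ c₂ ε r)
    (a : E × Bool → ℂ) {g : E × Bool → ℂ → ℂ} {h : E × Bool} {R : ℝ}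
    (hg : DifferentiableOn ℂ (g (opp h)) (ball 0 R)) {x : ℂ} (hx : x ∈ S.D h)
    (hz : S.z h x ≠ 0) (ht : t h.1 / S.z h x ∈ ball (0 : ℂ) R) :
    DifferentiableAt ℂ (neckSingular S t a g h) x := by
  have h1 := ((K.chart h).hasDerivAt hx).differentiableAt
  have h2 := ((K.chart h).differentiableOn.deriv (K.chart h).isOpen).differentiableAt
    ((K.chart h).isOpen.mem_nhds hx)
  have h3 : DifferentiableAt ℂ (fun x => t h.1 / S.z h x) x := (differentiableAt_const _).fun_div h1 hz
  have h4 : DifferentiableAt ℂ (fun x => g (opp h) (t h.1 / S.z h x)) x :=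
    DifferentiableAt.comp (g := g (opp h)) x (hg.differentiableAt (isOpen_ball.mem_nhds ht)) h3
  have h5 : DifferentiableAt ℂ (fun x => t h.1 / S.z h x ^ 2) x :=
    (differentiableAt_const _).fun_div (h1.pow 2) (pow_ne_zero 2 hz)
  exact (((differentiableAt_const _).fun_div h1 hz).sub (h5.mul h4)).mul h2

theorem differentiableAt_neckForm (K : NeckConfig G S t p₀ ρ c₁ c₂ ε r)
    (a : E × Bool → ℂ) {g : E × Bool → ℂ → ℂ} (hg : ∀ h, DifferentiableOn ℂ (g h) (ball 0 ρ))
    {h : E × Bool} {x : ℂ} (hx : x ∈ annulus ρ S t h) :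
    DifferentiableAt ℂ (neckForm S t a g h) x := by
  have h1 := ((K.chart h).hasDerivAt hx.1).differentiableAt
  have h2 := ((K.chart h).differentiableOn.deriv (K.chart h).isOpen).differentiableAt
    ((K.chart h).isOpen.mem_nhds hx.1)
  have h3 := K.differentiableAt_neckSingular a (hg (opp h)) hx.1 (K.z_ne_zero_of_mem_annulus hx)
    (K.t_div_mem_ball hx)
  have h4 : DifferentiableAt ℂ (fun x => g h (S.z h x)) x :=
    DifferentiableAt.comp (g := g h) x ((hg h).differentiableAt
      (isOpen_ball.mem_nhds ((K.chart h).bijOn.mapsTo hx.1))) h1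
  have h5 : neckForm S t a g h = fun x => g h (S.z h x) * deriv (S.z h) x +
      neckSingular S t a g h x := funext (neckForm_eq S t a g h)
  rw [h5]
  exact (h4.mul h2).add h3

end NeckConfig

/-! ### Gluing functions -/

section Glue

variable {V E : Type*} (G : OrientedMultigraph V E) (p₀ : E × Bool → ℂ) (b : ℝ)

open Classical in
/-- The function equal to `T k` on the disk of radius `b` around `p₀ k`, and to `A` outside of
these disks. -/
def glued (A : V → ℂ → ℂ) (T : E × Bool → ℂ → ℂ) (v : V) (x : ℂ) : ℂ :=
  if H : ∃ k, G.base k = v ∧ ‖x - p₀ k‖ ≤ b then T H.choose x else A v x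

variable {G p₀ b} {A : V → ℂ → ℂ} {T : E × Bool → ℂ → ℂ}

theorem glued_of_outside {v : V} {x : ℂ} (hx : ∀ k, G.base k = v → b < ‖x - p₀ k‖) :
    glued G p₀ b A T v x = A v x := by
  rw [glued, dif_neg]
  rintro ⟨k, hk, hkx⟩
  exact absurd (hx k hk) hkx.not_gt

theorem glued_of_mem {W : Set ℂ} {k : E × Bool}
    (hW : ∀ k', k ≠ k' → G.base k = G.base k' → ∀ x ∈ W, b < ‖x - p₀ k'‖)
    (hA : ∀ x ∈ W, b < ‖x - p₀ k‖ → A (G.base k) x = T k x) {x : ℂ} (hx : x ∈ W) :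
    glued G p₀ b A T (G.base k) x = T k x := by
  rw [glued]
  split_ifs with H
  · have h1 := H.choose_spec
    have : k = H.choose := by
      by_contra hne
      exact absurd (hW _ hne h1.1.symm x hx) h1.2.not_gt
    rw [← this]
  · refine hA x hx ?_
    by_contra hcon
    exact H ⟨k, rfl, not_lt.1 hcon⟩

end Glue

end OpenNodes

end

/-! ### The kernels relating Taylor coefficients in the necks and principal parts. -/

noncomputable section

namespace OpenNodes

open Metric Filter

variable {V E : Type*} {G : OrientedMultigraph V E} {S : NodeData E} {t : E → ℂ}
  {p₀ : E × Bool → ℂ} {ρ c₁ c₂ ε r : ℝ}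

/-- The sum of the principal parts at the half-edges based at `v`. -/
def vertexForm (hfin : G.LocallyFinite) (p₀ : E × Bool → ℂ) (b : ℝ) (d : E × Bool → ℕ → ℂ)
    (v : V) (w : ℂ) : ℂ := ∑ k ∈ hfin.halfEdges v, principalPart (p₀ k) b (d k) w

open Classical in
/-- The kernel computing the Taylor coefficients in the necks from the principal parts. -/
def taylorKernel (G : OrientedMultigraph V E) (S : NodeData E) (p₀ : E × Bool → ℂ) (ε r : ℝ)
    (i j : (E × Bool) × ℕ) : ℂ :=
  if G.base j.1 = G.base i.1 then
    (2 * Real.pi * Complex.I)⁻¹ * (r ^ i.2 * 2 ^ j.2 * (ε / 4 : ℝ) ^ j.2) *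
      ∮ w in C(p₀ i.1, ε / 2), (S.z i.1 w ^ (i.2 + 1))⁻¹ * ((w - p₀ j.1) ^ (j.2 + 1))⁻¹
  else 0

/-- The kernel computing the principal parts from the Taylor coefficients at the opposite
half-edge. -/
def inversionKernel (S : NodeData E) (t : E → ℂ) (p₀ : E × Bool → ℂ) (ε r : ℝ) (h : E × Bool)
    (j n : ℕ) : ℂ :=
  (2 * Real.pi * Complex.I)⁻¹ * (-(2 ^ n * ((r : ℂ) ^ n)⁻¹ * (((ε / 4 : ℝ) : ℂ) ^ j)⁻¹ * (j / (n + 1)))) *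
    ∮ y in C(p₀ h, ε / 8), (t h.1 / S.z h y) ^ (n + 1) * (y - p₀ h) ^ (j - 1)

theorem norm_two_pi_I_inv_mul_circleIntegral_le {f : ℂ → ℂ} {c : ℂ} {R C : ℝ} (hR : 0 ≤ R)
    (hf : ∀ z ∈ sphere c R, ‖f z‖ ≤ C) :
    ‖(2 * Real.pi * Complex.I : ℂ)⁻¹ * ∮ z in C(c, R), f z‖ ≤ R * C :=
  circleIntegral.norm_two_pi_i_inv_smul_integral_le_of_norm_le_const hR hf

namespace NeckConfig

theorem half_le_norm_sub (K : NeckConfig G S t p₀ ρ c₁ c₂ ε r) {h k : E × Bool}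
    (hk : G.base k = G.base h) {w : ℂ} (hw : w ∈ sphere (p₀ h) (ε / 2)) :
    ε / 2 ≤ ‖w - p₀ k‖ := by
  have hε := K.ε_pos
  rw [mem_sphere_iff_norm] at hw
  by_cases hkh : h = k
  · subst hkh; exact hw.ge
  · have h1 := K.sep h k hkh hk.symm
    have h2 : ‖p₀ h - p₀ k‖ ≤ ‖w - p₀ k‖ + ‖w - p₀ h‖ := by
      have := norm_sub_le (w - p₀ k) (w - p₀ h)
      rwa [sub_sub_sub_cancel_left] at this
    linarith

theorem z_ne_zero_of_mem_sphere (K : NeckConfig G S t p₀ ρ c₁ c₂ ε r) (h : E × Bool) {s : ℝ}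
    (hs : ε / 8 ≤ s) (hs' : s ≤ ε / 2) {x : ℂ} (hx : x ∈ sphere (p₀ h) s) : S.z h x ≠ 0 :=
  norm_pos_iff.1 (K.r_pos.trans_le (K.le_norm_z_of_mem_sphere h hs hs' hx))

theorem continuousOn_z (K : NeckConfig G S t p₀ ρ c₁ c₂ ε r) (h : E × Bool) {s : ℝ}
    (hs' : s ≤ ε / 2) : ContinuousOn (S.z h) (sphere (p₀ h) s) :=
  (K.chart h).differentiableOn.continuousOn.mono (K.sphere_subset h hs')

theorem continuousOn_inv_z_pow (K : NeckConfig G S t p₀ ρ c₁ c₂ ε r) (h : E × Bool) {s : ℝ}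
    (hs : ε / 8 ≤ s) (hs' : s ≤ ε / 2) (m : ℕ) :
    ContinuousOn (fun x => (S.z h x ^ m)⁻¹) (sphere (p₀ h) s) :=
  ((K.continuousOn_z h hs').pow m).inv₀ fun _ hx =>
    pow_ne_zero _ (K.z_ne_zero_of_mem_sphere h hs hs' hx)

theorem norm_inv_z_pow_le (K : NeckConfig G S t p₀ ρ c₁ c₂ ε r) (h : E × Bool) {s : ℝ}
    (hs : ε / 8 ≤ s) (hs' : s ≤ ε / 2) (m : ℕ) {x : ℂ} (hx : x ∈ sphere (p₀ h) s) :
    ‖(S.z h x ^ m)⁻¹‖ ≤ (r ^ m)⁻¹ := by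
  have h1 := K.le_norm_z_of_mem_sphere h hs hs' hx
  have h2 := K.r_pos
  rw [norm_inv, norm_pow]
  gcongr

/-- The normalisation `(ε / 4) ^ n` times the weight `2 ^ n` is `(ε / 2) ^ n`, exactly compensated
by the distance at least `ε / 2` from the circle to `p₀ k`; likewise `r ^ m` is compensated by `‖z‖
≥ r`. -/
theorem norm_taylorKernel_le (K : NeckConfig G S t p₀ ρ c₁ c₂ ε r) (i j : (E × Bool) × ℕ) :
    ‖taylorKernel G S p₀ ε r i j‖ ≤ r⁻¹ := by
  have hε := K.ε_pos
  have hr := K.r_pos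
  rw [taylorKernel]
  split_ifs with hij
  · rw [mul_right_comm, norm_mul]
    have h1 := norm_two_pi_I_inv_mul_circleIntegral_le (c := p₀ i.1) (R := ε / 2)
      (f := fun w => (S.z i.1 w ^ (i.2 + 1))⁻¹ * ((w - p₀ j.1) ^ (j.2 + 1))⁻¹)
      (C := (r ^ (i.2 + 1))⁻¹ * ((ε / 2) ^ (j.2 + 1))⁻¹) (by positivity) (fun w hw => by
        rw [norm_mul]
        have h2 := K.norm_inv_z_pow_le i.1 (by linarith) le_rfl (i.2 + 1) hw
        have h3 := K.half_le_norm_sub hij hw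
        rw [norm_inv ((w - p₀ j.1) ^ (j.2 + 1)), norm_pow]
        gcongr)
    have h2 : ‖(r : ℂ) ^ i.2 * 2 ^ j.2 * ((ε / 4 : ℝ) : ℂ) ^ j.2‖ =
        r ^ i.2 * 2 ^ j.2 * (ε / 4) ^ j.2 := by
      rw [norm_mul, norm_mul, norm_pow, norm_pow, norm_pow, Complex.norm_real, Complex.norm_real,
        Complex.norm_ofNat, Real.norm_eq_abs, Real.norm_eq_abs, abs_of_pos hr,
        abs_of_pos (by positivity)]
    rw [h2]
    calc _ ≤ ε / 2 * ((r ^ (i.2 + 1))⁻¹ * ((ε / 2) ^ (j.2 + 1))⁻¹) *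
          (r ^ i.2 * 2 ^ j.2 * (ε / 4) ^ j.2) := by gcongr
      _ = r⁻¹ := by
        have h3 : (ε / 4) ^ j.2 * 2 ^ j.2 = (ε / 2) ^ j.2 := by rw [← mul_pow]; congr 1; ring
        have h4 : (ε / 2) ^ j.2 ≠ 0 := by positivity
        rw [mul_assoc (r ^ i.2), mul_comm (2 ^ j.2), h3, pow_succ, pow_succ]
        field_simp
  · rw [norm_zero]; positivity

/-- One factor `‖t‖ / r` is left over and makes the operator small. The other `n` factors are at
most `r / 2` and absorb `2 ^ n (r ^ n)⁻¹`, while the factor `j ≤ 2 ^ j` is absorbed by integrating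
at radius `ε / 8` and normalising by `ε / 4`. -/
theorem norm_inversionKernel_le (K : NeckConfig G S t p₀ ρ c₁ c₂ ε r) (h : E × Bool) (j n : ℕ) :
    ‖inversionKernel S t p₀ ε r h j n‖ ≤ ‖t h.1‖ / r := by
  have hε := K.ε_pos
  have hr := K.r_pos
  have ht := K.t_small h.1
  -- The exponent `j - 1` is a truncated subtraction; at `j = 0` the factor `j` makes it irrelevant.
  rcases Nat.eq_zero_or_pos j with rfl | hj
  · simp only [inversionKernel, Nat.cast_zero, zero_div, mul_zero, neg_zero, zero_mul, norm_zero]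
    positivity
  obtain ⟨i, rfl⟩ := Nat.exists_eq_succ_of_ne_zero hj.ne'
  rw [inversionKernel, mul_right_comm, norm_mul]
  have h1 := norm_two_pi_I_inv_mul_circleIntegral_le (c := p₀ h) (R := ε / 8)
    (f := fun y => (t h.1 / S.z h y) ^ (n + 1) * (y - p₀ h) ^ (i.succ - 1))
    (C := (‖t h.1‖ / r) ^ (n + 1) * (ε / 8) ^ i) (by positivity) (fun w hw => by
      have h2 := K.le_norm_z_of_mem_sphere h le_rfl (by linarith) hw
      rw [norm_mul, norm_pow, norm_pow, mem_sphere_iff_norm.1 hw, norm_div, Nat.succ_sub_one]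
      gcongr)
  have h2 : ‖-((2 : ℂ) ^ n * ((r : ℂ) ^ n)⁻¹ * (((ε / 4 : ℝ) : ℂ) ^ i.succ)⁻¹ *
      ((i.succ : ℂ) / (n + 1)))‖ =
      2 ^ n * (r ^ n)⁻¹ * ((ε / 4) ^ i.succ)⁻¹ * (i.succ / (n + 1)) := by
    have h3 : ((n : ℂ) + 1) = ((n + 1 : ℕ) : ℂ) := by push_cast; rfl
    rw [norm_neg, norm_mul, norm_mul, norm_mul, norm_inv, norm_inv, norm_pow, norm_pow, norm_pow,
      norm_div, h3, Complex.norm_natCast, Complex.norm_natCast, Complex.norm_real,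
      Complex.norm_real, Complex.norm_ofNat, Real.norm_eq_abs, Real.norm_eq_abs, abs_of_pos hr,
      abs_of_pos (by positivity)]
    push_cast; rfl
  rw [h2]
  have h4 : (i.succ : ℝ) / (n + 1) ≤ 2 ^ i.succ := by
    refine (div_le_self (by positivity) (by linarith [(Nat.cast_nonneg n : (0:ℝ) ≤ n)])).trans ?_
    exact_mod_cast Nat.lt_two_pow_self.le
  have h5 : (‖t h.1‖ / r) ^ n ≤ (r / 2) ^ n := by
    refine pow_le_pow_left₀ (by positivity) ?_ n
    rw [div_le_iff₀ hr]; nlinarith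
  calc _ ≤ ε / 8 * ((‖t h.1‖ / r) ^ (n + 1) * (ε / 8) ^ i) *
        (2 ^ n * (r ^ n)⁻¹ * ((ε / 4) ^ i.succ)⁻¹ * 2 ^ i.succ) := by gcongr
    _ = ‖t h.1‖ / r * ((‖t h.1‖ / r) ^ n * (2 ^ n * (r ^ n)⁻¹)) := by
      have h3 : (ε / 8) ^ (i + 1) * 2 ^ (i + 1) = (ε / 4) ^ (i + 1) := by
        rw [← mul_pow]; congr 1; ring
      have h6 : (ε / 4) ^ (i + 1) ≠ 0 := by positivity
      rw [pow_succ (‖t h.1‖ / r)]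
      have h7 : ε / 8 * ((‖t h.1‖ / r) ^ n * (‖t h.1‖ / r) * (ε / 8) ^ i) *
        (2 ^ n * (r ^ n)⁻¹ * ((ε / 4) ^ i.succ)⁻¹ * 2 ^ i.succ) =
        ((ε / 8) ^ (i + 1) * 2 ^ (i + 1)) * ((ε / 4) ^ (i + 1))⁻¹ * (‖t h.1‖ / r *
        ((‖t h.1‖ / r) ^ n * (2 ^ n * (r ^ n)⁻¹))) := by
        rw [pow_succ (ε / 8), Nat.succ_eq_add_one]; ring
      rw [h7, h3, mul_inv_cancel₀ h6, one_mul]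
    _ ≤ ‖t h.1‖ / r * ((r / 2) ^ n * (2 ^ n * (r ^ n)⁻¹)) := by gcongr
    _ = ‖t h.1‖ / r := by rw [div_pow]; field_simp

theorem continuousOn_vertexForm_term (K : NeckConfig G S t p₀ ρ c₁ c₂ ε r) {h k : E × Bool}
    (hk : G.base k = G.base h) (n : ℕ) :
    ContinuousOn (fun w => ((w - p₀ k) ^ n)⁻¹) (sphere (p₀ h) (ε / 2)) := by
  have hε := K.ε_pos
  refine ContinuousOn.inv₀ (by fun_prop) fun w hw => pow_ne_zero _ (norm_pos_iff.1 ?_)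
  exact (half_pos hε).trans_le (K.half_le_norm_sub hk hw)

theorem differentiableAt_vertexForm (hfin : G.LocallyFinite) {b : ℝ} (hb : 0 ≤ b)
    {d : E × Bool → ℕ → ℂ} {B : E × Bool → ℝ} (hd : ∀ k n, ‖d k n‖ ≤ B k) {v : V} {w : ℂ}
    (hw : ∀ k, G.base k = v → b < ‖w - p₀ k‖) :
    DifferentiableAt ℂ (vertexForm hfin p₀ b d v) w := by
  have : vertexForm hfin p₀ b d v =
      fun w => ∑ k ∈ hfin.halfEdges v, principalPart (p₀ k) b (d k) w := rfl
  rw [this]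
  refine DifferentiableAt.fun_sum fun k hk => ?_
  exact differentiableAt_principalPart hb (hd k) (hw k (hfin.mem_halfEdges.1 hk))

/-- On the circle of radius `ε / 2` the principal parts, normalised at radius `ε / 4`, converge
geometrically with ratio `1 / 2`, so they can be integrated term by term. Half-edges near `h` but
not based at the same vertex have kernel zero. -/
theorem taylor_coefficient_eq (K : NeckConfig G S t p₀ ρ c₁ c₂ ε r) (hfin : G.LocallyFinite)
    {d : E × Bool → ℕ → ℂ} {B : E × Bool → ℝ} (hd : ∀ k n, ‖d k n‖ ≤ B k) (h : E × Bool) (m : ℕ) :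
    (2 * Real.pi * Complex.I : ℂ)⁻¹ * (r ^ m * ∮ w in C(p₀ h, ε / 2),
        (S.z h w ^ (m + 1))⁻¹ * vertexForm hfin p₀ (ε / 4) d (G.base h) w) =
      ∑ k ∈ hfin.nearby h.1, ∑' n,
        (2 : ℂ)⁻¹ ^ n * taylorKernel G S p₀ ε r (h, m) (k, n) * d k n := by
  classical
  have hε := K.ε_pos
  have hr := K.r_pos
  have hz := K.continuousOn_inv_z_pow h (s := ε / 2) (by linarith) le_rfl (m + 1)
  have hsub : hfin.halfEdges (G.base h) ⊆ hfin.nearby h.1 := fun k hk =>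
    hfin.mem_nearby_of_base_eq (hfin.mem_halfEdges.1 hk)
  rw [← Finset.sum_subset hsub]
  swap
  · intro k _ hk
    rw [hfin.mem_halfEdges] at hk
    simp [taylorKernel, hk]
  simp only [vertexForm, Finset.mul_sum]
  rw [circleIntegral.integral_fun_sum]
  swap
  · intro k hk
    rw [hfin.mem_halfEdges] at hk
    refine ContinuousOn.circleIntegrable (by positivity) (hz.mul fun w hw => ?_)
    refine ((differentiableAt_principalPart (by positivity) (hd k) ?_).continuousAt).continuousWithinAt
    have := K.half_le_norm_sub hk hw
    linarith
  rw [Finset.mul_sum, Finset.mul_sum]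
  refine Finset.sum_congr rfl fun k hk => ?_
  rw [hfin.mem_halfEdges] at hk
  have hB : 0 ≤ B k := (norm_nonneg _).trans (hd k 0)
  have hterm := K.continuousOn_vertexForm_term hk
  have key := hasSum_circleIntegral_of_bounded (c := p₀ h) (R := ε / 2)
    (f := fun n w => (d k n * ((ε / 4 : ℝ) : ℂ) ^ n) *
      ((S.z h w ^ (m + 1))⁻¹ * ((w - p₀ k) ^ (n + 1))⁻¹))
    (F := fun w => (S.z h w ^ (m + 1))⁻¹ * principalPart (p₀ k) (ε / 4) (d k) w)
    (u := fun n => (r ^ (m + 1))⁻¹ * (B k / (ε / 2) * (ε / 4 / (ε / 2)) ^ n))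
    (by positivity) (fun n => continuousOn_const.mul (hz.mul (hterm _)))
    (Summable.mul_left _ (Summable.mul_left _ (summable_geometric_of_lt_one (by positivity)
      ((div_lt_one (by positivity)).2 (by linarith)))))
    (fun n w hw => by
      have h1 := norm_principalPart_term_le (p := p₀ k) (b := ε / 4) (by positivity) (hd k)
        (half_pos hε) (K.half_le_norm_sub hk hw) n
      have h2 := K.norm_inv_z_pow_le h (by linarith) le_rfl (m + 1) hw
      have h3 : (d k n * ((ε / 4 : ℝ) : ℂ) ^ n) *
          ((S.z h w ^ (m + 1))⁻¹ * ((w - p₀ k) ^ (n + 1))⁻¹) = (S.z h w ^ (m + 1))⁻¹ *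
          (d k n * ((ε / 4 : ℝ) : ℂ) ^ n / (w - p₀ k) ^ (n + 1)) := by
        rw [div_eq_mul_inv]; ring
      rw [h3, norm_mul]
      gcongr)
    (fun w hw => by
      have h1 := hasSum_principalPart (p := p₀ k) (b := ε / 4) (w := w) (by positivity) (hd k) (by
        have := K.half_le_norm_sub hk hw; linarith)
      refine (h1.mul_left (S.z h w ^ (m + 1))⁻¹).of_eq (fun n => ?_) rfl
      rw [div_eq_mul_inv]; ring)
  simp only [circleIntegral.integral_const_mul] at key
  have key' := (key.mul_left ((r : ℂ) ^ m)).mul_left (2 * Real.pi * Complex.I : ℂ)⁻¹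
  rw [← key'.tsum_eq]
  refine tsum_congr fun n => ?_
  rw [taylorKernel, if_pos hk]
  have h2 : (2 : ℂ)⁻¹ ^ n * 2 ^ n = 1 := by rw [← mul_pow]; norm_num
  linear_combination (-((2 * Real.pi * Complex.I : ℂ)⁻¹ * r ^ m * ((ε / 4 : ℝ) : ℂ) ^ n * d k n *
    (∮ w in C(p₀ h, ε / 2), (S.z h w ^ (m + 1))⁻¹ * ((w - p₀ k) ^ (n + 1))⁻¹))) * h2

/-- The node point `S.p h` is not the centre `p₀ h`, so a simple pole there contributes to Laurent
coefficients of all orders at `p₀ h`. -/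
theorem circleIntegral_logDeriv_mul_pow (K : NeckConfig G S t p₀ ρ c₁ c₂ ε r) (h : E × Bool)
    (j : ℕ) :
    (∮ y in C(p₀ h, ε / 8), deriv (S.z h) y / S.z h y * (y - p₀ h) ^ j) =
      2 * Real.pi * Complex.I * (S.p h - p₀ h) ^ j := by
  have hε := K.ε_pos
  have hsub := K.sphere_subset h (s := ε / 8) (by linarith)
  have hmem := K.mem_ball h (s := ε / 8) le_rfl
  have hne : ∀ x ∈ sphere (p₀ h) (ε / 8), x ≠ S.p h := by
    rintro x hx rfl
    rw [Metric.mem_ball] at hmem; rw [mem_sphere] at hx; linarith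
  obtain ⟨L, hL, hL'⟩ := (K.chart h).exists_logDeriv_sub
  have h1 : (∮ y in C(p₀ h, ε / 8), deriv (S.z h) y / S.z h y * (y - p₀ h) ^ j) =
      ∮ y in C(p₀ h, ε / 8), ((y - S.p h)⁻¹ • (y - p₀ h) ^ j + L y * (y - p₀ h) ^ j) := by
    refine circleIntegral.integral_congr (by positivity) fun y hy => ?_
    rw [hL' y (hsub hy) (hne y hy), smul_eq_mul]; ring
  rw [h1, circleIntegral.integral_add, (K.chart h).circleIntegral_eq_zero (F := fun y => L y *
    (y - p₀ h) ^ j) (hL.mul (by fun_prop)) (by positivity) hsub, add_zero,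
    DiffContOnCl.circleIntegral_sub_inv_smul (DifferentiableOn.diffContOnCl (by fun_prop)) hmem,
    smul_eq_mul]
  · refine ContinuousOn.circleIntegrable (by positivity) ?_
    exact (ContinuousOn.inv₀ (by fun_prop) fun x hx => sub_ne_zero.2 (hne x hx)).smul (by fun_prop)
  · exact ContinuousOn.circleIntegrable (by positivity)
      ((hL.continuousOn.mono hsub).mul (by fun_prop))

/-- Integration by parts with the primitive `(t / z) ^ (n + 1) / (n + 1)`. It removes `deriv z` from
the kernel, so that bounds and analyticity in the parameters only require those of `z` itself. -/
theorem circleIntegral_inversion_mul_pow (K : NeckConfig G S t p₀ ρ c₁ c₂ ε r) (h : E × Bool)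
    (j n : ℕ) :
    (∮ y in C(p₀ h, ε / 8), -(t h.1 / S.z h y ^ 2 * (t h.1 / S.z h y) ^ n * deriv (S.z h) y) *
        (y - p₀ h) ^ j) =
      -(j / (n + 1)) * ∮ y in C(p₀ h, ε / 8), (t h.1 / S.z h y) ^ (n + 1) * (y - p₀ h) ^ (j - 1) := by
  have hε := K.ε_pos
  have hsub := K.sphere_subset h (s := ε / 8) (by linarith)
  have hz0 := fun x hx => K.z_ne_zero_of_mem_sphere h (s := ε / 8) (x := x) le_rfl (by linarith) hx
  have hzc := K.continuousOn_z h (s := ε / 8) (by linarith)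
  have hn : (n : ℂ) + 1 ≠ 0 := Nat.cast_add_one_ne_zero n
  have hint : ∀ m, ContinuousOn (fun y => (t h.1 / S.z h y) ^ m) (sphere (p₀ h) (ε / 8)) := fun m =>
    (continuousOn_const.div hzc hz0).pow m
  rw [← circleIntegral.integral_const_mul, ← sub_eq_zero, ← circleIntegral.integral_sub]
  · refine circleIntegral.integral_eq_zero_of_hasDerivWithinAt
      (f := fun y => (t h.1 / S.z h y) ^ (n + 1) / (n + 1) * (y - p₀ h) ^ j) (by positivity)
      fun y hy => ?_
    have h0 := hz0 y hy
    have h1 : HasDerivAt (fun x => t h.1 / S.z h x) (-t h.1 * deriv (S.z h) y / S.z h y ^ 2) y := by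
      refine ((hasDerivAt_const y (t h.1)).fun_div ((K.chart h).hasDerivAt (hsub hy)) h0).congr_deriv ?_
      simp
    have h2 := ((h1.fun_pow (n + 1)).div_const ((n : ℂ) + 1)).fun_mul
      (((hasDerivAt_id y).sub_const (p₀ h)).fun_pow j)
    refine h2.hasDerivWithinAt.congr_deriv ?_
    simp only [Nat.add_sub_cancel, id, Nat.cast_add, Nat.cast_one]
    field_simp
    ring
  · refine ContinuousOn.circleIntegrable (by positivity) ?_
    refine ContinuousOn.mul (ContinuousOn.neg ((ContinuousOn.mul ?_ (hint n)).mul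
      ((K.chart h).continuousOn_deriv.mono hsub))) (by fun_prop)
    exact continuousOn_const.div (hzc.pow 2) fun x hx => pow_ne_zero _ (hz0 x hx)
  · exact ContinuousOn.circleIntegrable (by positivity)
      (continuousOn_const.mul ((hint _).mul (by fun_prop)))

/-- The singular part is split: the pole gives the explicit term moved to the left-hand quantity,
and in the inverted term the series of the opposite half-edge is expanded (it converges since `‖t /
z‖ ≤ r / 2`) and each term is integrated by parts. -/
theorem principal_coefficient_eq (K : NeckConfig G S t p₀ ρ c₁ c₂ ε r) (a : E × Bool → ℂ)
    {c : E × Bool → ℕ → ℂ} {B : E × Bool → ℝ} (hc : ∀ k n, ‖c k n‖ ≤ B k) (h : E × Bool) (j : ℕ) :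
    HasSum (fun n => (2 : ℂ)⁻¹ ^ n * inversionKernel S t p₀ ε r h j n * c (opp h) n)
      ((2 * Real.pi * Complex.I : ℂ)⁻¹ * ((((ε / 4 : ℝ) : ℂ) ^ j)⁻¹ * ∮ y in C(p₀ h, ε / 8),
        neckSingular S t a (fun k => scaledSeries r (c k)) h y * (y - p₀ h) ^ j) -
        ((S.p h - p₀ h) / (ε / 4 : ℝ)) ^ j * a h) := by
  have hε := K.ε_pos
  have hr := K.r_pos
  have hsub := K.sphere_subset h (s := ε / 8) (by linarith)
  have hz0 := fun x hx => K.z_ne_zero_of_mem_sphere h (s := ε / 8) (x := x) le_rfl (by linarith) hx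
  have hzc := K.continuousOn_z h (s := ε / 8) (by linarith)
  have hzd := (K.chart h).continuousOn_deriv.mono hsub
  have hB : 0 ≤ B (opp h) := (norm_nonneg _).trans (hc _ 0)
  have hlt : ∀ x ∈ sphere (p₀ h) (ε / 8), ‖t h.1 / S.z h x‖ < r := fun x hx =>
    K.norm_t_div_lt h.1 (K.le_norm_z_of_mem_sphere h le_rfl (by linarith) hx)
  have hle : ∀ x ∈ sphere (p₀ h) (ε / 8), ‖t h.1 / S.z h x‖ ≤ r / 2 := fun x hx => by
    have h1 := K.le_norm_z_of_mem_sphere h le_rfl (by linarith) hx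
    have h2 := K.t_small h.1
    rw [norm_div, div_le_iff₀ (hr.trans_le h1)]
    nlinarith
  have hc1 : ContinuousOn (fun y => -(t h.1 / S.z h y ^ 2 * deriv (S.z h) y) * (y - p₀ h) ^ j)
      (sphere (p₀ h) (ε / 8)) :=
    (((continuousOn_const.div (hzc.pow 2) fun x hx => pow_ne_zero _ (hz0 x hx)).mul hzd).neg).mul
      (by fun_prop)
  obtain ⟨M, hM⟩ := (isCompact_sphere (p₀ h) (ε / 8)).exists_bound_of_continuousOn hc1
  have hg : ContinuousOn (fun y => scaledSeries r (c (opp h)) (t h.1 / S.z h y))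
      (sphere (p₀ h) (ε / 8)) :=
    (differentiableOn_scaledSeries (hc (opp h)) hr).continuousOn.comp
      (continuousOn_const.div hzc hz0) fun x hx => by simpa using hlt x hx
  have key := hasSum_circleIntegral_of_bounded (c := p₀ h) (R := ε / 8)
    (f := fun n y => (c (opp h) n * ((r : ℂ) ^ n)⁻¹) *
      (-(t h.1 / S.z h y ^ 2 * (t h.1 / S.z h y) ^ n * deriv (S.z h) y) * (y - p₀ h) ^ j))
    (F := fun y => -(t h.1 / S.z h y ^ 2 * deriv (S.z h) y) * (y - p₀ h) ^ j *
      scaledSeries r (c (opp h)) (t h.1 / S.z h y))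
    (u := fun n => M * (B (opp h) * (r / 2 / r) ^ n))
    (by positivity)
    (fun n => continuousOn_const.mul ((ContinuousOn.neg (((continuousOn_const.div (hzc.pow 2)
      fun x hx => pow_ne_zero _ (hz0 x hx)).mul
        ((continuousOn_const.div hzc hz0).pow n)).mul hzd)).mul (by fun_prop)))
    (Summable.mul_left _ (Summable.mul_left _ (summable_geometric_of_lt_one (by positivity)
      ((div_lt_one hr).2 (by linarith)))))
    (fun n y hy => by
      have h1 := norm_scaledSeries_term_le (hc (opp h)) hr (hle y hy) n
      have h2 := hM y hy
      have h3 : (c (opp h) n * ((r : ℂ) ^ n)⁻¹) *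
          (-(t h.1 / S.z h y ^ 2 * (t h.1 / S.z h y) ^ n * deriv (S.z h) y) * (y - p₀ h) ^ j) =
          (-(t h.1 / S.z h y ^ 2 * deriv (S.z h) y) * (y - p₀ h) ^ j) *
          (c (opp h) n * (t h.1 / S.z h y / r) ^ n) := by
        rw [div_pow (t h.1 / S.z h y)]; ring
      rw [h3, norm_mul]
      exact mul_le_mul h2 h1 (norm_nonneg _) ((norm_nonneg _).trans h2))
    (fun y hy => by
      refine ((hasSum_scaledSeries (hc (opp h)) hr (hlt y hy)).mul_left
        (-(t h.1 / S.z h y ^ 2 * deriv (S.z h) y) * (y - p₀ h) ^ j)).of_eq (fun n => ?_) rfl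
      rw [div_pow (t h.1 / S.z h y)]; ring)
  simp only [circleIntegral.integral_const_mul, K.circleIntegral_inversion_mul_pow] at key
  have hsplit : (∮ y in C(p₀ h, ε / 8),
      neckSingular S t a (fun k => scaledSeries r (c k)) h y * (y - p₀ h) ^ j) =
      a h * (2 * Real.pi * Complex.I * (S.p h - p₀ h) ^ j) +
      ∮ y in C(p₀ h, ε / 8), -(t h.1 / S.z h y ^ 2 * deriv (S.z h) y) * (y - p₀ h) ^ j *
      scaledSeries r (c (opp h)) (t h.1 / S.z h y) := by
    rw [← K.circleIntegral_logDeriv_mul_pow h j, ← circleIntegral.integral_const_mul,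
      ← circleIntegral.integral_add]
    · refine circleIntegral.integral_congr (by positivity) fun y hy => ?_
      simp only [neckSingular]
      ring
    · exact ContinuousOn.circleIntegrable (by positivity)
        (continuousOn_const.mul ((hzd.div hzc hz0).mul (by fun_prop)))
    · exact ContinuousOn.circleIntegrable (by positivity) (hc1.mul hg)
  have key' := (key.mul_left (((ε / 4 : ℝ) : ℂ) ^ j)⁻¹).mul_left (2 * Real.pi * Complex.I : ℂ)⁻¹
  refine key'.of_eq (fun n => ?_) ?_
  · rw [inversionKernel]
    have h2 : (2 : ℂ)⁻¹ ^ n * 2 ^ n = 1 := by rw [← mul_pow]; norm_num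
    linear_combination (-((2 * Real.pi * Complex.I : ℂ)⁻¹ * ((r : ℂ) ^ n)⁻¹ *
      (((ε / 4 : ℝ) : ℂ) ^ j)⁻¹ * (j / (n + 1)) * c (opp h) n *
      (∮ y in C(p₀ h, ε / 8), (t h.1 / S.z h y) ^ (n + 1) * (y - p₀ h) ^ (j - 1)))) * h2
  · rw [hsplit, div_pow]
    have h3 := Complex.two_pi_I_ne_zero
    have h4 : ((ε / 4 : ℝ) : ℂ) ≠ 0 := Complex.ofReal_ne_zero.2 (by positivity)
    field_simp
    ring

end NeckConfig

end OpenNodes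

end

noncomputable section

namespace OpenNodes

open Metric Filter Bornology

/-! ### Behaviour at infinity -/

theorem HolomorphicAtInfty.congr {f f' : ℂ → ℂ} (hf : HolomorphicAtInfty f)
    (h : ∀ᶠ x in cobounded ℂ, f' x = f x) : HolomorphicAtInfty f' := by
  obtain ⟨g, hg, hg'⟩ := hf
  refine ⟨g, hg, ?_⟩
  filter_upwards [hg', tendsto_inv₀_nhdsNE_zero.eventually h] with w h1 h2
  rw [h1, h2]

/-- The form `dz` has a double pole at infinity, so a double zero of the coefficient is what is
needed; the quotient by `w ^ 2` is an iterated `dslope`. -/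
theorem holomorphicAtInfty_of_double_zero {f Ψ : ℂ → ℂ} (hΨ : AnalyticAt ℂ Ψ 0) (h0 : Ψ 0 = 0)
    (h1 : deriv Ψ 0 = 0) (hf : ∀ᶠ w in 𝓝[≠] (0 : ℂ), f w⁻¹ = Ψ w) : HolomorphicAtInfty f := by
  obtain ⟨s, hs⟩ := hΨ
  have h2 := hs.has_fpower_series_dslope_fslope
  have h3 := h2.has_fpower_series_dslope_fslope
  refine ⟨fun w => -dslope (dslope Ψ 0) 0 w, h3.analyticAt.neg, ?_⟩
  filter_upwards [hf, self_mem_nhdsWithin] with w hw hw0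
  have hw0' : w ≠ 0 := hw0
  rw [dslope_of_ne _ hw0', slope_def_field, dslope_of_ne _ hw0', slope_def_field, dslope_same, h1,
    h0, hw]
  field_simp
  ring

theorem tendsto_zero_of_holomorphicAtInfty {f : ℂ → ℂ} (hf : HolomorphicAtInfty f) :
    Tendsto f (cobounded ℂ) (𝓝 0) := by
  obtain ⟨g, hg, hg'⟩ := hf
  have h1 : ∀ᶠ x in cobounded ℂ, f x = -(x⁻¹) ^ 2 * g x⁻¹ := by
    filter_upwards [tendsto_inv₀_cobounded'.eventually hg',
      (eventually_ne_cobounded (0 : ℂ))] with x hx hx0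
    rw [hx, inv_inv]
    field_simp
  have h2 : Tendsto (fun w : ℂ => -w ^ 2 * g w) (𝓝 0) (𝓝 0) := by
    have : ContinuousAt (fun w : ℂ => -w ^ 2 * g w) 0 :=
      ContinuousAt.mul (by fun_prop) hg.continuousAt
    simpa [ContinuousAt] using this
  exact (h2.comp (tendsto_inv₀_cobounded (α := ℂ))).congr' (h1.mono fun x hx => hx.symm)

theorem principalPart_eq_scaledSeries (p : ℂ) (b : ℝ) (d : ℕ → ℂ) (w : ℂ) :
    principalPart p b d w = (w - p)⁻¹ * scaledSeries b⁻¹ d (w - p)⁻¹ := by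
  rw [principalPart, scaledSeries, ← tsum_mul_left]
  refine tsum_congr fun j => ?_
  rw [Complex.ofReal_inv, div_inv_eq_mul, mul_pow, inv_pow, pow_succ, div_eq_mul_inv, mul_inv]
  ring

variable {V E : Type*} {G : OrientedMultigraph V E} {S : NodeData E} {t : E → ℂ}
  {p₀ : E × Bool → ℂ} {ρ c₁ c₂ ε r : ℝ}

/-- In `w = 1 / z` the principal part at `p` is a power series in `u = w / (1 - p w)` without
constant term, whose first-order coefficient is the residue. The sum vanishes to second order
because the residues add up to zero. -/
theorem holomorphicAtInfty_vertexForm (hfin : G.LocallyFinite) {b : ℝ} (hb : 0 < b)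
    {d : E × Bool → ℕ → ℂ} {B : E × Bool → ℝ} (hd : ∀ k n, ‖d k n‖ ≤ B k) {v : V}
    (hsum : ∑ k ∈ hfin.halfEdges v, d k 0 = 0) :
    HolomorphicAtInfty (vertexForm hfin p₀ b d v) := by
  let u : ℂ → ℂ → ℂ := fun p w => w / (1 - p * w)
  have hu : ∀ p, AnalyticAt ℂ (u p) 0 := fun p =>
    analyticAt_id.div (analyticAt_const.sub (analyticAt_const.mul analyticAt_id)) (by simp)
  have hu0 : ∀ p, u p 0 = 0 := fun p => by simp [u]
  have hu1 : ∀ p, HasDerivAt (u p) 1 0 := fun p => by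
    refine ((hasDerivAt_id (0 : ℂ)).fun_div (((hasDerivAt_id (0 : ℂ)).const_mul p).const_sub 1)
      (by simp)).congr_deriv ?_
    simp
  have hφ : ∀ k, AnalyticAt ℂ (scaledSeries b⁻¹ (d k)) 0 := fun k =>
    (differentiableOn_scaledSeries (hd k) (inv_pos.2 hb)).analyticAt
      (ball_mem_nhds 0 (inv_pos.2 hb))
  have hφ0 : ∀ k, scaledSeries b⁻¹ (d k) 0 = d k 0 := fun k => by
    rw [scaledSeries, tsum_eq_single 0 fun m hm => by simp [hm]]
    simp
  let Ψ : ℂ → ℂ := fun w => ∑ k ∈ hfin.halfEdges v,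
    u (p₀ k) w * scaledSeries b⁻¹ (d k) (u (p₀ k) w)
  have hcomp : ∀ k, AnalyticAt ℂ (fun w => scaledSeries b⁻¹ (d k) (u (p₀ k) w)) 0 := fun k =>
    AnalyticAt.fun_comp (g := scaledSeries b⁻¹ (d k)) (by rw [hu0]; exact hφ k) (hu _)
  refine holomorphicAtInfty_of_double_zero (Ψ := Ψ) ?_ ?_ ?_ ?_
  · exact Finset.analyticAt_fun_sum _ fun k _ => (hu _).mul (hcomp k)
  · simp [Ψ, hu0]
  · have h1 : HasDerivAt Ψ (∑ k ∈ hfin.halfEdges v, d k 0) 0 := by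
      refine HasDerivAt.fun_sum fun k _ => ?_
      refine ((hu1 (p₀ k)).fun_mul (hcomp k).differentiableAt.hasDerivAt).congr_deriv ?_
      rw [hu0, hφ0]; ring
    rw [h1.deriv, hsum]
  · have h2 : ∀ k, ∀ᶠ w in 𝓝 (0 : ℂ), 1 - p₀ k * w ≠ 0 := fun k => by
      have : ContinuousAt (fun w : ℂ => 1 - p₀ k * w) 0 := by fun_prop
      exact this.eventually_ne (by simp)
    have h3 : ∀ᶠ w in 𝓝 (0 : ℂ), ∀ k ∈ hfin.halfEdges v, 1 - p₀ k * w ≠ 0 :=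
      (eventually_all_finset _).2 fun k _ => h2 k
    filter_upwards [nhdsWithin_le_nhds h3, self_mem_nhdsWithin] with w hw hw0
    have hw0' : w ≠ 0 := hw0
    refine Finset.sum_congr rfl fun k hk => ?_
    have h4 := hw k hk
    have h5 : (w⁻¹ - p₀ k)⁻¹ = u (p₀ k) w := by
      have h6 : w⁻¹ - p₀ k = (1 - p₀ k * w) / w := by field_simp
      rw [h6, inv_div]
    rw [principalPart_eq_scaledSeries, h5]

namespace NeckConfig

theorem eventually_outside (hfin : G.LocallyFinite) (p₀ : E × Bool → ℂ) (s : ℝ) (v : V) :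
    ∀ᶠ x in cobounded ℂ, ∀ k, G.base k = v → s < ‖x - p₀ k‖ := by
  have h1 : ∀ᶠ x in cobounded ℂ, ∀ k ∈ hfin.halfEdges v, s < ‖x - p₀ k‖ := by
    refine (eventually_all_finset _).2 fun k _ => ?_
    filter_upwards [tendsto_norm_cobounded_atTop.eventually_gt_atTop (s + ‖p₀ k‖)] with x hx
    have := norm_sub_norm_le x (p₀ k)
    linarith
  filter_upwards [h1] with x hx k hk using hx k (hfin.mem_halfEdges.2 hk)

theorem isOpen_outside (hfin : G.LocallyFinite) (p₀ : E × Bool → ℂ) (s : ℝ) (v : V) :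
    IsOpen {x : ℂ | ∀ k, G.base k = v → s < ‖x - p₀ k‖} := by
  have : {x : ℂ | ∀ k, G.base k = v → s < ‖x - p₀ k‖} =
      ⋂ k ∈ hfin.halfEdges v, {x : ℂ | s < ‖x - p₀ k‖} := by
    ext x; simp [hfin.mem_halfEdges]
  rw [this]
  exact isOpen_biInter_finset fun k _ => isOpen_lt continuous_const (by fun_prop)

/-! ### Regular differentials from their expressions in the necks -/

section Glued

variable {a : E × Bool → ℂ} {g : E × Bool → ℂ → ℂ} {A : V → ℂ → ℂ}

theorem glued_eq_neckForm (K : NeckConfig G S t p₀ ρ c₁ c₂ ε r)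
    (hA : ∀ h, ∀ x ∈ S.D h, ε / 4 < ‖x - p₀ h‖ → A (G.base h) x = neckForm S t a g h x)
    {h : E × Bool} {x : ℂ} (hx : x ∈ S.D h) :
    glued G p₀ (ε / 4) A (neckForm S t a g) (G.base h) x = neckForm S t a g h x := by
  have hε := K.ε_pos
  exact glued_of_mem (W := S.D h)
    (fun k hk hb x hx => by have := K.disjoint h k hk hb x hx; linarith) (hA h) hx

/-- The gluing condition is built into the shape of `neckForm`: under `z ↦ t / z` the regular and
the inverted terms of opposite half-edges are exchanged, and the polar terms match because the
residues are opposite. When `t = 0` the inverted term vanishes and the logarithmic derivative of the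
coordinate exhibits the simple pole. -/
theorem isRegular_glued (K : NeckConfig G S t p₀ ρ c₁ c₂ ε r) (hfin : G.LocallyFinite)
    (hg : ∀ h, DifferentiableOn ℂ (g h) (ball 0 ρ))
    (ha : ∀ e, a (e, false) = -a (e, true))
    (hA : ∀ h, ∀ x ∈ S.D h, ε / 4 < ‖x - p₀ h‖ → A (G.base h) x = neckForm S t a g h x)
    (hAd : ∀ v x, (∀ k, G.base k = v → ε / 4 < ‖x - p₀ k‖) → DifferentiableAt ℂ (A v) x)
    (hAi : ∀ v, HolomorphicAtInfty (A v)) :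
    IsRegular G ρ S t (glued G p₀ (ε / 4) A (neckForm S t a g)) := by
  have hε := K.ε_pos
  have hval : ∀ h, ∀ x ∈ S.D h, glued G p₀ (ε / 4) A (neckForm S t a g) (G.base h) x =
      neckForm S t a g h x := fun h x hx => K.glued_eq_neckForm hA hx
  have hnode : ∀ h : E × Bool, t h.1 = 0 → ∃ u : ℂ → ℂ, AnalyticAt ℂ u (S.p h) ∧
      u (S.p h) = a h ∧ ∀ᶠ x in 𝓝[≠] (S.p h),
        glued G p₀ (ε / 4) A (neckForm S t a g) (G.base h) x = u x / (x - S.p h) := by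
    intro h ht
    have C := K.chart h
    obtain ⟨L, hL, hL'⟩ := C.exists_logDeriv_sub
    have hD := C.isOpen.mem_nhds C.center_mem
    refine ⟨fun x => (x - S.p h) * (g h (S.z h x) * deriv (S.z h) x + a h * L x) + a h, ?_,
      by simp, ?_⟩
    · have h1 : AnalyticAt ℂ (fun x => g h (S.z h x)) (S.p h) :=
        AnalyticAt.fun_comp (g := g h) ((hg h).analyticAt (isOpen_ball.mem_nhds
          (C.bijOn.mapsTo C.center_mem))) (C.analyticAt C.center_mem)
      exact ((analyticAt_id.sub analyticAt_const).mul ((h1.mul (C.analyticAt C.center_mem).deriv).add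
        (analyticAt_const.mul (hL.analyticAt hD)))).add analyticAt_const
    · filter_upwards [self_mem_nhdsWithin, nhdsWithin_le_nhds hD] with x hx hxD
      have hne : x - S.p h ≠ 0 := sub_ne_zero.2 hx
      rw [hval h x hxD, neckForm, ht]
      have h2 := hL' x hxD hx
      have h3 : a h / S.z h x * deriv (S.z h) x = a h * (deriv (S.z h) x / S.z h x) := by ring
      have h4 : (g h (S.z h x) + a h / S.z h x - 0 / S.z h x ^ 2 * g (opp h) (0 / S.z h x)) *
          deriv (S.z h) x = g h (S.z h x) * deriv (S.z h) x +
            a h / S.z h x * deriv (S.z h) x := by ring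
      rw [h4, h3, h2]
      field_simp
      ring
  refine ⟨fun v x hx => ?_, fun v => ?_, fun e ht x hx y hy hxy => ?_, fun e ht => ?_⟩
  · refine DifferentiableAt.differentiableWithinAt ?_
    by_cases H : ∀ k, G.base k = v → ε / 4 < ‖x - p₀ k‖
    · refine (hAd v x H).congr_of_eventuallyEq ?_
      filter_upwards [(isOpen_outside hfin p₀ (ε / 4) v).mem_nhds H] with y hy
      exact glued_of_outside hy
    · push Not at H
      obtain ⟨k, rfl, hk⟩ := H
      have hxD : x ∈ S.D k := K.closedBall_subset k (by
        rw [mem_closedBall, dist_eq_norm]; linarith)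
      have hxA := mem_annulus_of_mem_piece hx hxD
      refine (K.differentiableAt_neckForm a hg hxA).congr_of_eventuallyEq ?_
      filter_upwards [(K.chart k).isOpen.mem_nhds hxD] with y hy using hval k y hy
  · refine (hAi v).congr ?_
    filter_upwards [eventually_outside hfin p₀ (ε / 4) v] with x hx using glued_of_outside hx
  · have h1 := hval (e, false) x hx.1
    have h2 := hval (e, true) y hy.1
    have hb1 : G.base (e, false) = G.src e := rfl
    have hb2 : G.base (e, true) = G.tgt e := rfl
    rw [hb1] at h1
    rw [hb2] at h2
    rw [h1, h2, neckForm, neckForm]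
    have hz1 := K.z_ne_zero_of_mem_annulus hx
    have hz2 := K.z_ne_zero_of_mem_annulus hy
    have ho1 : opp (e, false) = (e, true) := rfl
    have ho2 : opp (e, true) = (e, false) := rfl
    rw [ho1, ho2, ha e]
    simp only [← hxy]
    rw [mul_div_cancel_left₀ _ hz1, mul_div_cancel_right₀ _ hz2]
    field_simp
    ring
  · obtain ⟨u, hu1, hu2, hu3⟩ := hnode (e, false) ht
    obtain ⟨w, hw1, hw2, hw3⟩ := hnode (e, true) ht
    exact ⟨u, w, hu1, hw1, hu3, hw3, by rw [hu2, hw2, ha e]⟩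

/-- Only the polar term contributes: the regular term is holomorphic on the disk and the inverted
term is exact. -/
theorem hasPeriods_glued (K : NeckConfig G S t p₀ ρ c₁ c₂ ε r)
    (hg : ∀ h, DifferentiableOn ℂ (g h) (ball 0 ρ))
    (hA : ∀ h, ∀ x ∈ S.D h, ε / 4 < ‖x - p₀ h‖ → A (G.base h) x = neckForm S t a g h x) :
    HasPeriods G ρ S t (glued G p₀ (ε / 4) A (neckForm S t a g))
      fun e => 2 * Real.pi * Complex.I * a (e, true) := by
  intro e s hs hsub
  set h : E × Bool := (e, true)
  have C := K.chart h
  have hD : sphere (S.p h) s ⊆ S.D h := fun x hx => (hsub hx).1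
  have hz0 : ∀ x ∈ sphere (S.p h) s, S.z h x ≠ 0 := fun x hx =>
    K.z_ne_zero_of_mem_annulus (hsub hx)
  have hzc := C.differentiableOn.continuousOn.mono hD
  have hzd := C.continuousOn_deriv.mono hD
  have hgz : DifferentiableOn ℂ (fun x => g h (S.z h x) * deriv (S.z h) x) (S.D h) :=
    ((hg h).comp C.differentiableOn C.bijOn.mapsTo).mul (C.differentiableOn.deriv C.isOpen)
  have h1 := C.circleIntegral_eq_zero hgz hs.le hD
  have h2 := C.circleIntegral_zpow_mul_deriv hs hD (mem_ball_self hs) (-1)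
  have h3 := C.circleIntegral_inversion_eq_zero (hg (opp h)) hs hD (mem_ball_self hs) (t h.1)
    (fun x hx => K.t_div_mem_ball (hsub hx)) 0
  rw [if_pos rfl] at h2
  have hinv : ContinuousOn (fun x => (S.z h x ^ 0)⁻¹ *
      (t h.1 / S.z h x ^ 2 * g (opp h) (t h.1 / S.z h x) * deriv (S.z h) x)) (sphere (S.p h) s) := by
    refine ContinuousOn.mul (((hzc.pow 0).inv₀ fun x hx => pow_ne_zero _ (hz0 x hx)))
      (((continuousOn_const.div (hzc.pow 2) fun x hx => pow_ne_zero _ (hz0 x hx)).mul ?_).mul hzd)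
    exact (hg (opp h)).continuousOn.comp (continuousOn_const.div hzc hz0)
      fun x hx => K.t_div_mem_ball (hsub hx)
  have h4 : (∮ x in C(S.p h, s), glued G p₀ (ε / 4) A (neckForm S t a g) (G.tgt e) x) =
      ∮ x in C(S.p h, s), ((g h (S.z h x) * deriv (S.z h) x +
        a h * (S.z h x ^ (-1 : ℤ) * deriv (S.z h) x)) - (S.z h x ^ 0)⁻¹ *
      (t h.1 / S.z h x ^ 2 * g (opp h) (t h.1 / S.z h x) * deriv (S.z h) x)) := by
    refine circleIntegral.integral_congr hs.le fun x hx => ?_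
    have h5 : glued G p₀ (ε / 4) A (neckForm S t a g) (G.tgt e) x = neckForm S t a g h x :=
      K.glued_eq_neckForm hA (hD hx)
    rw [h5, neckForm, zpow_neg_one]
    ring
  have hi1 := (hgz.continuousOn.mono hD).circleIntegrable hs.le
  have hi2 : CircleIntegrable (fun x => a h * (S.z h x ^ (-1 : ℤ) * deriv (S.z h) x)) (S.p h) s :=
    (continuousOn_const.mul ((hzc.zpow₀ _ fun x hx =>
      Or.inl (hz0 x hx)).mul hzd)).circleIntegrable hs.le
  rw [h4, circleIntegral.integral_sub (hi1.fun_add hi2) (hinv.circleIntegrable hs.le), h3,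
    circleIntegral.integral_add hi1 hi2, h1, circleIntegral.integral_const_mul, h2]
  ring

end Glued

/-! ### Existence from solutions of the coefficient equations -/

section Existence

variable {a : E × Bool → ℂ} {c d : E × Bool → ℕ → ℂ} {Bc Bd : E × Bool → ℝ}

/-- The singular part contains only negative powers of `z`, so it does not contribute to the Taylor
coefficients. -/
theorem circleIntegral_inv_pow_mul_neckSingular (K : NeckConfig G S t p₀ ρ c₁ c₂ ε r)
    {g : E × Bool → ℂ → ℂ} (h : E × Bool) {R : ℝ} (hR : r ≤ R)
    (hg : DifferentiableOn ℂ (g (opp h)) (ball 0 R)) (m : ℕ) :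
    (∮ x in C(p₀ h, ε / 2), (S.z h x ^ (m + 1))⁻¹ * neckSingular S t a g h x) = 0 := by
  have hε := K.ε_pos
  have C := K.chart h
  have hs : 0 < ε / 2 := by positivity
  have hD := K.sphere_subset h (s := ε / 2) le_rfl
  have hz0 := fun x hx => K.z_ne_zero_of_mem_sphere h (s := ε / 2) (x := x) (by linarith) le_rfl hx
  have hzc := K.continuousOn_z h (s := ε / 2) le_rfl
  have hzd := C.continuousOn_deriv.mono hD
  have hball : ∀ x ∈ sphere (p₀ h) (ε / 2), t h.1 / S.z h x ∈ ball (0 : ℂ) R := fun x hx => by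
    rw [mem_ball_zero_iff]
    exact (K.norm_t_div_lt h.1 (K.le_norm_z_of_mem_sphere h (by linarith) le_rfl hx)).trans_le hR
  have hm := K.mem_ball h (s := ε / 2) (by linarith)
  have h2 := C.circleIntegral_zpow_mul_deriv hs hD hm (-(m + 2 : ℕ))
  have h3 := C.circleIntegral_inversion_eq_zero hg hs hD hm (t h.1) hball (m + 1)
  rw [if_neg (by omega)] at h2
  have h4 : (∮ x in C(p₀ h, ε / 2), (S.z h x ^ (m + 1))⁻¹ * neckSingular S t a g h x) =
      ∮ x in C(p₀ h, ε / 2), (a h * (S.z h x ^ (-(m + 2 : ℕ) : ℤ) * deriv (S.z h) x) -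
      (S.z h x ^ (m + 1))⁻¹ *
      (t h.1 / S.z h x ^ 2 * g (opp h) (t h.1 / S.z h x) * deriv (S.z h) x)) := by
    refine circleIntegral.integral_congr hs.le fun x hx => ?_
    have h0 := hz0 x hx
    simp only [neckSingular]
    rw [zpow_neg, zpow_natCast, pow_succ _ (m + 1), mul_inv]
    ring
  rw [h4, circleIntegral.integral_sub, h3, circleIntegral.integral_const_mul, h2, mul_zero, sub_zero]
  · exact (continuousOn_const.mul ((hzc.zpow₀ _ fun x hx =>
      Or.inl (hz0 x hx)).mul hzd)).circleIntegrable hs.le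
  · refine ContinuousOn.circleIntegrable hs.le ?_
    refine ContinuousOn.mul (((hzc.pow _).inv₀ fun x hx => pow_ne_zero _ (hz0 x hx)))
      (((continuousOn_const.div (hzc.pow 2) fun x hx => pow_ne_zero _ (hz0 x hx)).mul ?_).mul hzd)
    exact hg.continuousOn.comp (continuousOn_const.div hzc hz0) hball

theorem vertexForm_eq_erase_add (hfin : G.LocallyFinite) [DecidableEq (E × Bool)] (b : ℝ)
    (d : E × Bool → ℕ → ℂ) (h : E × Bool) (x : ℂ) :
    vertexForm hfin p₀ b d (G.base h) x =
      ∑ k ∈ (hfin.halfEdges (G.base h)).erase h, principalPart (p₀ k) b (d k) x +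
        principalPart (p₀ h) b (d h) x := by
  rw [vertexForm, Finset.sum_erase_add _ _ (hfin.mem_halfEdges.2 rfl)]

/-- By `hD`, the principal part at `p₀ h` is that of the singular part `q`, so `vertexForm - q`
extends holomorphically over the disk `S.D h`. By `hC`, and because `q` has no Taylor coefficients,
the pullback of this extension to `|z| < ρ` has the Taylor coefficients `c h`. Hence the series, a
priori convergent only for `|z| < r`, is holomorphic up to radius `ρ`. -/
theorem vertexForm_eq_neckForm (K : NeckConfig G S t p₀ ρ c₁ c₂ ε r) (hfin : G.LocallyFinite)
    (hc : ∀ k n, ‖c k n‖ ≤ Bc k) (hd : ∀ k n, ‖d k n‖ ≤ Bd k)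
    (hC : ∀ h m, c h m = (2 * Real.pi * Complex.I : ℂ)⁻¹ * (r ^ m * ∮ w in C(p₀ h, ε / 2),
      (S.z h w ^ (m + 1))⁻¹ * vertexForm hfin p₀ (ε / 4) d (G.base h) w))
    (hD : ∀ h j, d h j = (2 * Real.pi * Complex.I : ℂ)⁻¹ * ((((ε / 4 : ℝ) : ℂ) ^ j)⁻¹ *
      ∮ y in C(p₀ h, ε / 8),
        neckSingular S t a (fun k => scaledSeries r (c k)) h y * (y - p₀ h) ^ j)) (h : E × Bool) :
    DifferentiableOn ℂ (scaledSeries r (c h)) (ball 0 ρ) ∧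
      ∀ x ∈ S.D h, ε / 4 < ‖x - p₀ h‖ → vertexForm hfin p₀ (ε / 4) d (G.base h) x =
        neckForm S t a (fun k => scaledSeries r (c k)) h x := by
  classical
  have hε := K.ε_pos
  have hr := K.r_pos
  have C := K.chart h
  set q := neckSingular S t a (fun k => scaledSeries r (c k)) h with hq
  have hg : ∀ k, DifferentiableOn ℂ (scaledSeries r (c k)) (ball 0 r) := fun k =>
    differentiableOn_scaledSeries (hc k) hr
  have hqd : ∀ x ∈ S.D h, ε / 8 ≤ ‖x - p₀ h‖ → DifferentiableAt ℂ q x := fun x hx hx' => by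
    have h1 := K.le_norm_z h hx hx'
    refine K.differentiableAt_neckSingular a (hg (opp h)) hx (norm_pos_iff.1 (hr.trans_le h1)) ?_
    rw [mem_ball_zero_iff]; exact K.norm_t_div_lt h.1 h1
  obtain ⟨F, hF, hFq⟩ := exists_laurent_decomposition (q := q) (c := p₀ h) (s₁ := ε / 8)
    (s₂ := ε / 2) (by positivity) (by linarith)
    (fun x hx => (hqd x (K.closedBall_subset h hx.1)
      (by simpa [dist_eq_norm] using hx.2)).continuousAt.continuousWithinAt)
    (fun x hx => hqd x (K.closedBall_subset h (ball_subset_closedBall hx.1))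
      (by have := hx.2; rw [mem_closedBall, dist_eq_norm] at this; linarith))
  have hb0 : (((ε / 4 : ℝ) : ℂ)) ≠ 0 := Complex.ofReal_ne_zero.2 (by positivity)
  have hPq : ∀ x, ε / 4 < ‖x - p₀ h‖ → ‖x - p₀ h‖ < ε / 2 →
      principalPart (p₀ h) (ε / 4) (d h) x = q x - F x := fun x hx1 hx2 => by
    have h1 := hFq x ⟨by rw [Metric.mem_ball, dist_eq_norm]; exact hx2, by
      rw [mem_closedBall, dist_eq_norm]; linarith⟩
    rw [← h1.tsum_eq, principalPart]
    refine tsum_congr fun j => ?_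
    rw [hD h j, ← hq]
    field_simp
  let Hs : ℂ → ℂ := fun x =>
    ∑ k ∈ (hfin.halfEdges (G.base h)).erase h, principalPart (p₀ k) (ε / 4) (d k) x
  have hHs : DifferentiableOn ℂ Hs (S.D h) := by
    intro x hx
    refine DifferentiableAt.differentiableWithinAt (DifferentiableAt.fun_sum fun k hk => ?_)
    rw [Finset.mem_erase, hfin.mem_halfEdges] at hk
    refine differentiableAt_principalPart (by positivity) (hd k) ?_
    have := K.disjoint h k (Ne.symm hk.1) hk.2.symm x hx
    linarith
  -- The extension of `vertexForm - q` has one formula inside radius `ε / 2` and another outside;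
  -- they agree between `ε / 4` and `ε / 2` by `hPq`.
  let Bh : ℂ → ℂ := fun x => Hs x + if ‖x - p₀ h‖ < ε / 2 then -F x else
    principalPart (p₀ h) (ε / 4) (d h) x - q x
  have hBeq : ∀ x, ε / 4 < ‖x - p₀ h‖ →
      Bh x = vertexForm hfin p₀ (ε / 4) d (G.base h) x - q x := fun x hx => by
    simp only [Bh, Hs, vertexForm_eq_erase_add]
    split_ifs with h1
    · rw [hPq x hx h1]; ring
    · ring
  have hBd : DifferentiableOn ℂ Bh (S.D h) := by
    refine hHs.add fun x hx => DifferentiableAt.differentiableWithinAt ?_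
    by_cases hx' : ‖x - p₀ h‖ < ε / 2
    · refine DifferentiableAt.congr_of_eventuallyEq (f := fun x => -F x)
        (hF.differentiableAt (isOpen_ball.mem_nhds (by
          rw [Metric.mem_ball, dist_eq_norm]; exact hx'))).fun_neg ?_
      have : {y : ℂ | ‖y - p₀ h‖ < ε / 2} ∈ 𝓝 x :=
        (isOpen_lt (by fun_prop) continuous_const).mem_nhds hx'
      filter_upwards [this] with y hy
      rw [if_pos hy]
    · rw [not_lt] at hx'
      refine DifferentiableAt.congr_of_eventuallyEq
        (f := fun x => principalPart (p₀ h) (ε / 4) (d h) x - q x)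
        ((differentiableAt_principalPart (by positivity) (hd h) (by linarith)).fun_sub
          (hqd x hx (by linarith))) ?_
      have : {y : ℂ | ε / 4 < ‖y - p₀ h‖} ∈ 𝓝 x :=
        (isOpen_lt continuous_const (by fun_prop)).mem_nhds
          (show ε / 4 < ‖x - p₀ h‖ by linarith)
      filter_upwards [this] with y hy
      split_ifs with h1
      · rw [hPq y hy h1]; ring
      · rfl
  obtain ⟨γ, hγ, hBγ⟩ := C.exists_pullback_disk hBd
  have hsub := K.sphere_subset h (s := ε / 2) le_rfl
  have hcoef : ∀ m, (∮ x in C(p₀ h, ε / 2), (S.z h x ^ (m + 1))⁻¹ *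
      (γ (S.z h x) * deriv (S.z h) x)) = ∮ w in C(p₀ h, ε / 2),
      (S.z h w ^ (m + 1))⁻¹ * vertexForm hfin p₀ (ε / 4) d (G.base h) w := by
    intro m
    have hz := K.continuousOn_inv_z_pow h (s := ε / 2) (by linarith) le_rfl (m + 1)
    have h1 : (∮ x in C(p₀ h, ε / 2), (S.z h x ^ (m + 1))⁻¹ *
      (γ (S.z h x) * deriv (S.z h) x)) = ∮ x in C(p₀ h, ε / 2), ((S.z h x ^ (m + 1))⁻¹ *
        vertexForm hfin p₀ (ε / 4) d (G.base h) x - (S.z h x ^ (m + 1))⁻¹ * q x) := by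
      refine circleIntegral.integral_congr (by positivity) fun x hx => ?_
      rw [← hBγ x (hsub hx), hBeq x (by rw [mem_sphere_iff_norm.1 hx]; linarith)]
      ring
    rw [h1, circleIntegral.integral_sub,
      K.circleIntegral_inv_pow_mul_neckSingular h le_rfl (hg (opp h)), sub_zero]
    · refine ContinuousOn.circleIntegrable (by positivity) (hz.mul fun x hx => ?_)
      refine (differentiableAt_vertexForm hfin (by positivity) hd fun k hk =>
        ?_).continuousAt.continuousWithinAt
      have := K.half_le_norm_sub hk hx
      linarith
    · refine ContinuousOn.circleIntegrable (by positivity) (hz.mul fun x hx => ?_)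
      exact (hqd x (hsub hx) (by rw [mem_sphere_iff_norm.1 hx]; linarith)).continuousAt.continuousWithinAt
  have hγeq : ∀ ζ ∈ ball (0 : ℂ) ρ, scaledSeries r (c h) ζ = γ ζ := by
    intro ζ hζ
    have h1 := C.hasSum_circleIntegral_coeff hγ (half_pos hε) hsub
      (K.mem_ball h (by linarith)) hζ
    rw [← h1.tsum_eq, scaledSeries]
    refine tsum_congr fun m => ?_
    rw [hcoef, hC h m, div_pow]
    have h2 : (r : ℂ) ≠ 0 := Complex.ofReal_ne_zero.2 hr.ne'
    field_simp
  refine ⟨hγ.congr hγeq, fun x hx hx' => ?_⟩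
  rw [neckForm_eq, hγeq _ (C.bijOn.mapsTo hx), ← hBγ x hx, hBeq x hx']
  ring

/-- The inverted term is exact, so it has no residue: its kernel vanishes for `j = 0`. -/
theorem head_coefficient_eq (K : NeckConfig G S t p₀ ρ c₁ c₂ ε r)
    (hc : ∀ k n, ‖c k n‖ ≤ Bc k)
    (hD : ∀ h j, d h j = (2 * Real.pi * Complex.I : ℂ)⁻¹ * ((((ε / 4 : ℝ) : ℂ) ^ j)⁻¹ *
      ∮ y in C(p₀ h, ε / 8),
        neckSingular S t a (fun k => scaledSeries r (c k)) h y * (y - p₀ h) ^ j)) (h : E × Bool) :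
    d h 0 = a h := by
  have h1 := K.principal_coefficient_eq a hc h 0
  rw [← hD h 0] at h1
  simp only [inversionKernel, Nat.cast_zero, zero_div, mul_zero, neg_zero, zero_mul, pow_zero,
    one_mul] at h1
  have h2 := h1.unique hasSum_zero
  exact sub_eq_zero.1 h2

/-- The regular differential given by a solution of the coefficient equations. -/
def solution (hfin : G.LocallyFinite) (S : NodeData E) (t : E → ℂ) (p₀ : E × Bool → ℂ) (ε r : ℝ)
    (a : E × Bool → ℂ) (c d : E × Bool → ℕ → ℂ) : V → ℂ → ℂ :=
  glued G p₀ (ε / 4) (vertexForm hfin p₀ (ε / 4) d)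
    (neckForm S t a fun k => scaledSeries r (c k))

theorem solution_spec (K : NeckConfig G S t p₀ ρ c₁ c₂ ε r) (hfin : G.LocallyFinite)
    (ha : ∀ e, a (e, false) = -a (e, true)) (hsum : ∀ v, ∑ k ∈ hfin.halfEdges v, a k = 0)
    (hc : ∀ k n, ‖c k n‖ ≤ Bc k) (hd : ∀ k n, ‖d k n‖ ≤ Bd k)
    (hC : ∀ h m, c h m = (2 * Real.pi * Complex.I : ℂ)⁻¹ * (r ^ m * ∮ w in C(p₀ h, ε / 2),
      (S.z h w ^ (m + 1))⁻¹ * vertexForm hfin p₀ (ε / 4) d (G.base h) w))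
    (hD : ∀ h j, d h j = (2 * Real.pi * Complex.I : ℂ)⁻¹ * ((((ε / 4 : ℝ) : ℂ) ^ j)⁻¹ *
      ∮ y in C(p₀ h, ε / 8),
        neckSingular S t a (fun k => scaledSeries r (c k)) h y * (y - p₀ h) ^ j)) :
    IsRegular G ρ S t (solution hfin S t p₀ ε r a c d) ∧
      HasPeriods G ρ S t (solution hfin S t p₀ ε r a c d)
        (fun e => 2 * Real.pi * Complex.I * a (e, true)) := by
  have hε := K.ε_pos
  have hmain := K.vertexForm_eq_neckForm hfin hc hd hC hD
  refine ⟨K.isRegular_glued hfin (fun h => (hmain h).1) ha (fun h => (hmain h).2)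
    (fun v x hx => differentiableAt_vertexForm hfin (by positivity) hd hx) fun v => ?_,
    K.hasPeriods_glued (fun h => (hmain h).1) fun h => (hmain h).2⟩
  refine holomorphicAtInfty_vertexForm hfin (by positivity) hd ?_
  rw [← hsum v]
  exact Finset.sum_congr rfl fun k _ => K.head_coefficient_eq hc hD k

end Existence

end NeckConfig

end OpenNodes

end

noncomputable section

namespace OpenNodes

open Metric Filter Bornology

/-! ### Laurent expansions in the necks -/

/-- The decomposition is made between intermediate radii `s₁ < s₂`; each of the two parts then
extends to its full disk as `U` minus the other part. -/
theorem exists_laurent_annulus {U : ℂ → ℂ} {R₁ R₂ : ℝ} (hR₁ : 0 < R₁) (hR : R₁ < R₂)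
    (hU : ∀ ζ, R₁ < ‖ζ‖ → ‖ζ‖ < R₂ → DifferentiableAt ℂ U ζ) :
    ∃ F Q : ℂ → ℂ, DifferentiableOn ℂ F (ball 0 R₂) ∧ DifferentiableOn ℂ Q (ball 0 R₁⁻¹) ∧
      ∀ ζ, R₁ < ‖ζ‖ → ‖ζ‖ < R₂ → U ζ = F ζ + ζ⁻¹ * Q ζ⁻¹ := by
  obtain ⟨s₁, h1, h1'⟩ := exists_between hR
  obtain ⟨s₂, h2, h2'⟩ := exists_between h1'
  have hs₁ : 0 < s₁ := hR₁.trans h1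
  have hs₂ : 0 < s₂ := hs₁.trans h2
  have hUat : ∀ ζ, s₁ ≤ ‖ζ‖ → ‖ζ‖ ≤ s₂ → DifferentiableAt ℂ U ζ := fun ζ h3 h4 =>
    hU ζ (h1.trans_le h3) (h4.trans_lt h2')
  obtain ⟨F₀, hF₀, hsum⟩ := exists_laurent_decomposition (q := U) (c := 0) hs₁ h2
    (fun ζ hζ => (hUat ζ (by simpa using hζ.2) (by simpa using hζ.1)).continuousAt.continuousWithinAt)
    (fun ζ hζ => hUat ζ (by have := hζ.2; rw [mem_closedBall_zero_iff] at this; linarith)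
      (by simpa using (mem_ball_zero_iff.1 hζ.1).le))
  have hUc : ContinuousOn U (sphere 0 s₁) := fun ζ hζ => by
    rw [mem_sphere_zero_iff_norm] at hζ
    exact (hUat ζ hζ.ge (hζ.trans_le h2.le)).continuousAt.continuousWithinAt
  obtain ⟨M, hM⟩ := (isCompact_sphere (0 : ℂ) s₁).exists_bound_of_continuousOn hUc
  let d : ℕ → ℂ := fun j => (2 * Real.pi * Complex.I : ℂ)⁻¹ *
    (∮ y in C(0, s₁), U y * (y - 0) ^ j) / (s₁ : ℂ) ^ j
  have hs₁c : (s₁ : ℂ) ≠ 0 := Complex.ofReal_ne_zero.2 hs₁.ne'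
  have hd : ∀ j, ‖d j‖ ≤ s₁ * M := fun j => by
    have h3 := norm_two_pi_I_inv_mul_circleIntegral_le (c := 0) hs₁.le
      (f := fun y => U y * (y - 0) ^ j) (C := M * s₁ ^ j) fun y hy => by
        rw [norm_mul, norm_pow, mem_sphere_iff_norm.1 hy]
        gcongr
        exact hM y hy
    rw [norm_div, norm_pow, Complex.norm_real, Real.norm_eq_abs, abs_of_pos hs₁,
      div_le_iff₀ (by positivity)]
    linarith
  let Q₀ : ℂ → ℂ := scaledSeries s₁⁻¹ d
  have hQ₀ : DifferentiableOn ℂ Q₀ (ball 0 s₁⁻¹) := differentiableOn_scaledSeries hd (inv_pos.2 hs₁)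
  have hmid : ∀ ζ, s₁ < ‖ζ‖ → ‖ζ‖ < s₂ → U ζ = F₀ ζ + ζ⁻¹ * Q₀ ζ⁻¹ := fun ζ h3 h4 => by
    have h5 := hsum ζ ⟨by simpa using h4, by simpa using h3⟩
    have h6 := principalPart_eq_scaledSeries 0 s₁ d ζ
    rw [sub_zero] at h6
    rw [← h6, principalPart, ← sub_eq_iff_eq_add', ← h5.tsum_eq]
    refine tsum_congr fun j => ?_
    simp only [d, sub_zero]
    field_simp
  have hopen_lt : ∀ s : ℝ, IsOpen {ζ : ℂ | ‖ζ‖ < s} := fun s =>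
    isOpen_lt continuous_norm continuous_const
  have hopen_gt : ∀ s : ℝ, IsOpen {ζ : ℂ | s < ‖ζ‖} := fun s =>
    isOpen_lt continuous_const continuous_norm
  have hnz : ∀ {s : ℝ} {ζ : ℂ}, 0 < s → s ≤ ‖ζ‖ → ζ ≠ 0 := fun hs hζ =>
    norm_pos_iff.1 (hs.trans_le hζ)
  refine ⟨fun ζ => if ‖ζ‖ < s₂ then F₀ ζ else U ζ - ζ⁻¹ * Q₀ ζ⁻¹,
    fun w => if ‖w‖ < s₁⁻¹ then Q₀ w else w⁻¹ * (U w⁻¹ - F₀ w⁻¹), ?_, ?_, ?_⟩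
  · intro ζ hζ
    rw [mem_ball_zero_iff] at hζ
    refine DifferentiableAt.differentiableWithinAt ?_
    by_cases h3 : ‖ζ‖ < s₂
    · refine (hF₀.differentiableAt (isOpen_ball.mem_nhds (by simpa using h3))).congr_of_eventuallyEq ?_
      filter_upwards [(hopen_lt s₂).mem_nhds h3] with y hy
      rw [if_pos hy]
    · rw [not_lt] at h3
      have h0 := hnz hs₂ h3
      have h4 : ζ⁻¹ ∈ ball (0 : ℂ) s₁⁻¹ := by
        rw [mem_ball_zero_iff, norm_inv]
        exact inv_strictAnti₀ hs₁ (h2.trans_le h3)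
      have h5 : DifferentiableAt ℂ (fun ζ : ℂ => Q₀ ζ⁻¹) ζ :=
        DifferentiableAt.comp (g := Q₀) ζ (hQ₀.differentiableAt (isOpen_ball.mem_nhds h4))
          (differentiableAt_inv h0)
      refine DifferentiableAt.congr_of_eventuallyEq (f := fun ζ => U ζ - ζ⁻¹ * Q₀ ζ⁻¹)
        ((hU ζ ((h1.trans h2).trans_le h3) hζ).fun_sub ((differentiableAt_inv h0).fun_mul h5)) ?_
      filter_upwards [(hopen_gt s₁).mem_nhds (h2.trans_le h3)] with y hy
      split_ifs with h6
      · rw [hmid y hy h6]; ring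
      · rfl
  · intro w hw
    rw [mem_ball_zero_iff] at hw
    refine DifferentiableAt.differentiableWithinAt ?_
    by_cases h3 : ‖w‖ < s₁⁻¹
    · refine (hQ₀.differentiableAt (isOpen_ball.mem_nhds (by simpa using h3))).congr_of_eventuallyEq ?_
      filter_upwards [(hopen_lt s₁⁻¹).mem_nhds h3] with y hy
      rw [if_pos hy]
    · rw [not_lt] at h3
      have h0 := hnz (inv_pos.2 hs₁) h3
      have h4 : ‖w⁻¹‖ ≤ s₁ := by rw [norm_inv]; exact inv_le_of_inv_le₀ hs₁ h3
      have h5 : R₁ < ‖w⁻¹‖ := by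
        rw [norm_inv]; exact (lt_inv_comm₀ (norm_pos_iff.2 h0) hR₁).1 hw
      have h6 : DifferentiableAt ℂ (fun w : ℂ => U w⁻¹) w :=
        DifferentiableAt.comp (g := U) w (hU _ h5 (h4.trans_lt h1')) (differentiableAt_inv h0)
      have h7 : DifferentiableAt ℂ (fun w : ℂ => F₀ w⁻¹) w :=
        DifferentiableAt.comp (g := F₀) w (hF₀.differentiableAt (isOpen_ball.mem_nhds (by
          rw [mem_ball_zero_iff]; linarith))) (differentiableAt_inv h0)
      refine DifferentiableAt.congr_of_eventuallyEq (f := fun w => w⁻¹ * (U w⁻¹ - F₀ w⁻¹))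
        ((differentiableAt_inv h0).fun_mul (h6.fun_sub h7)) ?_
      have h8 : s₂⁻¹ < ‖w‖ := (inv_strictAnti₀ hs₁ h2).trans_le h3
      filter_upwards [(hopen_gt s₂⁻¹).mem_nhds h8] with y hy
      have hy' : s₂⁻¹ < ‖y‖ := hy
      have hy0 := hnz (inv_pos.2 hs₂) hy'.le
      split_ifs with h9
      · rw [hmid y⁻¹ (by rw [norm_inv]; exact (lt_inv_comm₀ (norm_pos_iff.2 hy0) hs₁).1 h9)
          (by rw [norm_inv]; exact (inv_lt_comm₀ hs₂ (norm_pos_iff.2 hy0)).1 hy'), inv_inv]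
        field_simp
        ring
      · rfl
  · intro ζ h3 h4
    have h0 := hnz hR₁ h3.le
    have h5 : ‖ζ⁻¹‖ < s₁⁻¹ ↔ s₁ < ‖ζ‖ := by
      rw [norm_inv]; exact inv_lt_inv₀ (norm_pos_iff.2 h0) hs₁
    beta_reduce
    by_cases h6 : s₁ < ‖ζ‖
    · rw [if_pos (h5.2 h6)]
      split_ifs with h7
      · exact hmid ζ h6 h7
      · ring
    · rw [if_neg (mt h5.1 h6), if_pos (by linarith), inv_inv]
      field_simp
      ring

variable {V E : Type*} {G : OrientedMultigraph V E} {S : NodeData E} {t : E → ℂ}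
  {p₀ : E × Bool → ℂ} {ρ c₁ c₂ ε r : ℝ}

namespace NeckConfig

theorem sphere_center_subset (K : NeckConfig G S t p₀ ρ c₁ c₂ ε r) (h : E × Bool) :
    sphere (S.p h) (ε / 2) ⊆ annulus ρ S t h := by
  intro x hx
  have h1 := K.close h
  have hε := K.ε_pos
  rw [mem_sphere_iff_norm] at hx
  have h2 : ‖x - S.p h‖ ≤ ‖x - p₀ h‖ + ‖S.p h - p₀ h‖ := by
    have := norm_sub_le (x - p₀ h) (S.p h - p₀ h)
    rwa [sub_sub_sub_cancel_right] at this
  refine K.mem_annulus h ((K.chart h).ball_subset K.c₁_pos ?_) (by linarith)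
  have := K.ε_le
  rw [Metric.mem_ball, dist_eq_norm]; linarith

theorem exists_mem_annulus (K : NeckConfig G S t p₀ ρ c₁ c₂ ε r) {h : E × Bool} {ζ : ℂ}
    (h1 : ‖t h.1‖ / ρ < ‖ζ‖) (h2 : ‖ζ‖ < ρ) : ∃ x ∈ annulus ρ S t h, S.z h x = ζ := by
  obtain ⟨x, hx, rfl⟩ := (K.chart h).bijOn.surjOn (mem_ball_zero_iff.2 h2)
  exact ⟨x, ⟨hx, h1⟩, rfl⟩

variable {a : E × Bool → ℂ} {f : V → ℂ → ℂ}

/-- The differential is expanded on the `+` side as `F(z) + z⁻¹ Q(z⁻¹)`. The function `F` serves for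
the `+` side, `Q(0)` is the residue read from the period, and the rest of `Q`, rescaled by `t`,
serves for the `-` side. The formula on the `-` side then follows from the gluing condition. -/
theorem exists_neckForm_of_ne_zero (K : NeckConfig G S t p₀ ρ c₁ c₂ ε r)
    (hreg : IsRegular G ρ S t f)
    (hper : HasPeriods G ρ S t f fun e => 2 * Real.pi * Complex.I * a (e, true))
    (ha : ∀ e, a (e, false) = -a (e, true)) {e : E} (ht : t e ≠ 0) :
    ∃ g : Bool → ℂ → ℂ, (∀ σ, DifferentiableOn ℂ (g σ) (ball 0 ρ)) ∧
      ∀ σ, ∀ x ∈ annulus ρ S t (e, σ), f (G.base (e, σ)) x =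
        (g σ (S.z (e, σ) x) + a (e, σ) / S.z (e, σ) x -
          t e / S.z (e, σ) x ^ 2 * g (!σ) (t e / S.z (e, σ) x)) * deriv (S.z (e, σ)) x := by
  have hε := K.ε_pos
  set h : E × Bool := (e, true) with hh
  have C := K.chart h
  have hρ := C.radius_pos
  have htn : 0 < ‖t e‖ := norm_pos_iff.2 ht
  have hsub : annulus ρ S t h ⊆ S.D h := fun x hx => hx.1
  obtain ⟨U, hUd, hU⟩ := C.exists_pullback (K.isOpen_annulus h) hsub
    ((hreg.holomorphic (G.base h)).mono (K.annulus_subset_piece h))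
  obtain ⟨F, Q, hF, hQ, hFQ⟩ := exists_laurent_annulus (U := U) (R₁ := ‖t e‖ / ρ) (R₂ := ρ)
    (by positivity) ((K.norm_div_lt h e).trans (K.r_lt h)) fun ζ h1 h2 => by
      obtain ⟨x, hx, rfl⟩ := K.exists_mem_annulus (h := h) h1 h2
      exact hUd _ x hx rfl
  have hQ₁ : DifferentiableOn ℂ (dslope Q 0) (ball 0 (‖t e‖ / ρ)⁻¹) :=
    (Complex.differentiableOn_dslope (ball_mem_nhds 0 (by positivity))).2 hQ
  have hform : ∀ x ∈ annulus ρ S t h, f (G.base h) x = F (S.z h x) * deriv (S.z h) x +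
      (Q 0 * (S.z h x ^ (-1 : ℤ) * deriv (S.z h) x) + (S.z h x ^ 0)⁻¹ *
        (1 / S.z h x ^ 2 * dslope Q 0 (1 / S.z h x) * deriv (S.z h) x)) := fun x hx => by
    have h0 := K.z_ne_zero_of_mem_annulus hx
    rw [hU x hx, hFQ _ hx.2 (C.norm_lt hx.1)]
    have h1 := sub_smul_dslope Q 0 (S.z h x)⁻¹
    rw [sub_zero, smul_eq_mul] at h1
    rw [eq_add_of_sub_eq h1.symm, zpow_neg_one, one_div, one_div]
    field_simp
    ring
  have hQ0 : Q 0 = a h := by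
    have hs : 0 < ε / 2 := by positivity
    have hsph := K.sphere_center_subset h
    have hD := hsph.trans hsub
    have hmem : S.p h ∈ ball (S.p h) (ε / 2) := mem_ball_self hs
    have hz0 : ∀ x ∈ sphere (S.p h) (ε / 2), S.z h x ≠ 0 := fun x hx =>
      K.z_ne_zero_of_mem_annulus (hsph hx)
    have hzc := C.differentiableOn.continuousOn.mono hD
    have hzd := C.continuousOn_deriv.mono hD
    have hball : ∀ x ∈ sphere (S.p h) (ε / 2), 1 / S.z h x ∈ ball (0 : ℂ) (‖t e‖ / ρ)⁻¹ :=
      fun x hx => by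
        rw [mem_ball_zero_iff, one_div, norm_inv]
        exact inv_strictAnti₀ (by positivity) (hsph hx).2
    have hgz : DifferentiableOn ℂ (fun x => F (S.z h x) * deriv (S.z h) x) (S.D h) :=
      (hF.comp C.differentiableOn C.bijOn.mapsTo).mul (C.differentiableOn.deriv C.isOpen)
    have h1 := C.circleIntegral_eq_zero hgz hs.le hD
    have h2 := C.circleIntegral_zpow_mul_deriv hs hD hmem (-1)
    have h3 := C.circleIntegral_inversion_eq_zero hQ₁ hs hD hmem 1 hball 0
    rw [if_pos rfl] at h2
    have h4 := hper e (ε / 2) hs hsph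
    have h5 : (∮ x in C(S.p (e, true), ε / 2), f (G.tgt e) x) = ∮ x in C(S.p h, ε / 2),
        (F (S.z h x) * deriv (S.z h) x +
      (Q 0 * (S.z h x ^ (-1 : ℤ) * deriv (S.z h) x) + (S.z h x ^ 0)⁻¹ *
        (1 / S.z h x ^ 2 * dslope Q 0 (1 / S.z h x) * deriv (S.z h) x))) :=
      circleIntegral.integral_congr hs.le fun x hx => hform x (hsph hx)
    have hi1 := (hgz.continuousOn.mono hD).circleIntegrable hs.le
    have hi2 : CircleIntegrable (fun x => Q 0 * (S.z h x ^ (-1 : ℤ) * deriv (S.z h) x))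
        (S.p h) (ε / 2) := (continuousOn_const.mul ((hzc.zpow₀ _ fun x hx =>
      Or.inl (hz0 x hx)).mul hzd)).circleIntegrable hs.le
    have hi3 : CircleIntegrable (fun x => (S.z h x ^ 0)⁻¹ *
        (1 / S.z h x ^ 2 * dslope Q 0 (1 / S.z h x) * deriv (S.z h) x)) (S.p h) (ε / 2) := by
      refine ContinuousOn.circleIntegrable hs.le (ContinuousOn.mul
        (((hzc.pow 0).inv₀ fun x hx => pow_ne_zero _ (hz0 x hx)))
        (((continuousOn_const.div (hzc.pow 2) fun x hx => pow_ne_zero _ (hz0 x hx)).mul ?_).mul hzd))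
      exact hQ₁.continuousOn.comp (continuousOn_const.div hzc hz0) hball
    rw [h5, circleIntegral.integral_add hi1 (hi2.fun_add hi3), circleIntegral.integral_add hi2 hi3,
      h1, h3, circleIntegral.integral_const_mul, h2, zero_add, add_zero, mul_comm] at h4
    exact mul_left_cancel₀ Complex.two_pi_I_ne_zero h4
  -- The second function is chosen so that `-(t / z ^ 2) g(t / z)` equals `z⁻²` times `dslope Q 0`
  -- at `1 / z`, the part of the Laurent series of order at most `-2`.
  let g : Bool → ℂ → ℂ := fun σ => if σ then F else fun ξ => -(t e)⁻¹ * dslope Q 0 (ξ / t e)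
  have hgt : g true = F := rfl
  have hgf : g false = fun ξ => -(t e)⁻¹ * dslope Q 0 (ξ / t e) := rfl
  have htrue : ∀ x ∈ annulus ρ S t h, f (G.base h) x =
      (g true (S.z h x) + a h / S.z h x -
        t e / S.z h x ^ 2 * g false (t e / S.z h x)) * deriv (S.z h) x := by
    intro x hx
    have h0 := K.z_ne_zero_of_mem_annulus hx
    have h1 : t e / S.z h x / t e = 1 / S.z h x := by field_simp
    rw [hform x hx, hQ0, hgt, hgf]
    beta_reduce
    rw [h1, zpow_neg_one]
    field_simp
    ring
  refine ⟨g, ?_, ?_⟩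
  · rintro (_ | _)
    · rw [hgf]
      refine DifferentiableOn.const_mul (hQ₁.comp (by fun_prop) fun ξ hξ => ?_) _
      rw [mem_ball_zero_iff] at hξ ⊢
      rw [norm_div, inv_div]
      gcongr
    · rw [hgt]; exact hF
  · rintro (_ | _)
    · intro x hx
      have h0 := K.z_ne_zero_of_mem_annulus hx
      have h0n := norm_pos_iff.2 h0
      have h1 := (K.chart (e, false)).norm_lt hx.1
      have hlt := K.t_div_mem_ball hx
      -- `y` is the point of the `+` annulus identified with `x`.
      obtain ⟨y, hy, hzy⟩ := K.exists_mem_annulus (h := h) (ζ := t e / S.z (e, false) x)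
        (by rw [norm_div]; gcongr) (by simpa using hlt)
      have h2 := hreg.glue e ht x hx y hy (by rw [← hh, hzy]; field_simp)
      have h3 := htrue y hy
      have hb1 : G.base h = G.tgt e := rfl
      have hb2 : G.base (e, false) = G.src e := rfl
      have hy0 : deriv (S.z h) y ≠ 0 := C.deriv_ne_zero hy.1
      have h4 : t e / (t e / S.z (e, false) x) = S.z (e, false) x := by field_simp
      rw [hb1, hzy, h4] at h3
      rw [← hh, h3, hzy] at h2
      rw [hb2, Bool.not_false, ha e, ← hh]
      have h5 : S.z (e, false) x * deriv (S.z h) y ≠ 0 := mul_ne_zero h0 hy0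
      refine mul_right_cancel₀ h5 (h2.trans ?_)
      field_simp
      ring
    · exact htrue

/-- Subtracting the residue times `deriv z / z` removes the simple pole, and the difference is
pulled back to the round disk. The residue on the `+` side comes from the period, that on the `-`
side from the condition at the node. -/
theorem exists_neckForm_of_eq_zero (K : NeckConfig G S t p₀ ρ c₁ c₂ ε r)
    (hreg : IsRegular G ρ S t f)
    (hper : HasPeriods G ρ S t f fun e => 2 * Real.pi * Complex.I * a (e, true))
    (ha : ∀ e, a (e, false) = -a (e, true)) {e : E} (ht : t e = 0) :
    ∃ g : Bool → ℂ → ℂ, (∀ σ, DifferentiableOn ℂ (g σ) (ball 0 ρ)) ∧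
      ∀ σ, ∀ x ∈ annulus ρ S t (e, σ), f (G.base (e, σ)) x =
        (g σ (S.z (e, σ) x) + a (e, σ) / S.z (e, σ) x) * deriv (S.z (e, σ)) x := by
  have hε := K.ε_pos
  have key : ∀ h : E × Bool, h.1 = e → ∀ u : ℂ → ℂ, AnalyticAt ℂ u (S.p h) →
      (∀ᶠ x in 𝓝[≠] (S.p h), f (G.base h) x = u x / (x - S.p h)) →
      ∃ g : ℂ → ℂ, DifferentiableOn ℂ g (ball 0 ρ) ∧ ∀ x ∈ annulus ρ S t h,
        f (G.base h) x = (g (S.z h x) + u (S.p h) / S.z h x) * deriv (S.z h) x := by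
    intro h hhe u hu hfu
    have C := K.chart h
    have hDn := C.isOpen.mem_nhds C.center_mem
    have hann : ∀ x ∈ S.D h, x ≠ S.p h → x ∈ annulus ρ S t h := fun x hx hxp =>
      ⟨hx, by rw [hhe, ht, norm_zero, zero_div]; exact norm_pos_iff.2 (C.ne_zero hx hxp)⟩
    obtain ⟨L, hL, hL'⟩ := C.exists_logDeriv_sub
    -- The value at the node point is the one which makes the difference continuous there.
    let B : ℂ → ℂ := fun x => if x = S.p h then dslope u (S.p h) x - u (S.p h) * L x else
      f (G.base h) x - u (S.p h) * (deriv (S.z h) x / S.z h x)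
    have hB : DifferentiableOn ℂ B (S.D h) := by
      intro x hx
      refine DifferentiableAt.differentiableWithinAt ?_
      rcases eq_or_ne x (S.p h) with rfl | hxp
      · have h1 : DifferentiableAt ℂ (dslope u (S.p h)) (S.p h) := by
          obtain ⟨s, hs⟩ := hu
          exact hs.has_fpower_series_dslope_fslope.analyticAt.differentiableAt
        refine DifferentiableAt.congr_of_eventuallyEq
          (f := fun x => dslope u (S.p h) x - u (S.p h) * L x)
          (h1.fun_sub ((hL.differentiableAt hDn).const_mul _)) ?_
        filter_upwards [eventually_nhdsWithin_iff.1 hfu, hDn] with y hy hyD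
        simp only [B]
        split_ifs with h2
        · rfl
        · have h3 := sub_ne_zero.2 h2
          rw [hy h2, hL' y hyD h2, dslope_of_ne _ h2, slope_def_field]
          field_simp
          ring
      · have h1 := ((hreg.holomorphic (G.base h)).mono
          (K.annulus_subset_piece h)).differentiableAt
            ((K.isOpen_annulus h).mem_nhds (hann x hx hxp))
        have h2 := (C.hasDerivAt hx).differentiableAt
        have h3 := (C.differentiableOn.deriv C.isOpen).differentiableAt (C.isOpen.mem_nhds hx)
        refine DifferentiableAt.congr_of_eventuallyEq
          (f := fun x => f (G.base h) x - u (S.p h) * (deriv (S.z h) x / S.z h x))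
          (h1.fun_sub ((h3.fun_div h2 (C.ne_zero hx hxp)).const_mul _)) ?_
        filter_upwards [isOpen_ne.mem_nhds hxp] with y hy
        simp only [B]
        rw [if_neg hy]
    obtain ⟨g, hg, hBg⟩ := C.exists_pullback_disk hB
    refine ⟨g, hg, fun x hx => ?_⟩
    have h0 := K.z_ne_zero_of_mem_annulus hx
    have hxp : x ≠ S.p h := by rintro rfl; exact h0 C.center
    have h1 := hBg x hx.1
    simp only [B] at h1
    rw [if_neg hxp] at h1
    rw [add_mul, ← h1]
    ring
  obtain ⟨u, w, hu, hw, hfu, hfw, huw⟩ := hreg.node e ht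
  obtain ⟨g₀, hg₀, hf₀⟩ := key (e, false) rfl u hu hfu
  obtain ⟨g₁, hg₁, hf₁⟩ := key (e, true) rfl w hw hfw
  have hres : w (S.p (e, true)) = a (e, true) := by
    set h : E × Bool := (e, true) with hh
    have C := K.chart h
    have hs : 0 < ε / 2 := by positivity
    have hsph := K.sphere_center_subset h
    have hD : sphere (S.p h) (ε / 2) ⊆ S.D h := fun x hx => (hsph hx).1
    have hz0 : ∀ x ∈ sphere (S.p h) (ε / 2), S.z h x ≠ 0 := fun x hx =>
      K.z_ne_zero_of_mem_annulus (hsph hx)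
    have hzc := C.differentiableOn.continuousOn.mono hD
    have hzd := C.continuousOn_deriv.mono hD
    have hgz : DifferentiableOn ℂ (fun x => g₁ (S.z h x) * deriv (S.z h) x) (S.D h) :=
      (hg₁.comp C.differentiableOn C.bijOn.mapsTo).mul (C.differentiableOn.deriv C.isOpen)
    have h1 := C.circleIntegral_eq_zero hgz hs.le hD
    have h2 := C.circleIntegral_zpow_mul_deriv hs hD (mem_ball_self hs) (-1)
    rw [if_pos rfl] at h2
    have h4 := hper e (ε / 2) hs hsph
    have h5 : (∮ x in C(S.p (e, true), ε / 2), f (G.tgt e) x) = ∮ x in C(S.p h, ε / 2),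
        (g₁ (S.z h x) * deriv (S.z h) x +
          w (S.p h) * (S.z h x ^ (-1 : ℤ) * deriv (S.z h) x)) := by
      refine circleIntegral.integral_congr hs.le fun x hx => (hf₁ x (hsph hx)).trans ?_
      rw [zpow_neg_one]
      ring
    have hi1 := (hgz.continuousOn.mono hD).circleIntegrable hs.le
    have hi2 : CircleIntegrable (fun x => w (S.p h) * (S.z h x ^ (-1 : ℤ) * deriv (S.z h) x))
        (S.p h) (ε / 2) := (continuousOn_const.mul ((hzc.zpow₀ _ fun x hx =>
      Or.inl (hz0 x hx)).mul hzd)).circleIntegrable hs.le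
    rw [h5, circleIntegral.integral_add hi1 hi2, h1, circleIntegral.integral_const_mul, h2,
      zero_add, mul_comm] at h4
    exact mul_left_cancel₀ Complex.two_pi_I_ne_zero h4
  refine ⟨fun σ => if σ then g₁ else g₀, ?_, ?_⟩
  · rintro (_ | _)
    · simpa using hg₀
    · simpa using hg₁
  · rintro (_ | _)
    · rw [huw, hres, ← ha e] at hf₀
      simpa using hf₀
    · rw [hres] at hf₁
      simpa using hf₁

theorem exists_neckForm (K : NeckConfig G S t p₀ ρ c₁ c₂ ε r)
    (hreg : IsRegular G ρ S t f)
    (hper : HasPeriods G ρ S t f fun e => 2 * Real.pi * Complex.I * a (e, true))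
    (ha : ∀ e, a (e, false) = -a (e, true)) :
    ∃ g : E × Bool → ℂ → ℂ, (∀ h, DifferentiableOn ℂ (g h) (ball 0 ρ)) ∧
      ∀ h, ∀ x ∈ annulus ρ S t h, f (G.base h) x = neckForm S t a g h x := by
  have key : ∀ e, ∃ g : Bool → ℂ → ℂ, (∀ σ, DifferentiableOn ℂ (g σ) (ball 0 ρ)) ∧
      ∀ σ, ∀ x ∈ annulus ρ S t (e, σ), f (G.base (e, σ)) x =
        (g σ (S.z (e, σ) x) + a (e, σ) / S.z (e, σ) x -
          t e / S.z (e, σ) x ^ 2 * g (!σ) (t e / S.z (e, σ) x)) * deriv (S.z (e, σ)) x := by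
    intro e
    by_cases ht : t e = 0
    · obtain ⟨g, hg, hf⟩ := K.exists_neckForm_of_eq_zero hreg hper ha ht
      refine ⟨g, hg, fun σ x hx => ?_⟩
      rw [hf σ x hx, ht]
      ring
    · exact K.exists_neckForm_of_ne_zero hreg hper ha ht
  choose g hg hf using key
  exact ⟨fun h => g h.1 h.2, fun h => hg h.1 h.2, fun h => hf h.1 h.2⟩

end NeckConfig

end OpenNodes

end

/-! ### Coefficients of a given regular differential: equations and a priori bounds. -/

noncomputable section

namespace OpenNodes

open Metric Filter Bornology

variable {V E : Type*} {G : OrientedMultigraph V E} {S : NodeData E} {t : E → ℂ}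
  {p₀ : E × Bool → ℂ} {ρ c₁ c₂ ε r : ℝ}

/-- The normalised Laurent coefficients of a differential at the central node points. -/
def principalCoeff (G : OrientedMultigraph V E) (p₀ : E × Bool → ℂ) (ε : ℝ) (f : V → ℂ → ℂ)
    (h : E × Bool) (j : ℕ) : ℂ :=
  (2 * Real.pi * Complex.I : ℂ)⁻¹ * ((((ε / 4 : ℝ) : ℂ) ^ j)⁻¹ *
    ∮ y in C(p₀ h, ε / 8), f (G.base h) y * (y - p₀ h) ^ j)

namespace NeckConfig

variable {f : V → ℂ → ℂ}

theorem differentiableAt_of_outside (K : NeckConfig G S t p₀ ρ c₁ c₂ ε r) (hfin : G.LocallyFinite)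
    {v : V} (hf : DifferentiableOn ℂ (f v) (piece G ρ S t v)) {x : ℂ}
    (hx : ∀ k, G.base k = v → ε / 8 < ‖x - p₀ k‖) : DifferentiableAt ℂ (f v) x :=
  (hf.mono fun _ hy => K.outside_subset_piece fun k hk => (hy k hk).le).differentiableAt
    ((isOpen_outside hfin p₀ (ε / 8) v).mem_nhds hx)

theorem half_le_of_le (K : NeckConfig G S t p₀ ρ c₁ c₂ ε r) {h k : E × Bool} (hk : h ≠ k)
    (hb : G.base h = G.base k) {x : ℂ} (hx : ‖x - p₀ h‖ ≤ 3 * ε / 2) : ε / 2 ≤ ‖x - p₀ k‖ := by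
  have h1 := K.sep h k hk hb
  have h2 : ‖p₀ h - p₀ k‖ ≤ ‖x - p₀ k‖ + ‖x - p₀ h‖ := by
    have := norm_sub_le (x - p₀ k) (x - p₀ h)
    rwa [sub_sub_sub_cancel_left] at this
  linarith

theorem lt_norm_sub_of_base_eq (K : NeckConfig G S t p₀ ρ c₁ c₂ ε r) {h k : E × Bool}
    (hk : G.base k = G.base h) {x : ℂ} {s : ℝ} (hs : s < ε / 2) (hx : s < ‖x - p₀ h‖)
    (hx' : ‖x - p₀ h‖ ≤ 3 * ε / 2) : s < ‖x - p₀ k‖ := by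
  by_cases h1 : h = k
  · subst h1; exact hx
  · exact hs.trans_le (K.half_le_of_le h1 hk.symm hx')

theorem sphere_subset_piece (K : NeckConfig G S t p₀ ρ c₁ c₂ ε r) (h : E × Bool) {s : ℝ}
    (hs : ε / 8 ≤ s) (hs' : s ≤ 3 * ε / 2) : sphere (p₀ h) s ⊆ piece G ρ S t (G.base h) := by
  intro x hx
  have hε := K.ε_pos
  rw [mem_sphere_iff_norm] at hx
  refine K.outside_subset_piece fun k hk => ?_
  by_cases h1 : h = k
  · subst h1; linarith
  · have := K.half_le_of_le h1 hk.symm (hx.trans_le hs'); linarith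

theorem exists_principalCoeff_bound (K : NeckConfig G S t p₀ ρ c₁ c₂ ε r)
    (hf : ∀ v, DifferentiableOn ℂ (f v) (piece G ρ S t v)) (h : E × Bool) :
    ∃ B, ∀ j, ‖principalCoeff G p₀ ε f h j‖ ≤ B := by
  have hε := K.ε_pos
  obtain ⟨M, hM⟩ := (isCompact_sphere (p₀ h) (ε / 8)).exists_bound_of_continuousOn
    ((hf (G.base h)).continuousOn.mono (K.sphere_subset_piece h le_rfl (by linarith)))
  have hM0 : 0 ≤ M := by
    obtain ⟨x, hx⟩ := (NormedSpace.sphere_nonempty (x := p₀ h)).2 (show 0 ≤ ε / 8 by positivity)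
    exact (norm_nonneg _).trans (hM x hx)
  refine ⟨ε / 8 * M, fun j => ?_⟩
  have h1 := norm_two_pi_I_inv_mul_circleIntegral_le (c := p₀ h) (R := ε / 8)
    (f := fun y => f (G.base h) y * (y - p₀ h) ^ j) (C := M * (ε / 8) ^ j) (by positivity)
    fun y hy => by
      rw [norm_mul, norm_pow, mem_sphere_iff_norm.1 hy]
      gcongr
      exact hM y hy
  have h2 : (ε / 8) ^ j ≤ (ε / 4) ^ j := by gcongr; linarith
  rw [principalCoeff, mul_left_comm, norm_mul, norm_inv, norm_pow, Complex.norm_real,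
    Real.norm_eq_abs, abs_of_pos (by positivity), inv_mul_le_iff₀ (by positivity)]
  calc _ ≤ ε / 8 * (M * (ε / 8) ^ j) := h1
    _ ≤ ε / 8 * (M * (ε / 4) ^ j) := by gcongr
    _ = _ := by ring

/-- The outer radius `3 ε / 2` is large enough to contain the circle of radius `ε` bounding the
thick part, and small enough to stay at distance `ε / 2` from the other central points. -/
theorem exists_local_decomposition (K : NeckConfig G S t p₀ ρ c₁ c₂ ε r) (hfin : G.LocallyFinite)
    (hf : ∀ v, DifferentiableOn ℂ (f v) (piece G ρ S t v)) (h : E × Bool) :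
    ∃ F : ℂ → ℂ, DifferentiableOn ℂ F (ball (p₀ h) (3 * ε / 2)) ∧
      ∀ x, ε / 4 < ‖x - p₀ h‖ → ‖x - p₀ h‖ < 3 * ε / 2 → f (G.base h) x =
        F x + principalPart (p₀ h) (ε / 4) (principalCoeff G p₀ ε f h) x := by
  have hε := K.ε_pos
  obtain ⟨F, hF, hsum⟩ := exists_laurent_decomposition (q := f (G.base h)) (c := p₀ h)
    (s₁ := ε / 8) (s₂ := 3 * ε / 2) (by positivity) (by linarith)
    ((hf (G.base h)).continuousOn.mono fun x hx => by
      have h1 : ε / 8 ≤ ‖x - p₀ h‖ := by simpa [dist_eq_norm] using hx.2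
      have h2 : ‖x - p₀ h‖ ≤ 3 * ε / 2 := by rw [← dist_eq_norm]; exact hx.1
      exact K.sphere_subset_piece h h1 h2 (by simp))
    (fun x hx => by
      have h1 : ε / 8 < ‖x - p₀ h‖ := by simpa [dist_eq_norm] using hx.2
      have h2 : ‖x - p₀ h‖ < 3 * ε / 2 := by rw [← dist_eq_norm]; exact hx.1
      exact K.differentiableAt_of_outside hfin (hf _) fun k hk =>
        K.lt_norm_sub_of_base_eq hk (by linarith) h1 h2.le)
  refine ⟨F, hF, fun x h1 h2 => ?_⟩
  have h3 := hsum x ⟨by rw [Metric.mem_ball, dist_eq_norm]; exact h2, by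
    rw [mem_closedBall, dist_eq_norm]; linarith⟩
  have hb0 : (((ε / 4 : ℝ) : ℂ)) ≠ 0 := Complex.ofReal_ne_zero.2 (by positivity)
  rw [← sub_eq_iff_eq_add', ← h3.tsum_eq, principalPart]
  refine tsum_congr fun j => ?_
  rw [principalCoeff]
  field_simp

/-- Liouville's theorem: the difference extends over the disks to an entire function by
`exists_local_decomposition`, and it tends to zero at infinity. -/
theorem eq_vertexForm_of_outside (K : NeckConfig G S t p₀ ρ c₁ c₂ ε r) (hfin : G.LocallyFinite)
    (hf : ∀ v, DifferentiableOn ℂ (f v) (piece G ρ S t v)) {v : V} (hinf : HolomorphicAtInfty (f v))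
    (hsum : ∑ k ∈ hfin.halfEdges v, principalCoeff G p₀ ε f k 0 = 0) {x : ℂ}
    (hx : ∀ k, G.base k = v → ε / 4 < ‖x - p₀ k‖) :
    f v x = vertexForm hfin p₀ (ε / 4) (principalCoeff G p₀ ε f) v x := by
  classical
  have hε := K.ε_pos
  set d := principalCoeff G p₀ ε f
  choose B hB using K.exists_principalCoeff_bound hf
  choose F hF hFf using K.exists_local_decomposition hfin hf
  let A : V → ℂ → ℂ := fun v x => f v x - vertexForm hfin p₀ (ε / 4) d v x
  let T : E × Bool → ℂ → ℂ := fun h x =>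
    F h x - ∑ k ∈ (hfin.halfEdges (G.base h)).erase h, principalPart (p₀ k) (ε / 4) (d k) x
  have hAd : ∀ y, (∀ k, G.base k = v → ε / 4 < ‖y - p₀ k‖) → DifferentiableAt ℂ (A v) y :=
    fun y hy => (K.differentiableAt_of_outside hfin (hf v) fun k hk => by
      have := hy k hk; linarith).fun_sub (differentiableAt_vertexForm hfin (by positivity) hB hy)
  have hval : ∀ h, ∀ y ∈ ball (p₀ h) (3 * ε / 2),
      glued G p₀ (ε / 4) A T (G.base h) y = T h y := fun h y hy =>
    glued_of_mem (W := ball (p₀ h) (3 * ε / 2)) (fun k hk hb x hx => by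
      rw [Metric.mem_ball, dist_eq_norm] at hx
      have := K.half_le_of_le hk hb hx.le
      linarith) (fun x hx hx' => by
      rw [Metric.mem_ball, dist_eq_norm] at hx
      simp only [A, T]
      rw [hFf h x hx' hx, vertexForm_eq_erase_add]
      ring) hy
  have hTd : ∀ h, ∀ y ∈ ball (p₀ h) (3 * ε / 2), DifferentiableAt ℂ (T h) y := fun h y hy => by
    refine ((hF h).differentiableAt (isOpen_ball.mem_nhds hy)).fun_sub
      (DifferentiableAt.fun_sum fun k hk => ?_)
    rw [Finset.mem_erase, hfin.mem_halfEdges] at hk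
    rw [Metric.mem_ball, dist_eq_norm] at hy
    have := K.half_le_of_le (Ne.symm hk.1) hk.2.symm hy.le
    exact differentiableAt_principalPart (by positivity) (hB k) (by linarith)
  have hdiff : Differentiable ℂ (glued G p₀ (ε / 4) A T v) := by
    intro y
    by_cases H : ∀ k, G.base k = v → ε / 4 < ‖y - p₀ k‖
    · refine (hAd y H).congr_of_eventuallyEq ?_
      filter_upwards [(isOpen_outside hfin p₀ (ε / 4) v).mem_nhds H] with x hx
        using glued_of_outside hx
    · push Not at H
      obtain ⟨k, rfl, hk⟩ := H
      have hy : y ∈ ball (p₀ k) (3 * ε / 2) := by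
        rw [Metric.mem_ball, dist_eq_norm]; linarith
      refine (hTd k y hy).congr_of_eventuallyEq ?_
      filter_upwards [isOpen_ball.mem_nhds hy] with x hx using hval k x hx
  have hlim : Tendsto (glued G p₀ (ε / 4) A T v) (cocompact ℂ) (𝓝 0) := by
    rw [← cobounded_eq_cocompact]
    have h1 := (tendsto_zero_of_holomorphicAtInfty hinf).sub (tendsto_zero_of_holomorphicAtInfty
      (holomorphicAtInfty_vertexForm hfin (p₀ := p₀) (by positivity : 0 < ε / 4) hB hsum))
    rw [sub_zero] at h1
    refine h1.congr' ?_
    filter_upwards [eventually_outside hfin p₀ (ε / 4) v] with x hx using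
      (glued_of_outside (A := A) (T := T) hx).symm
  have h2 := hdiff.apply_eq_of_tendsto_cocompact x hlim
  rw [glued_of_outside hx] at h2
  exact sub_eq_zero.1 h2

variable {a : E × Bool → ℂ} {c : E × Bool → ℕ → ℂ} {Bc : E × Bool → ℝ}

theorem exists_scaledSeries (K : NeckConfig G S t p₀ ρ c₁ c₂ ε r) {g : E × Bool → ℂ → ℂ}
    (hg : ∀ h, DifferentiableOn ℂ (g h) (ball 0 ρ)) :
    ∃ (c : E × Bool → ℕ → ℂ) (B : E × Bool → ℝ), (∀ h m, ‖c h m‖ ≤ B h) ∧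
      (∀ h, ∀ ζ ∈ ball (0 : ℂ) ρ, g h ζ = scaledSeries r (c h) ζ) ∧
      ∀ h m, c h m = (2 * Real.pi * Complex.I : ℂ)⁻¹ * (r ^ m * ∮ w in C(p₀ h, ε / 2),
        (S.z h w ^ (m + 1))⁻¹ * (g h (S.z h w) * deriv (S.z h) w)) := by
  have hε := K.ε_pos
  have hr := K.r_pos
  have hrc : (r : ℂ) ≠ 0 := Complex.ofReal_ne_zero.2 hr.ne'
  have hbound : ∀ h, ∃ M, ∀ x ∈ sphere (p₀ h) (ε / 2), ‖g h (S.z h x) * deriv (S.z h) x‖ ≤ M :=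
    fun h => (isCompact_sphere (p₀ h) (ε / 2)).exists_bound_of_continuousOn
      ((((hg h).continuousOn.comp (K.chart h).differentiableOn.continuousOn
        (K.chart h).bijOn.mapsTo).mul (K.chart h).continuousOn_deriv).mono
          (K.sphere_subset h le_rfl))
  choose M hM using hbound
  refine ⟨fun h m => (2 * Real.pi * Complex.I : ℂ)⁻¹ * (r ^ m * ∮ w in C(p₀ h, ε / 2),
        (S.z h w ^ (m + 1))⁻¹ * (g h (S.z h w) * deriv (S.z h) w)),
    fun h => ε / 2 * (r⁻¹ * M h), fun h m => ?_, fun h ζ hζ => ?_, fun h m => rfl⟩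
  · have h1 := norm_two_pi_I_inv_mul_circleIntegral_le (c := p₀ h) (R := ε / 2)
      (f := fun w => (S.z h w ^ (m + 1))⁻¹ * (g h (S.z h w) * deriv (S.z h) w))
      (C := (r ^ (m + 1))⁻¹ * M h) (by positivity) fun w hw => by
        have h2 := K.norm_inv_z_pow_le h (by linarith) le_rfl (m + 1) hw
        rw [norm_mul]
        exact mul_le_mul h2 (hM h w hw) (norm_nonneg _) (by positivity)
    beta_reduce
    rw [mul_left_comm, norm_mul, norm_pow, Complex.norm_real, Real.norm_eq_abs, abs_of_pos hr]
    calc _ ≤ r ^ m * (ε / 2 * ((r ^ (m + 1))⁻¹ * M h)) := by gcongr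
      _ = _ := by rw [pow_succ]; field_simp
  · have h1 := (K.chart h).hasSum_circleIntegral_coeff (hg h) (half_pos hε)
      (K.sphere_subset h le_rfl) (K.mem_ball h (by linarith)) hζ
    rw [← h1.tsum_eq, scaledSeries]
    refine tsum_congr fun m => ?_
    rw [div_pow]
    field_simp

theorem neckForm_congr (K : NeckConfig G S t p₀ ρ c₁ c₂ ε r) {g g' : E × Bool → ℂ → ℂ}
    (hg : ∀ h, ∀ ζ ∈ ball (0 : ℂ) ρ, g h ζ = g' h ζ) {h : E × Bool} {x : ℂ}
    (hx : x ∈ annulus ρ S t h) : neckForm S t a g h x = neckForm S t a g' h x := by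
  rw [neckForm, neckForm, hg h _ ((K.chart h).bijOn.mapsTo hx.1),
    hg (opp h) _ (K.t_div_mem_ball hx)]

theorem principalCoeff_eq (K : NeckConfig G S t p₀ ρ c₁ c₂ ε r) {g : E × Bool → ℂ → ℂ}
    (hg : ∀ h, DifferentiableOn ℂ (g h) (ball 0 ρ))
    (hfg : ∀ h, ∀ x ∈ annulus ρ S t h, f (G.base h) x = neckForm S t a g h x) (h : E × Bool)
    (j : ℕ) : principalCoeff G p₀ ε f h j = (2 * Real.pi * Complex.I : ℂ)⁻¹ *
      ((((ε / 4 : ℝ) : ℂ) ^ j)⁻¹ *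
        ∮ y in C(p₀ h, ε / 8), neckSingular S t a g h y * (y - p₀ h) ^ j) := by
  have hε := K.ε_pos
  have C := K.chart h
  have hD := K.sphere_subset h (s := ε / 8) (by linarith)
  have hann : sphere (p₀ h) (ε / 8) ⊆ annulus ρ S t h := fun x hx =>
    K.mem_annulus h (hD hx) (mem_sphere_iff_norm.1 hx).ge
  have h1 : DifferentiableOn ℂ (fun y => g h (S.z h y) * deriv (S.z h) y * (y - p₀ h) ^ j) (S.D h) :=
    (((hg h).comp C.differentiableOn C.bijOn.mapsTo).mul (C.differentiableOn.deriv C.isOpen)).mul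
      (by fun_prop)
  have h2 : (∮ y in C(p₀ h, ε / 8), f (G.base h) y * (y - p₀ h) ^ j) =
      ∮ y in C(p₀ h, ε / 8), (g h (S.z h y) * deriv (S.z h) y * (y - p₀ h) ^ j +
        neckSingular S t a g h y * (y - p₀ h) ^ j) := by
    refine circleIntegral.integral_congr (by positivity) fun y hy => ?_
    rw [hfg h y (hann hy), neckForm_eq]
    ring
  rw [principalCoeff, h2, circleIntegral.integral_add, C.circleIntegral_eq_zero h1 (by positivity) hD,
    zero_add]
  · exact (h1.continuousOn.mono hD).circleIntegrable (by positivity)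
  · refine ContinuousOn.circleIntegrable (by positivity) (ContinuousOn.mul (fun y hy => ?_)
      (by fun_prop))
    exact (K.differentiableAt_neckSingular a (hg (opp h)) (hD hy)
      (K.z_ne_zero_of_mem_annulus (hann hy))
      (K.t_div_mem_ball (hann hy))).continuousAt.continuousWithinAt

theorem taylorCoeff_eq (K : NeckConfig G S t p₀ ρ c₁ c₂ ε r) {g : E × Bool → ℂ → ℂ}
    (hg : ∀ h, DifferentiableOn ℂ (g h) (ball 0 ρ))
    (hfg : ∀ h, ∀ x ∈ annulus ρ S t h, f (G.base h) x = neckForm S t a g h x) (h : E × Bool)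
    (m : ℕ) : (∮ w in C(p₀ h, ε / 2), (S.z h w ^ (m + 1))⁻¹ * f (G.base h) w) =
      ∮ w in C(p₀ h, ε / 2), (S.z h w ^ (m + 1))⁻¹ * (g h (S.z h w) * deriv (S.z h) w) := by
  have hε := K.ε_pos
  have C := K.chart h
  have hD := K.sphere_subset h (s := ε / 2) le_rfl
  have hz := K.continuousOn_inv_z_pow h (s := ε / 2) (by linarith) le_rfl (m + 1)
  have hann : sphere (p₀ h) (ε / 2) ⊆ annulus ρ S t h := fun x hx =>
    K.mem_annulus h (hD hx) (by rw [mem_sphere_iff_norm.1 hx]; linarith)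
  have h2 : (∮ w in C(p₀ h, ε / 2), (S.z h w ^ (m + 1))⁻¹ * f (G.base h) w) =
      ∮ w in C(p₀ h, ε / 2), ((S.z h w ^ (m + 1))⁻¹ * (g h (S.z h w) * deriv (S.z h) w) +
        (S.z h w ^ (m + 1))⁻¹ * neckSingular S t a g h w) := by
    refine circleIntegral.integral_congr (by positivity) fun y hy => ?_
    rw [hfg h y (hann hy), neckForm_eq]
    ring
  rw [h2, circleIntegral.integral_add, K.circleIntegral_inv_pow_mul_neckSingular h
    (K.r_lt h).le (hg (opp h)), add_zero]
  · exact (hz.mul ((((hg h).continuousOn.comp C.differentiableOn.continuousOn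
      C.bijOn.mapsTo).mul C.continuousOn_deriv).mono hD)).circleIntegrable (by positivity)
  · refine ContinuousOn.circleIntegrable (by positivity) (hz.mul (fun y hy => ?_))
    exact (K.differentiableAt_neckSingular a (hg (opp h)) (hD hy)
      (K.z_ne_zero_of_mem_annulus (hann hy))
      (K.t_div_mem_ball (hann hy))).continuousAt.continuousWithinAt

/-- The factor 2 is the sum of the weights `2⁻ⁿ`, and the displacement of the pole costs nothing
because `‖S.p h - p₀ h‖ ≤ ε / 4`. -/
theorem norm_principalCoeff_le (K : NeckConfig G S t p₀ ρ c₁ c₂ ε r)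
    (hc : ∀ k n, ‖c k n‖ ≤ Bc k) {d : E × Bool → ℕ → ℂ}
    (hD : ∀ h j, d h j = (2 * Real.pi * Complex.I : ℂ)⁻¹ * ((((ε / 4 : ℝ) : ℂ) ^ j)⁻¹ *
      ∮ y in C(p₀ h, ε / 8),
        neckSingular S t a (fun k => scaledSeries r (c k)) h y * (y - p₀ h) ^ j)) (h : E × Bool)
    {N : ℝ} (hN : ∀ n, ‖c (opp h) n‖ ≤ N) (j : ℕ) :
    ‖d h j‖ ≤ ‖a h‖ + 2 * (‖t h.1‖ / r) * N := by
  have hε := K.ε_pos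
  have hr := K.r_pos
  have h1 := K.principal_coefficient_eq a hc h j
  rw [← hD h j] at h1
  have h2 := tsum_of_norm_bounded (summable_half_pow_mul (‖t h.1‖ / r * N)).hasSum
    (f := fun n => (2 : ℂ)⁻¹ ^ n * inversionKernel S t p₀ ε r h j n * c (opp h) n) fun n => by
      rw [norm_mul, norm_mul, norm_pow, norm_inv, Complex.norm_ofNat, mul_assoc]
      have h3 := K.norm_inversionKernel_le h j n
      have h4 := hN n
      gcongr
  rw [h1.tsum_eq, tsum_mul_right, tsum_geometric_of_lt_one (by norm_num) (by norm_num)] at h2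
  have h3 : ‖((S.p h - p₀ h) / (ε / 4 : ℝ)) ^ j * a h‖ ≤ ‖a h‖ := by
    rw [norm_mul, norm_pow]
    refine mul_le_of_le_one_left (norm_nonneg _) (pow_le_one₀ (norm_nonneg _) ?_)
    rw [norm_div, Complex.norm_real, Real.norm_eq_abs, abs_of_pos (by positivity),
      div_le_one (by positivity)]
    have := K.close h
    linarith
  have h4 := norm_sub_norm_le (d h j) (((S.p h - p₀ h) / (ε / 4 : ℝ)) ^ j * a h)
  have h5 : (1 - (2 : ℝ)⁻¹)⁻¹ * (‖t h.1‖ / r * N) = 2 * (‖t h.1‖ / r) * N := by norm_num; ring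
  linarith

/-- A bound on the thick part is carried inside the disk of radius `ε`: the regular part by the
maximum principle from the circle of radius `ε`, the principal part by its coefficients. -/
theorem norm_le_on_sphere (K : NeckConfig G S t p₀ ρ c₁ c₂ ε r) (hfin : G.LocallyFinite)
    (hf : ∀ v, DifferentiableOn ℂ (f v) (piece G ρ S t v)) (h : E × Bool) {M B : ℝ}
    (hM : ∀ x ∈ domainΩ G p₀ ε (G.base h), ‖f (G.base h) x‖ ≤ M)
    (hB : ∀ j, ‖principalCoeff G p₀ ε f h j‖ ≤ B) {x : ℂ} (hx : x ∈ sphere (p₀ h) (ε / 2)) :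
    ‖f (G.base h) x‖ ≤ M + 8 * B / ε := by
  have hε := K.ε_pos
  obtain ⟨F, hF, hFf⟩ := K.exists_local_decomposition hfin hf h
  have hB0 : 0 ≤ B := (norm_nonneg _).trans (hB 0)
  have hcl : closure (ball (p₀ h) ε) ⊆ ball (p₀ h) (3 * ε / 2) := by
    rw [closure_ball _ hε.ne']
    exact closedBall_subset_ball (by linarith)
  have hdc : DiffContOnCl ℂ F (ball (p₀ h) ε) := (hF.mono hcl).diffContOnCl
  have hfr : ∀ y ∈ frontier (ball (p₀ h) ε), ‖F y‖ ≤ M + 4 * B / ε := by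
    intro y hy
    rw [frontier_ball _ hε.ne', mem_sphere_iff_norm] at hy
    have h1 : y ∈ domainΩ G p₀ ε (G.base h) := by
      intro k hk
      by_cases hkh : h = k
      · subst hkh; exact hy.ge
      · have h1 := K.sep h k hkh hk.symm
        have h2 : ‖p₀ h - p₀ k‖ ≤ ‖y - p₀ k‖ + ‖y - p₀ h‖ := by
          have := norm_sub_le (y - p₀ k) (y - p₀ h)
          rwa [sub_sub_sub_cancel_left] at this
        linarith
    have h2 := hFf y (by linarith) (by linarith)
    have h3 := norm_principalPart_le (p := p₀ h) (b := ε / 4) (by positivity) hB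
      (show ε / 4 < ε by linarith) hy.ge
    have h4 : F y = f (G.base h) y -
        principalPart (p₀ h) (ε / 4) (principalCoeff G p₀ ε f h) y := by rw [h2]; ring
    have h5 : B / (ε - ε / 4) ≤ 4 * B / ε := by
      rw [div_le_div_iff₀ (by linarith) hε]
      nlinarith
    rw [h4]
    have := norm_sub_le (f (G.base h) y)
      (principalPart (p₀ h) (ε / 4) (principalCoeff G p₀ ε f h) y)
    have := hM y h1
    linarith
  rw [mem_sphere_iff_norm] at hx
  have h1 := Complex.norm_le_of_forall_mem_frontier_norm_le isBounded_ball hdc hfr (z := x)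
    (subset_closure (by rw [Metric.mem_ball, dist_eq_norm]; linarith))
  have h3 := norm_principalPart_le (p := p₀ h) (b := ε / 4) (by positivity) hB
    (show ε / 4 < ε / 2 by linarith) hx.ge
  have h4 : B / (ε / 2 - ε / 4) = 4 * B / ε := by field_simp; ring
  rw [hFf x (by linarith) (by linarith)]
  have := norm_add_le (F x) (principalPart (p₀ h) (ε / 4) (principalCoeff G p₀ ε f h) x)
  have h6 : 8 * B / ε = 4 * B / ε + 4 * B / ε := by ring
  linarith

/-- A regular differential satisfies the coefficient equations, and its Taylor coefficients in
the necks are controlled by its values on the thick part and by its residues. -/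
theorem exists_coefficients (K : NeckConfig G S t p₀ ρ c₁ c₂ ε r) (hfin : G.LocallyFinite)
    (ht : ∀ e, 16 * ‖t e‖ ≤ r ^ 2) (hreg : IsRegular G ρ S t f)
    (hper : HasPeriods G ρ S t f fun e => 2 * Real.pi * Complex.I * a (e, true))
    (ha : ∀ e, a (e, false) = -a (e, true)) (hsum : ∀ v, ∑ k ∈ hfin.halfEdges v, a k = 0)
    {M : V → ℝ} (hM : ∀ v, ∀ x ∈ domainΩ G p₀ ε v, ‖f v x‖ ≤ M v) :
    ∃ (c d : E × Bool → ℕ → ℂ) (Bd : E × Bool → ℝ),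
      (∀ h m, ‖c h m‖ ≤ ε / r * (M (G.src h.1) + M (G.tgt h.1)) + 16 / r * ‖a (h.1, true)‖) ∧
      (∀ h j, ‖d h j‖ ≤ Bd h) ∧
      (∀ h m, c h m = (2 * Real.pi * Complex.I : ℂ)⁻¹ * (r ^ m * ∮ w in C(p₀ h, ε / 2),
        (S.z h w ^ (m + 1))⁻¹ * vertexForm hfin p₀ (ε / 4) d (G.base h) w)) ∧
      (∀ h j, d h j = (2 * Real.pi * Complex.I : ℂ)⁻¹ * ((((ε / 4 : ℝ) : ℂ) ^ j)⁻¹ *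
        ∮ y in C(p₀ h, ε / 8),
          neckSingular S t a (fun k => scaledSeries r (c k)) h y * (y - p₀ h) ^ j)) ∧
      (∀ v x, (∀ k, G.base k = v → ε / 4 < ‖x - p₀ k‖) →
        f v x = vertexForm hfin p₀ (ε / 4) d v x) ∧
      ∀ h, ∀ x ∈ annulus ρ S t h,
        f (G.base h) x = neckForm S t a (fun k => scaledSeries r (c k)) h x := by
  have hε := K.ε_pos
  have hr := K.r_pos
  obtain ⟨g, hg, hfg⟩ := K.exists_neckForm hreg hper ha
  obtain ⟨c, Bc, hBc, hgc, hcg⟩ := K.exists_scaledSeries hg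
  have hg' : ∀ h, DifferentiableOn ℂ (scaledSeries r (c h)) (ball 0 ρ) := fun h =>
    (hg h).congr fun ζ hζ => (hgc h ζ hζ).symm
  have hfc : ∀ h, ∀ x ∈ annulus ρ S t h,
      f (G.base h) x = neckForm S t a (fun k => scaledSeries r (c k)) h x := fun h x hx =>
    (hfg h x hx).trans (K.neckForm_congr hgc hx)
  choose Bd hBd using K.exists_principalCoeff_bound hreg.holomorphic
  have hD := K.principalCoeff_eq hg' hfc
  have hhead := K.head_coefficient_eq hBc hD
  have hout : ∀ v x, (∀ k, G.base k = v → ε / 4 < ‖x - p₀ k‖) →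
      f v x = vertexForm hfin p₀ (ε / 4) (principalCoeff G p₀ ε f) v x := fun v x hx =>
    K.eq_vertexForm_of_outside hfin hreg.holomorphic (hreg.infty v)
      (by rw [← hsum v]; exact Finset.sum_congr rfl fun k _ => hhead k) hx
  have hcf : ∀ h m, c h m = (2 * Real.pi * Complex.I : ℂ)⁻¹ * (r ^ m * ∮ w in C(p₀ h, ε / 2),
        (S.z h w ^ (m + 1))⁻¹ * f (G.base h) w) := fun h m => by
    rw [K.taylorCoeff_eq hg hfg h m]; exact hcg h m
  have hM0 : ∀ h : E × Bool, 0 ≤ M (G.base h) := fun h => by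
    obtain ⟨x, hx⟩ := (eventually_outside hfin p₀ ε (G.base h)).exists
    exact (norm_nonneg _).trans (hM _ x fun k hk => (hx k hk).le)
  -- The Taylor coefficients at `h` are bounded by data on the thick part plus half of those at the
  -- opposite half-edge; the factor `1 / 2` is `4 / r` times `r / 8`, which is where `16 ‖t‖ ≤ r ^
  -- 2` enters.
  have hstep : ∀ h N, (∀ n, ‖c (opp h) n‖ ≤ N) → ∀ m,
      ‖c h m‖ ≤ (ε / (2 * r) * M (G.base h) + 4 / r * ‖a h‖) + N / 2 := by
    intro h N hN m
    have hN0 : 0 ≤ N := (norm_nonneg _).trans (hN 0)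
    have h1 := K.norm_principalCoeff_le hBc hD h hN
    set B := ‖a h‖ + 2 * (‖t h.1‖ / r) * N with hBdef
    have hB0 : 0 ≤ B := by positivity
    have h2 := norm_two_pi_I_inv_mul_circleIntegral_le (c := p₀ h) (R := ε / 2)
      (f := fun w => (S.z h w ^ (m + 1))⁻¹ * f (G.base h) w)
      (C := (r ^ (m + 1))⁻¹ * (M (G.base h) + 8 * B / ε)) (by positivity) fun w hw => by
        have h2 := K.norm_inv_z_pow_le h (by linarith) le_rfl (m + 1) hw
        have h3 := K.norm_le_on_sphere hfin hreg.holomorphic h (hM _) h1 hw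
        rw [norm_mul]
        exact mul_le_mul h2 h3 (norm_nonneg _) (by positivity)
    have h5 : 2 * (‖t h.1‖ / r) ≤ r / 8 := by
      have := ht h.1
      rw [mul_div_assoc', div_le_iff₀ hr]
      nlinarith
    have h6 : B ≤ ‖a h‖ + r / 8 * N := by rw [hBdef]; gcongr
    rw [hcf h m, mul_left_comm, norm_mul, norm_pow, Complex.norm_real, Real.norm_eq_abs,
      abs_of_pos hr]
    calc _ ≤ r ^ m * (ε / 2 * ((r ^ (m + 1))⁻¹ * (M (G.base h) + 8 * B / ε))) := by gcongr
      _ = ε / (2 * r) * M (G.base h) + 4 / r * B := by rw [pow_succ]; field_simp; ring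
      _ ≤ ε / (2 * r) * M (G.base h) + 4 / r * (‖a h‖ + r / 8 * N) := by gcongr
      _ = _ := by field_simp; ring
  have hfinal : ∀ h m, ‖c h m‖ ≤ 2 * ((ε / (2 * r) * M (G.base h) + 4 / r * ‖a h‖) +
      (ε / (2 * r) * M (G.base (opp h)) + 4 / r * ‖a (opp h)‖)) := by
    intro h m
    -- The bound `Bc` is not controlled along the graph, but it makes the suprema at `h` and `opp h`
    -- finite, so the two inequalities of `hstep` can be solved against each other.
    have hbdd : ∀ k, BddAbove (Set.range fun n => ‖c k n‖) := fun k =>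
      ⟨Bc k, by rintro _ ⟨n, rfl⟩; exact hBc k n⟩
    have hle : ∀ k n, ‖c k n‖ ≤ ⨆ n, ‖c k n‖ := fun k n => le_ciSup (hbdd k) n
    have h1 : (⨆ n, ‖c h n‖) ≤ _ := ciSup_le (hstep h _ (hle (opp h)))
    have h2 : (⨆ n, ‖c (opp h) n‖) ≤ _ := ciSup_le (hstep (opp h) _ (by
      rw [opp_opp]; exact hle h))
    have h3 := hle h m
    have h4 := hM0 h
    have h5 := hM0 (opp h)
    have h6 : 0 ≤ ε / (2 * r) * M (G.base h) + 4 / r * ‖a h‖ := by positivity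
    have h7 : 0 ≤ ε / (2 * r) * M (G.base (opp h)) + 4 / r * ‖a (opp h)‖ := by positivity
    linarith
  refine ⟨c, principalCoeff G p₀ ε f, Bd, fun h m => (hfinal h m).trans (le_of_eq ?_), hBd,
    fun h m => ?_, hD, hout, hfc⟩
  · obtain ⟨e, _ | _⟩ := h
    · have h1 : G.base (e, false) = G.src e := rfl
      have h2 : G.base (opp (e, false)) = G.tgt e := rfl
      have h3 : opp (e, false) = (e, true) := rfl
      rw [h1, h2, h3, ha e, norm_neg]
      field_simp
      ring
    · have h1 : G.base (e, true) = G.tgt e := rfl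
      have h2 : G.base (opp (e, true)) = G.src e := rfl
      have h3 : opp (e, true) = (e, false) := rfl
      rw [h1, h2, h3, ha e, norm_neg]
      field_simp
      ring
  · rw [hcf h m]
    congr 2
    refine circleIntegral.integral_congr (by positivity) fun w hw => ?_
    rw [hout _ w fun k hk => ?_]
    have := K.half_le_norm_sub hk hw
    linarith

theorem eq_solution (K : NeckConfig G S t p₀ ρ c₁ c₂ ε r) (hfin : G.LocallyFinite)
    {d : E × Bool → ℕ → ℂ} (hout : ∀ v x, (∀ k, G.base k = v → ε / 4 < ‖x - p₀ k‖) →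
        f v x = vertexForm hfin p₀ (ε / 4) d v x)
    (hann : ∀ h, ∀ x ∈ annulus ρ S t h,
        f (G.base h) x = neckForm S t a (fun k => scaledSeries r (c k)) h x)
    (hsol : ∀ h, ∀ x ∈ S.D h, ε / 4 < ‖x - p₀ h‖ → vertexForm hfin p₀ (ε / 4) d (G.base h) x =
        neckForm S t a (fun k => scaledSeries r (c k)) h x) (v : V) :
    Set.EqOn (f v) (solution hfin S t p₀ ε r a c d v) (piece G ρ S t v) := by
  intro x hx
  by_cases H : ∀ k, G.base k = v → ε / 4 < ‖x - p₀ k‖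
  · rw [solution, glued_of_outside H, hout v x H]
  · push Not at H
    obtain ⟨k, rfl, hk⟩ := H
    have hε := K.ε_pos
    have hxD : x ∈ S.D k := K.closedBall_subset k (by
      rw [mem_closedBall, dist_eq_norm]; linarith)
    rw [hann k x (mem_annulus_of_mem_piece hx hxD), solution, K.glued_eq_neckForm hsol hxD]

end NeckConfig

end OpenNodes

end

noncomputable section

namespace OpenNodes

open Metric Filter

/-! ### Analytic families of kernels -/

section AnalyticFamilies

variable {X : Type*} [NormedAddCommGroup X] [NormedSpace ℂ X]

theorem analyticOnNhd_circleIntegral {F : X → ℂ → ℂ} {U : Set X} {M R : ℝ} {c : ℂ} (hR : 0 ≤ R)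
    (hU : IsOpen U) (hF : ∀ w ∈ sphere c R, AnalyticOnNhd ℂ (fun x => F x w) U)
    (hc : ∀ x ∈ U, ContinuousOn (F x) (sphere c R)) (hM : ∀ x ∈ U, ∀ w ∈ sphere c R, ‖F x w‖ ≤ M) :
    AnalyticOnNhd ℂ (fun x => ∮ w in C(c, R), F x w) U := by
  have hmem : ∀ θ, circleMap c R θ ∈ sphere c R := fun θ => circleMap_mem_sphere c hR θ
  refine analyticOnNhd_intervalIntegral (M := R * M)
    (F := fun x θ => deriv (circleMap c R) θ • F x (circleMap c R θ)) hU (fun θ => ?_)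
    (fun x hx => ?_) fun x hx θ => ?_
  · exact fun x hx => analyticAt_const.fun_smul (hF _ (hmem θ) x hx)
  · simp only [deriv_circleMap]
    exact ((continuous_circleMap 0 R).mul continuous_const).smul
      ((hc x hx).comp_continuous (continuous_circleMap c R) hmem)
  · rw [norm_smul]
    simp only [deriv_circleMap, norm_mul, norm_circleMap_zero, Complex.norm_I, mul_one,
      abs_of_nonneg hR]
    gcongr
    exact hM x hx _ (hmem θ)

/-- The kernels are built by this lemma: their entries are analytic one by one, with a common bound.
-/
theorem exists_analyticOnNhd_lp {I : Type*} {k : X → I → ℂ} {U : Set X} {M : ℝ} (hM0 : 0 ≤ M)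
    (hU : IsOpen U) (hk : ∀ i, AnalyticOnNhd ℂ (fun x => k x i) U) (hM : ∀ x ∈ U, ∀ i, ‖k x i‖ ≤ M) :
    ∃ κ : X → lp (fun _ : I => ℂ) ∞, AnalyticOnNhd ℂ κ U ∧ (∀ x ∈ U, ∀ i, κ x i = k x i) ∧
      ∀ x ∈ U, ‖κ x‖ ≤ M := by
  classical
  let κ : X → lp (fun _ : I => ℂ) ∞ := fun x =>
    if hx : x ∈ U then ⟨k x, memℓp_infty ⟨M, by rintro _ ⟨i, rfl⟩; exact hM x hx i⟩⟩ else 0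
  have hκ : ∀ x ∈ U, ∀ i, κ x i = k x i := fun x hx i => by simp only [κ, dif_pos hx]
  have hκM : ∀ x ∈ U, ‖κ x‖ ≤ M := fun x hx =>
    lp.norm_le_of_forall_le hM0 fun i => by rw [hκ x hx]; exact hM x hx i
  exact ⟨κ, isNorming_lp.analyticOnNhd hU (fun i => (hk i).congr hU fun x hx => (hκ x hx i).symm) hκM,
    hκ, hκM⟩

end AnalyticFamilies

/-! ### The neck configurations given by the parameters -/

theorem DiskChart.translate {p : ℂ} {D : Set ℂ} {z : ℂ → ℂ} {ρ c₁ c₂ : ℝ}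
    (C : DiskChart p D z ρ c₁ c₂) (w : ℂ) :
    DiskChart (p + w) {x | x - w ∈ D} (fun x => z (x - w)) ρ c₁ c₂ where
  isOpen := C.isOpen.preimage (by fun_prop)
  center_mem := by simpa using C.center_mem
  differentiableOn := C.differentiableOn.comp (by fun_prop) fun x hx => hx
  bijOn := by
    refine ⟨fun x hx => C.bijOn.mapsTo hx, fun x hx y hy hxy => ?_, fun ζ hζ => ?_⟩
    · exact sub_left_injective (C.bijOn.injOn hx hy hxy)
    · obtain ⟨x, hx, rfl⟩ := C.bijOn.surjOn hζ
      exact ⟨x + w, by simpa using hx, by simp⟩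
  center := by simpa using C.center
  lower x hx := by
    have := C.lower _ hx
    rwa [sub_sub, add_comm w p] at this
  upper x hx := by
    have := C.upper _ hx
    rwa [sub_sub, add_comm w p] at this

section Parameters

variable {V E : Type*} {G : OrientedMultigraph V E} {X : E × Bool → Type*}
  [∀ h, NormedAddCommGroup (X h)] {Z : CoordFamily E X} {p₀ : E × Bool → ℂ} {ξ₀ : ∀ h, X h}
  {ρ c₁ c₂ δ₀ ε : ℝ}

theorem Admissible.diskChart {S : NodeData E} (hS : Admissible G ρ c₁ c₂ S) (h : E × Bool) :
    DiskChart (S.p h) (S.D h) (S.z h) ρ c₁ c₂ :=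
  ⟨hS.isOpen h, hS.center_mem h, hS.differentiableOn h, hS.bijOn h, hS.center h, hS.lower h,
    hS.upper h⟩

theorem Param.norm_fst_apply_le (x : Param E X) (h : E × Bool) : ‖x.1 h‖ ≤ ‖x‖ :=
  (lp.norm_apply_le_norm ENNReal.top_ne_zero x.1 h).trans (norm_fst_le x)

theorem Param.norm_snd_fst_apply_le (x : Param E X) (e : E) : ‖x.2.1 e‖ ≤ ‖x‖ :=
  (lp.norm_apply_le_norm ENNReal.top_ne_zero x.2.1 e).trans
    ((norm_fst_le x.2).trans (norm_snd_le x))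

/-- Admissibility is assumed at `p = p₀` only. The coordinates depend on `z - p`, so the charts for
other `p` are translates by `x.1 h`. Disjointness of the disks is replaced by distances to the
central points: `c₁ ρ ≥ ε` and the displacements are at most `ε / 16`. -/
theorem neckConfig_nodesAt (hc₁ : 0 < c₁) (hc₂ : 0 < c₂)
    (hadm : ∀ η : lp X ∞, ‖η‖ < δ₀ → Admissible G ρ c₁ c₂ (Z.nodeData p₀ fun h => ξ₀ h + η h))
    (hε : 0 < ε) (hερ : ε ≤ ρ * c₁) {x : Param E X} (hx₀ : ‖x‖ < δ₀) (hx : ‖x‖ ≤ ε / 16)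
    (hxt : 2 * ‖x‖ ≤ (ε / (16 * c₂)) ^ 2) :
    NeckConfig G (nodesAt Z p₀ ξ₀ x) x.2.1 p₀ ρ c₁ c₂ ε (ε / (16 * c₂)) := by
  have hA := hadm x.2.2 (((norm_snd_le x.2).trans (norm_snd_le x)).trans_lt hx₀)
  have hρ : 0 < ρ := by
    by_contra hcon
    nlinarith
  have hD : ∀ h y, y ∈ (nodesAt Z p₀ ξ₀ x).D h ↔
      y - x.1 h ∈ (Z.nodeData p₀ fun h => ξ₀ h + x.2.2 h).D h := fun h y => by
    change y - (p₀ h + x.1 h) ∈ Z.dom h (ξ₀ h + x.2.2 h) ↔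
      y - x.1 h - p₀ h ∈ Z.dom h (ξ₀ h + x.2.2 h)
    rw [sub_sub, add_comm (x.1 h)]
  have hball : ∀ h, ball (p₀ h) (c₁ * ρ) ⊆ (Z.nodeData p₀ fun h => ξ₀ h + x.2.2 h).D h :=
    fun h => (hA.diskChart h).ball_subset hc₁
  have hx1 := fun h => (Param.norm_fst_apply_le x h).trans hx
  refine ⟨fun h => ?_, hc₁, hc₂, hε, hερ, rfl, fun h => ?_, fun h k hk hb => ?_,
    fun h k hk hb y hy => ?_, fun e => ?_⟩
  · have h1 := (hA.diskChart h).translate (x.1 h)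
    have h2 : (nodesAt Z p₀ ξ₀ x).D h =
        {y | y - x.1 h ∈ (Z.nodeData p₀ fun h => ξ₀ h + x.2.2 h).D h} := Set.ext fun y => hD h y
    have h3 : (nodesAt Z p₀ ξ₀ x).z h =
        fun y => (Z.nodeData p₀ fun h => ξ₀ h + x.2.2 h).z h (y - x.1 h) := funext fun y => by
      change Z.map h (y - (p₀ h + x.1 h)) _ = Z.map h (y - x.1 h - p₀ h) _
      rw [sub_sub, add_comm (x.1 h)]
    rw [h2, h3]
    exact h1
  · change ‖p₀ h + x.1 h - p₀ h‖ ≤ ε / 16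
    rw [add_sub_cancel_left]
    exact hx1 h
  · have h1 := (hA.disjoint h k hk hb).mono (hball h) (hball k)
    rw [disjoint_ball_ball_iff (by positivity) (by positivity), dist_eq_norm] at h1
    linarith
  · rw [hD] at hy
    have h1 : y - x.1 h ∉ ball (p₀ k) (c₁ * ρ) := fun h2 =>
      Set.disjoint_left.1 (hA.disjoint h k hk hb) hy (hball k h2)
    rw [Metric.mem_ball, dist_eq_norm, not_lt] at h1
    have h2 : ‖y - x.1 h - p₀ k‖ ≤ ‖y - p₀ k‖ + ‖x.1 h‖ := by
      have := norm_sub_le (y - p₀ k) (x.1 h)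
      rwa [sub_right_comm] at this
    have := hx1 h
    linarith
  · have := Param.norm_snd_fst_apply_le x e
    linarith

variable [∀ h, NormedSpace ℂ (X h)]

theorem analyticAt_param_fst (h : E × Bool) (x : Param E X) :
    AnalyticAt ℂ (fun x : Param E X => x.1 h) x :=
  ((lp.evalCLM ℂ (fun _ : E × Bool => ℂ) ∞ h).comp
    (ContinuousLinearMap.fst ℂ _ _)).analyticAt x

theorem analyticAt_param_snd_fst (e : E) (x : Param E X) :
    AnalyticAt ℂ (fun x : Param E X => x.2.1 e) x :=
  ((lp.evalCLM ℂ (fun _ : E => ℂ) ∞ e).comp ((ContinuousLinearMap.fst ℂ _ _).comp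
    (ContinuousLinearMap.snd ℂ _ _))).analyticAt x

theorem analyticAt_param_snd_snd (h : E × Bool) (x : Param E X) :
    AnalyticAt ℂ (fun x : Param E X => x.2.2 h) x :=
  ((lp.evalCLM ℂ X ∞ h).comp ((ContinuousLinearMap.snd ℂ _ _).comp
    (ContinuousLinearMap.snd ℂ _ _))).analyticAt x

theorem analyticAt_nodesAt_z (hZ : ∀ h, AnalyticOnNhd ℂ (fun q : ℂ × X h => Z.map h q.1 q.2)
      {q | q.2 ∈ ball (ξ₀ h) δ₀ ∧ q.1 ∈ Z.dom h q.2}) {x : Param E X} (hx : ‖x‖ < δ₀)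
    {h : E × Bool} {w : ℂ} (hw : w ∈ (nodesAt Z p₀ ξ₀ x).D h) :
    AnalyticAt ℂ (fun x : Param E X => (nodesAt Z p₀ ξ₀ x).z h w) x := by
  have h1 := hZ h (w - (p₀ h + x.1 h), ξ₀ h + x.2.2 h) ⟨by
    rw [Metric.mem_ball, dist_eq_norm, add_sub_cancel_left]
    exact (((lp.norm_apply_le_norm ENNReal.top_ne_zero x.2.2 h).trans (norm_snd_le x.2)).trans
      (norm_snd_le x)).trans_lt hx, hw⟩
  have h2 : AnalyticAt ℂ (fun x : Param E X => (w - (p₀ h + x.1 h), ξ₀ h + x.2.2 h)) x :=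
    (analyticAt_const.fun_sub (analyticAt_const.fun_add (analyticAt_param_fst h x))).prod
      (analyticAt_const.fun_add (analyticAt_param_snd_snd h x))
  exact AnalyticAt.fun_comp (g := fun q : ℂ × X h => Z.map h q.1 q.2)
    (f := fun x : Param E X => (w - (p₀ h + x.1 h), ξ₀ h + x.2.2 h)) h1 h2

variable {δ r : ℝ}

theorem exists_taylorKernelFamily (hZ : ∀ h, AnalyticOnNhd ℂ (fun q : ℂ × X h => Z.map h q.1 q.2)
      {q | q.2 ∈ ball (ξ₀ h) δ₀ ∧ q.1 ∈ Z.dom h q.2}) (hδ : δ ≤ δ₀) (hr : 0 < r)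
    (hK : ∀ x ∈ ball (0 : Param E X) δ, NeckConfig G (nodesAt Z p₀ ξ₀ x) x.2.1 p₀ ρ c₁ c₂ ε r) :
    ∃ κ : Param E X → KernelSpace E, AnalyticOnNhd ℂ κ (ball 0 δ) ∧
      (∀ x ∈ ball (0 : Param E X) δ, ∀ i,
        κ x i = taylorKernel G (nodesAt Z p₀ ξ₀ x) p₀ ε r i.1 i.2) ∧
      ∀ x ∈ ball (0 : Param E X) δ, ‖κ x‖ ≤ r⁻¹ := by
  refine exists_analyticOnNhd_lp
    (k := fun x (i : ((E × Bool) × ℕ) × ((E × Bool) × ℕ)) => taylorKernel G (nodesAt Z p₀ ξ₀ x) p₀ ε r i.1 i.2) (by positivity) isOpen_ball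
    (fun ⟨⟨h, m⟩, ⟨k, n⟩⟩ => ?_) fun x hx i => (hK x hx).norm_taylorKernel_le i.1 i.2
  simp only [taylorKernel]
  split_ifs with hkh
  · have hx₀ : ∀ x ∈ ball (0 : Param E X) δ, ‖x‖ < δ₀ := fun x hx =>
      (mem_ball_zero_iff.1 hx).trans_le hδ
    refine analyticOnNhd_const.mul ?_
    -- Positivity of `ε` comes from a configuration at some point of the ball; over an empty ball
    -- there is nothing to prove.
    by_cases hne : (ball (0 : Param E X) δ).Nonempty
    swap
    · rw [Set.not_nonempty_iff_eq_empty.1 hne]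
      exact fun x hx => hx.elim
    have hε : 0 < ε := (hK _ hne.some_mem).ε_pos
    refine analyticOnNhd_circleIntegral (M := (r ^ (m + 1))⁻¹ * ((ε / 2) ^ (n + 1))⁻¹)
      (by positivity) isOpen_ball (fun w hw x hx => ?_) (fun x hx => ?_) fun x hx w hw => ?_
    · have h0 := (hK x hx).z_ne_zero_of_mem_sphere h (s := ε / 2) (by linarith) le_rfl hw
      exact (((analyticAt_nodesAt_z hZ (hx₀ x hx)
        ((hK x hx).sphere_subset h le_rfl hw)).fun_pow (m + 1)).fun_inv
          (pow_ne_zero _ h0)).fun_mul analyticAt_const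
    · exact ((hK x hx).continuousOn_inv_z_pow h (by linarith) le_rfl (m + 1)).mul
        ((hK x hx).continuousOn_vertexForm_term hkh (n + 1))
    · have h2 := (hK x hx).norm_inv_z_pow_le h (by linarith) le_rfl (m + 1) hw
      have h3 := (hK x hx).half_le_norm_sub hkh hw
      rw [norm_mul, norm_inv ((w - p₀ k) ^ (n + 1)), norm_pow]
      gcongr
  · exact analyticOnNhd_const

open Classical in
theorem exists_inversionKernelFamily (hZ : ∀ h, AnalyticOnNhd ℂ (fun q : ℂ × X h => Z.map h q.1 q.2)
      {q | q.2 ∈ ball (ξ₀ h) δ₀ ∧ q.1 ∈ Z.dom h q.2}) (hδ : δ ≤ δ₀) (hδ0 : 0 < δ) (hr : 0 < r)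
    (hK : ∀ x ∈ ball (0 : Param E X) δ, NeckConfig G (nodesAt Z p₀ ξ₀ x) x.2.1 p₀ ρ c₁ c₂ ε r) :
    ∃ κ : Param E X → KernelSpace E, AnalyticOnNhd ℂ κ (ball 0 δ) ∧
      (∀ x ∈ ball (0 : Param E X) δ, ∀ i, κ x i = if i.2.1 = opp i.1.1 then
        inversionKernel (nodesAt Z p₀ ξ₀ x) x.2.1 p₀ ε r i.1.1 i.1.2 i.2.2 else 0) ∧
      ∀ x ∈ ball (0 : Param E X) δ, ‖κ x‖ ≤ δ / r := by
  refine exists_analyticOnNhd_lp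
    (k := fun x (i : ((E × Bool) × ℕ) × ((E × Bool) × ℕ)) => if i.2.1 = opp i.1.1 then
        inversionKernel (nodesAt Z p₀ ξ₀ x) x.2.1 p₀ ε r i.1.1 i.1.2 i.2.2 else 0)
    (by positivity) isOpen_ball (fun ⟨⟨h, j⟩, ⟨k, n⟩⟩ => ?_) fun x hx i => ?_
  · dsimp only
    split_ifs with hkh
    · have hx₀ : ∀ x ∈ ball (0 : Param E X) δ, ‖x‖ < δ₀ := fun x hx =>
        (mem_ball_zero_iff.1 hx).trans_le hδ
      have hε : 0 < ε := (hK 0 (mem_ball_self hδ0)).ε_pos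
      simp only [inversionKernel]
      refine analyticOnNhd_const.mul ?_
      refine analyticOnNhd_circleIntegral (M := (δ / r) ^ (n + 1) * (ε / 8) ^ (j - 1))
        (by positivity) isOpen_ball (fun w hw x hx => ?_) (fun x hx => ?_) fun x hx w hw => ?_
      · have h0 := (hK x hx).z_ne_zero_of_mem_sphere h (s := ε / 8) le_rfl (by linarith) hw
        exact (((analyticAt_param_snd_fst h.1 x).fun_div (analyticAt_nodesAt_z hZ (hx₀ x hx)
          ((hK x hx).sphere_subset h (by linarith) hw)) h0).fun_pow (n + 1)).fun_mul
            analyticAt_const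
      · refine ((continuousOn_const.div ((hK x hx).continuousOn_z h (by linarith)) fun w hw =>
          (hK x hx).z_ne_zero_of_mem_sphere h le_rfl (by linarith) hw).pow (n + 1)).mul
          (by fun_prop)
      · have h2 := (hK x hx).le_norm_z_of_mem_sphere h le_rfl (by linarith) hw
        have h3 := (Param.norm_snd_fst_apply_le x h.1).trans (mem_ball_zero_iff.1 hx).le
        rw [norm_mul, norm_pow, norm_pow, mem_sphere_iff_norm.1 hw, norm_div]
        gcongr
    · exact analyticOnNhd_const
  · dsimp only
    split_ifs with hkh
    · refine ((hK x hx).norm_inversionKernel_le _ _ _).trans ?_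
      have h3 := (Param.norm_snd_fst_apply_le x i.1.1.1).trans (mem_ball_zero_iff.1 hx).le
      gcongr
    · rw [norm_zero]; positivity

open Classical in
theorem exists_residueKernelFamily (hε : 0 < ε)
    (hK : ∀ x ∈ ball (0 : Param E X) δ, NeckConfig G (nodesAt Z p₀ ξ₀ x) x.2.1 p₀ ρ c₁ c₂ ε r) :
    ∃ κ : Param E X → KernelSpace E, AnalyticOnNhd ℂ κ (ball 0 δ) ∧
      ∀ x ∈ ball (0 : Param E X) δ, ∀ i, κ x i = if i.2.1 = i.1.1 ∧ i.2.2 = 0 then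
        (((nodesAt Z p₀ ξ₀ x).p i.1.1 - p₀ i.1.1) / (ε / 4 : ℝ)) ^ i.1.2 else 0 := by
  refine (exists_analyticOnNhd_lp (U := ball (0 : Param E X) δ) (M := 1)
    (k := fun x (i : ((E × Bool) × ℕ) × ((E × Bool) × ℕ)) => if i.2.1 = i.1.1 ∧ i.2.2 = 0 then
        (((nodesAt Z p₀ ξ₀ x).p i.1.1 - p₀ i.1.1) / (ε / 4 : ℝ)) ^ i.1.2 else 0)
    zero_le_one isOpen_ball (fun i => ?_) fun x hx i => ?_).imp fun κ h => ⟨h.1, h.2.1⟩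
  · split_ifs
    · intro x hx
      have h3 : AnalyticAt ℂ (fun x : Param E X => (nodesAt Z p₀ ξ₀ x).p i.1.1) x :=
        analyticAt_const.fun_add (analyticAt_param_fst i.1.1 x)
      have h4 : ((ε / 4 : ℝ) : ℂ) ≠ 0 := Complex.ofReal_ne_zero.2 (by positivity)
      exact ((h3.fun_sub analyticAt_const).fun_div analyticAt_const h4).fun_pow _
    · exact analyticOnNhd_const
  · split_ifs
    · rw [norm_pow]
      refine pow_le_one₀ (norm_nonneg _) ?_
      rw [norm_div, Complex.norm_real, Real.norm_eq_abs, abs_of_pos (by positivity),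
        div_le_one (by positivity)]
      have := (hK x hx).close i.1.1
      linarith
    · rw [norm_zero]; exact zero_le_one

end Parameters

end OpenNodes

end

noncomputable section

namespace OpenNodes

open Metric Filter

/-! ### Differentials on the thick part given by principal parts -/

section Thick

variable {V E : Type*} {G : OrientedMultigraph V E} {NE : SeqNorm E} {NV : SeqNorm V}
  {p₀ : E × Bool → ℂ} {ε : ℝ}

theorem domNorm_le {N : SeqNorm V} {Ω : V → Set ℂ} {w : V → ℂ → ℂ} {B : V → ℝ}
    (hB : ∀ v, 0 ≤ B v) (hw : ∀ v, ∀ z ∈ Ω v, ‖w v z‖ ≤ B v) :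
    domNorm N Ω w ≤ N.toFun fun v => (B v : ℂ) := by
  have h1 : domNorm N Ω w ≤ N.enorm fun v => ENNReal.ofReal (B v) :=
    N.enorm_mono fun v => iSup₂_le fun z hz => by
      rw [← ofReal_norm]
      exact ENNReal.ofReal_le_ofReal (hw v z hz)
  rw [N.enorm_of_ne_top fun v => ENNReal.ofReal_ne_top] at h1
  simpa only [ENNReal.toReal_ofReal (hB _)] using h1

theorem domNorm_congr {N : SeqNorm V} {Ω : V → Set ℂ} {w w' : V → ℂ → ℂ}
    (h : ∀ v, ∀ z ∈ Ω v, w v z = w' v z) : domNorm N Ω w = domNorm N Ω w' := by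
  rw [domNorm, domNorm]
  congr 1
  funext v
  exact iSup_congr fun z => iSup_congr fun hz => by rw [h v z hz]

theorem exists_bound_of_domNorm {N : SeqNorm V} {Ω : V → Set ℂ} {w : V → ℂ → ℂ}
    (h : domNorm N Ω w < ∞) : ∃ M : V → ℝ, (∀ v, 0 ≤ M v) ∧
      (∀ v, ∀ z ∈ Ω v, ‖w v z‖ ≤ M v) ∧ N.toFun (fun v => (M v : ℂ)) < ∞ := by
  have h1 := N.ne_top_of_enorm h
  refine ⟨fun v => (⨆ z ∈ Ω v, ‖w v z‖ₑ).toReal, fun v => ENNReal.toReal_nonneg, fun v z hz => ?_, ?_⟩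
  · rw [← toReal_enorm]
    exact ENNReal.toReal_mono (h1 v) (le_iSup₂ (f := fun z (_ : z ∈ Ω v) => ‖w v z‖ₑ) z hz)
  · rw [← N.enorm_of_ne_top h1]; exact h

/-- The restriction of `vertexForm` to the thick part. -/
def thickForm (hfin : G.LocallyFinite) (p₀ : E × Bool → ℂ) (ε : ℝ) (d : E × Bool → ℕ → ℂ) (v : V) :
    ℂ → ℂ := (domainΩ G p₀ ε v).indicator (vertexForm hfin p₀ (ε / 4) d v)

theorem norm_vertexForm_le (hfin : G.LocallyFinite) (hε : 0 < ε) {d : E × Bool → ℕ → ℂ} {u : E → ℝ}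
    (hd : ∀ k n, ‖d k n‖ ≤ u k.1) {v : V} {z : ℂ} (hz : z ∈ domainΩ G p₀ ε v) :
    ‖vertexForm hfin p₀ (ε / 4) d v z‖ ≤ 2 / ε * ∑ k ∈ hfin.halfEdges v, u k.1 := by
  rw [vertexForm, Finset.mul_sum]
  refine norm_sum_le_of_le _ fun k hk => ?_
  refine (norm_principalPart_le (by positivity) (hd k) (show ε / 4 < ε by linarith)
    (hz k (hfin.mem_halfEdges.1 hk))).trans ?_
  have hu : 0 ≤ u k.1 := (norm_nonneg _).trans (hd k 0)
  rw [div_mul_eq_mul_div, div_le_div_iff₀ (by linarith) hε]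
  nlinarith

theorem domNorm_thickForm_le (hfin : G.LocallyFinite) (hε : 0 < ε) {d : E × Bool → ℕ → ℂ}
    {u : E → ℝ} (hd : ∀ k n, ‖d k n‖ ≤ u k.1) {C : ℝ}
    (hu : NV.toFun (fun v => ((∑ k ∈ hfin.halfEdges v, u k.1 : ℝ) : ℂ)) ≤ ENNReal.ofReal C) :
    domNorm NV (domainΩ G p₀ ε) (thickForm hfin p₀ ε d) ≤ ENNReal.ofReal (2 / ε * C) := by
  have hu0 : ∀ v, 0 ≤ ∑ k ∈ hfin.halfEdges v, u k.1 := fun v =>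
    Finset.sum_nonneg fun k _ => (norm_nonneg _).trans (hd k 0)
  refine (domNorm_le (B := fun v => 2 / ε * ∑ k ∈ hfin.halfEdges v, u k.1)
    (fun v => mul_nonneg (by positivity) (hu0 v)) fun v z hz => ?_).trans ?_
  · rw [thickForm, Set.indicator_of_mem hz]
    exact norm_vertexForm_le hfin hε hd hz
  · rw [NV.toFun_const_mul (by positivity) (hu.trans_lt ENNReal.ofReal_lt_top),
      ENNReal.ofReal_mul (by positivity)]
    gcongr

theorem thickForm_mem (hfin : G.LocallyFinite) (hε : 0 < ε) {d : E × Bool → ℕ → ℂ}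
    {u : E → ℝ} (hd : ∀ k n, ‖d k n‖ ≤ u k.1)
    (hu : NV.toFun (fun v => ((∑ k ∈ hfin.halfEdges v, u k.1 : ℝ) : ℂ)) < ∞)
    (hsum : ∀ v, ∑ k ∈ hfin.halfEdges v, d k 0 = 0) :
    thickForm hfin p₀ ε d ∈ holoDiffSubmodule NV (domainΩ G p₀ ε) := by
  have hdiff : ∀ v, ∀ z ∈ domainΩ G p₀ ε v,
      DifferentiableAt ℂ (vertexForm hfin p₀ (ε / 4) d v) z := fun v z hz =>
    NeckConfig.differentiableAt_vertexForm (B := fun k => u k.1) hfin (by positivity) hd fun k hk => by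
      have := hz k hk
      linarith
  have heq : ∀ v, Set.EqOn (thickForm hfin p₀ ε d v) (vertexForm hfin p₀ (ε / 4) d v)
      (domainΩ G p₀ ε v) := fun v => Set.eqOn_indicator
  refine ⟨fun v z hz => Set.indicator_of_notMem hz _, fun v => ?_, fun v => ?_, fun v => ?_, ?_⟩
  · exact ContinuousOn.congr (fun z hz => (hdiff v z hz).continuousAt.continuousWithinAt) (heq v)
  · exact DifferentiableOn.congr (fun z hz =>
      (hdiff v z (interior_subset hz)).differentiableWithinAt) ((heq v).mono interior_subset)
  · refine (holomorphicAtInfty_vertexForm (p₀ := p₀) (B := fun k => u k.1) hfin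
      (by positivity : 0 < ε / 4) hd (hsum v)).congr ?_
    filter_upwards [NeckConfig.eventually_outside hfin p₀ ε v] with z hz using
      heq v fun k hk => (hz k hk).le
  · refine (domNorm_thickForm_le hfin hε hd (C := (NV.toFun fun v =>
      ((∑ k ∈ hfin.halfEdges v, u k.1 : ℝ) : ℂ)).toReal) ?_).trans_lt ENNReal.ofReal_lt_top
    rw [ENNReal.ofReal_toReal hu.ne]

/-- The family of coefficients with the coefficients of index `0` replaced by `0`. -/
def dropHead (d : E × Bool → ℕ → ℂ) (h : E × Bool) (n : ℕ) : ℂ := if n = 0 then 0 else d h n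

/-- The family of coefficients with `a` in index `0`. -/
def headOnly (a : E × Bool → ℂ) (h : E × Bool) (n : ℕ) : ℂ := if n = 0 then a h else 0

theorem norm_dropHead_le {d : E × Bool → ℕ → ℂ} {u : E → ℝ} (hd : ∀ k n, ‖d k n‖ ≤ u k.1)
    (k : E × Bool) (n : ℕ) : ‖dropHead d k n‖ ≤ u k.1 := by
  rw [dropHead]
  split_ifs
  · rw [norm_zero]; exact (norm_nonneg _).trans (hd k 0)
  · exact hd k n

theorem vertexForm_add (hfin : G.LocallyFinite) {b : ℝ} (hb : 0 ≤ b) {d d' : E × Bool → ℕ → ℂ}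
    {B B' : E × Bool → ℝ} (hd : ∀ k n, ‖d k n‖ ≤ B k) (hd' : ∀ k n, ‖d' k n‖ ≤ B' k) {v : V} {z : ℂ}
    (hz : ∀ k, G.base k = v → b < ‖z - p₀ k‖) :
    vertexForm hfin p₀ b (fun k n => d k n + d' k n) v z =
      vertexForm hfin p₀ b d v z + vertexForm hfin p₀ b d' v z := by
  rw [vertexForm, vertexForm, vertexForm, ← Finset.sum_add_distrib]
  exact Finset.sum_congr rfl fun k hk =>
    principalPart_add hb (hd k) (hd' k) (hz k (hfin.mem_halfEdges.1 hk))

/-- The differential on the thick part as a bounded operator on the coefficients. -/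
theorem exists_thickOperator (hN : AdmissibleNorms G NE NV) (hfin : G.LocallyFinite) (hε : 0 < ε) :
    ∃ R : CoeffSpace NE →L[ℂ] HoloDiff NV (domainΩ G p₀ ε), ∀ d,
      (R d).coeff = thickForm hfin p₀ ε (dropHead (coef d)) := by
  obtain ⟨C, hC, hb⟩ := hN.exists_halfEdges_bound hfin
  have hd : ∀ (d : CoeffSpace NE) k n, ‖dropHead (coef d) k n‖ ≤ ‖d.fam k.1‖ := fun d =>
    norm_dropHead_le (u := fun e => ‖d.fam e‖) fun k n => norm_coef_le d k n
  have hu : ∀ d : CoeffSpace NE, NV.toFun (fun v => ((∑ k ∈ hfin.halfEdges v, ‖d.fam k.1‖ : ℝ) : ℂ)) ≤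
      ENNReal.ofReal (C * ‖d‖) := fun d => by
    have h1 := hb _ (fun e => norm_nonneg (d.fam e)) d.toFun_norm_lt_top
    rwa [d.toFun_norm, ← ENNReal.ofReal_mul hC] at h1
  let T : CoeffSpace NE → HoloDiff NV (domainΩ G p₀ ε) := fun d =>
    ⟨thickForm hfin p₀ ε (dropHead (coef d)), thickForm_mem (u := fun e => ‖d.fam e‖) hfin hε (hd d)
      ((hu d).trans_lt ENNReal.ofReal_lt_top) fun v => by simp [dropHead]⟩
  have hT : ∀ d, (T d).coeff = thickForm hfin p₀ ε (dropHead (coef d)) := fun d => rfl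
  have hext : ∀ w w' : HoloDiff NV (domainΩ G p₀ ε), w.coeff = w'.coeff → w = w' :=
    fun w w' h => Subtype.ext h
  refine ⟨LinearMap.mkContinuous
    { toFun := T
      map_add' := fun d d' => hext _ _ ?_
      map_smul' := fun c d => hext _ _ ?_ } (2 / ε * C) fun d => ?_, hT⟩
  · change (T (d + d')).coeff = (T d).coeff + (T d').coeff
    rw [hT, hT, hT]
    funext v z
    rw [Pi.add_apply, Pi.add_apply]
    by_cases hz : z ∈ domainΩ G p₀ ε v
    · simp only [thickForm, Set.indicator_of_mem hz]
      rw [← vertexForm_add hfin (by positivity) (hd d) (hd d') fun k hk => by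
        have := hz k hk
        linarith]
      congr 1
      funext k n
      simp only [dropHead, coef_add]
      split_ifs <;> simp
    · simp only [thickForm, Set.indicator_of_notMem hz, add_zero]
  · change (T (c • d)).coeff = c • (T d).coeff
    rw [hT, hT]
    funext v z
    rw [Pi.smul_apply, Pi.smul_apply, smul_eq_mul]
    by_cases hz : z ∈ domainΩ G p₀ ε v
    · simp only [thickForm, Set.indicator_of_mem hz]
      rw [vertexForm, vertexForm, Finset.mul_sum]
      refine Finset.sum_congr rfl fun k _ => ?_
      rw [← principalPart_smul]
      congr 1
      funext n
      simp only [dropHead, coef_smul]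
      split_ifs <;> simp
    · simp only [thickForm, Set.indicator_of_notMem hz, mul_zero]
  · change ‖T d‖ ≤ _
    rw [HoloDiff.norm_def, hT]
    refine ENNReal.toReal_le_of_le_ofReal (by positivity) ?_
    rw [mul_assoc]
    exact domNorm_thickForm_le (u := fun e => ‖d.fam e‖) hfin hε (hd d) (hu d)

/-- The coefficients of index `0` are the residues. For a general element of `CoeffSpace` they do
not add up to zero at the vertices, so the differential would not be holomorphic at infinity; for a
solution they do not depend on the parameters. They are therefore split off as a constant summand,
and the linear operator uses `dropHead`. -/
theorem exists_residueDiff (hN : AdmissibleNorms G NE NV) (hfin : G.LocallyFinite) (hε : 0 < ε)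
    {a : E × Bool → ℂ} {u : E → ℝ} (ha : ∀ h, ‖a h‖ ≤ u h.1) (hu : NE.toFun (fun e => (u e : ℂ)) < ∞)
    (hsum : ∀ v, ∑ k ∈ hfin.halfEdges v, a k = 0) :
    ∃ w : HoloDiff NV (domainΩ G p₀ ε), w.coeff = thickForm hfin p₀ ε (headOnly a) := by
  obtain ⟨C, hC, hb⟩ := hN.exists_halfEdges_bound hfin
  have hu0 : ∀ e, 0 ≤ u e := fun e => (norm_nonneg _).trans (ha (e, true))
  refine ⟨⟨thickForm hfin p₀ ε (headOnly a), thickForm_mem hfin hε (u := u) (fun k n => ?_)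
    ((hb u hu0 hu).trans_lt (ENNReal.mul_lt_top ENNReal.ofReal_lt_top hu)) fun v => ?_⟩, rfl⟩
  · rw [headOnly]
    split_ifs
    · exact ha k
    · rw [norm_zero]; exact hu0 _
  · simpa [headOnly] using hsum v

end Thick

end OpenNodes

end

noncomputable section

namespace OpenNodes

open Metric Filter

/-! ### The linear equation for the coefficients -/

section Analytic

variable {X F H : Type*} [NormedAddCommGroup X] [NormedSpace ℂ X] [NormedAddCommGroup F]
  [NormedSpace ℂ F] [NormedAddCommGroup H] [NormedSpace ℂ H] {U : Set X}

theorem AnalyticOnNhd.clm_apply {T : X → F →L[ℂ] H} {y : X → F} (hT : AnalyticOnNhd ℂ T U)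
    (hy : AnalyticOnNhd ℂ y U) : AnalyticOnNhd ℂ (fun x => T x (y x)) U := fun x hx =>
  ((ContinuousLinearMap.id ℂ (F →L[ℂ] H)).analyticAt_bilinear (T x, y x)).comp₂ (hT x hx) (hy x hx)

/-- Inversion is analytic at the units of the Banach algebra of operators, and `1 - T x` is a unit
by the Neumann series. -/
theorem AnalyticOnNhd.inverse_one_sub_apply [CompleteSpace F] {T : X → F →L[ℂ] F} {y : X → F}
    (hT : AnalyticOnNhd ℂ T U) (hy : AnalyticOnNhd ℂ y U) (hT1 : ∀ x ∈ U, ‖T x‖ < 1) :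
    AnalyticOnNhd ℂ (fun x => Ring.inverse (1 - T x) (y x)) U := by
  refine AnalyticOnNhd.clm_apply (fun x hx => ?_) hy
  have h1 : AnalyticAt ℂ (fun x => 1 - T x) x := analyticAt_const.sub (hT x hx)
  obtain ⟨u, hu⟩ := isUnit_one_sub_of_norm_lt_one (hT1 x hx)
  exact AnalyticAt.fun_comp (g := Ring.inverse) (f := fun x => 1 - T x)
    (by rw [← hu]; exact analyticAt_inverse u) h1

end Analytic

section Coefficients

variable {V E : Type*} {G : OrientedMultigraph V E} {NE : SeqNorm E} {S : NodeData E} {t : E → ℂ}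
  {p₀ : E × Bool → ℂ} {ρ c₁ c₂ ε r : ℝ}

theorem coef_taylor_eq (K : NeckConfig G S t p₀ ρ c₁ c₂ ε r) (hfin : G.LocallyFinite)
    {L : KernelSpace E →L[ℂ] CoeffSpace NE →L[ℂ] CoeffSpace NE}
    (hL : ∀ κ c h m, coef (L κ c) h m =
      ∑ k ∈ hfin.nearby h.1, ∑' n, (2 : ℂ)⁻¹ ^ n * κ ((h, m), (k, n)) * coef c k n)
    {κ : KernelSpace E} (hκ : ∀ i, κ i = taylorKernel G S p₀ ε r i.1 i.2) (d : CoeffSpace NE)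
    (h : E × Bool) (m : ℕ) :
    coef (L κ d) h m = (2 * Real.pi * Complex.I : ℂ)⁻¹ * (r ^ m * ∮ w in C(p₀ h, ε / 2),
      (S.z h w ^ (m + 1))⁻¹ * vertexForm hfin p₀ (ε / 4) (coef d) (G.base h) w) := by
  rw [K.taylor_coefficient_eq hfin (B := fun k => ‖d.fam k.1‖) (fun k n => norm_coef_le d k n), hL]
  simp only [hκ]

open Classical in
theorem coef_principal_eq (K : NeckConfig G S t p₀ ρ c₁ c₂ ε r) (hfin : G.LocallyFinite)
    {L : KernelSpace E →L[ℂ] CoeffSpace NE →L[ℂ] CoeffSpace NE}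
    (hL : ∀ κ c h m, coef (L κ c) h m =
      ∑ k ∈ hfin.nearby h.1, ∑' n, (2 : ℂ)⁻¹ ^ n * κ ((h, m), (k, n)) * coef c k n)
    {κ κ' : KernelSpace E} (hκ : ∀ i, κ i = if i.2.1 = i.1.1 ∧ i.2.2 = 0 then
      ((S.p i.1.1 - p₀ i.1.1) / (ε / 4 : ℝ)) ^ i.1.2 else 0)
    (hκ' : ∀ i, κ' i = if i.2.1 = opp i.1.1 then
      inversionKernel S t p₀ ε r i.1.1 i.1.2 i.2.2 else 0)
    {a : E × Bool → ℂ} {A : CoeffSpace NE} (hA : coef A = headOnly a) (c : CoeffSpace NE)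
    (h : E × Bool) (j : ℕ) :
    coef (L κ A + L κ' c) h j = (2 * Real.pi * Complex.I : ℂ)⁻¹ * ((((ε / 4 : ℝ) : ℂ) ^ j)⁻¹ *
      ∮ y in C(p₀ h, ε / 8),
        neckSingular S t a (fun k => scaledSeries r (coef c k)) h y * (y - p₀ h) ^ j) := by
  have h1 : coef (L κ A) h j = ((S.p h - p₀ h) / (ε / 4 : ℝ)) ^ j * a h := by
    rw [hL, Finset.sum_eq_single h, tsum_eq_single 0]
    · simp [hκ, hA, headOnly]
    · intro n hn
      simp [hκ, hn]
    · intro k _ hk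
      simp [hκ, hk]
    · intro hh
      exact absurd (hfin.mem_nearby h.1 h.2) hh
  have h2 := (K.principal_coefficient_eq a (B := fun k => ‖c.fam k.1‖)
    (fun k n => norm_coef_le c k n) h j).tsum_eq
  have h3 : coef (L κ' c) h j =
      ∑' n, (2 : ℂ)⁻¹ ^ n * inversionKernel S t p₀ ε r h j n * coef c (opp h) n := by
    rw [hL, Finset.sum_eq_single (opp h)]
    · simp [hκ']
    · intro k _ hk
      simp [hκ', hk]
    · intro hh
      exact absurd (hfin.mem_nearby h.1 (!h.2)) hh
  rw [coef_add, h1, h3, h2]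
  ring

end Coefficients

/-! ### Residues -/

section Residues

variable {V E : Type*} {G : OrientedMultigraph V E}

/-- The residues at the node points determined by the periods. -/
def nodeResidue (α : E → ℂ) (h : E × Bool) : ℂ :=
  if h.2 then (2 * Real.pi * Complex.I : ℂ)⁻¹ * α h.1 else -((2 * Real.pi * Complex.I : ℂ)⁻¹ * α h.1)

theorem norm_nodeResidue (α : E → ℂ) (h : E × Bool) :
    ‖nodeResidue α h‖ = ‖nodeResidue α (h.1, true)‖ := by
  obtain ⟨e, σ⟩ := h
  cases σ <;> simp [nodeResidue]

theorem two_pi_I_mul_nodeResidue (α : E → ℂ) (e : E) :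
    2 * Real.pi * Complex.I * nodeResidue α (e, true) = α e := by
  rw [nodeResidue, if_pos rfl, mul_inv_cancel_left₀ Complex.two_pi_I_ne_zero]

theorem sum_nodeResidue (hfin : G.LocallyFinite) {α : E → ℂ} (hα : G.Compatible α) (v : V) :
    ∑ k ∈ hfin.halfEdges v, nodeResidue α k = 0 := by
  classical
  have h1 : {e | G.src e = v}.Finite := (hfin v).subset fun e he => Or.inl he
  have h2 : {e | G.tgt e = v}.Finite := (hfin v).subset fun e he => Or.inr he
  have h3 : hfin.halfEdges v = h1.toFinset.image (fun e => (e, false)) ∪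
      h2.toFinset.image (fun e => (e, true)) := by
    ext ⟨e, σ⟩
    rw [hfin.mem_halfEdges]
    cases σ <;> simp [OrientedMultigraph.base]
  have h4 := hα v
  rw [finsum_mem_eq_finite_toFinset_sum _ h1, finsum_mem_eq_finite_toFinset_sum _ h2] at h4
  rw [h3, Finset.sum_union, Finset.sum_image (by simp), Finset.sum_image (by simp)]
  · simp only [nodeResidue, Bool.false_eq_true, if_false, if_true]
    rw [Finset.sum_neg_distrib, ← Finset.mul_sum, ← Finset.mul_sum, h4, neg_add_cancel]
  · rw [Finset.disjoint_left]
    simp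

theorem toFun_norm_nodeResidue_lt_top {N : SeqNorm E} {α : E → ℂ} (hα : N.toFun α < ∞) :
    N.toFun (fun e => (‖nodeResidue α (e, true)‖ : ℂ)) < ∞ := by
  refine (N.mono' _ ((2 * Real.pi * Complex.I : ℂ)⁻¹ • α) fun e => ?_).trans_lt ?_
  · simp [nodeResidue]
  · rw [N.smul' _ _ hα]
    exact ENNReal.mul_lt_top enorm_lt_top hα

end Residues

end OpenNodes

end

noncomputable section

namespace OpenNodes

open Metric Filter

/-! ### Solving for the coefficients -/

theorem exists_unique_solution_linear {F : Type*} [NormedAddCommGroup F] [NormedSpace ℂ F]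
    [CompleteSpace F] {T : F →L[ℂ] F} (hT : ‖T‖ < 1) (b d : F) :
    d = b + T d ↔ d = Ring.inverse (1 - T) b := by
  have hu := isUnit_one_sub_of_norm_lt_one hT
  constructor
  · intro h
    have h1 : (1 - T) d = b := sub_eq_of_eq_add h
    rw [← h1, ← mul_apply_eq_comp, Ring.inverse_mul_cancel _ hu,
      one_apply_eq_self]
  · rintro rfl
    have h1 : (1 - T) (Ring.inverse (1 - T) b) = b := by
      rw [← mul_apply_eq_comp, Ring.mul_inverse_cancel _ hu,
        one_apply_eq_self]
    exact eq_add_of_sub_eq h1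

variable {V E : Type*} {G : OrientedMultigraph V E} {NE : SeqNorm E} {NV : SeqNorm V}
  {X : E × Bool → Type*} [∀ h, NormedAddCommGroup (X h)] [∀ h, NormedSpace ℂ (X h)]
  {Z : CoordFamily E X} {p₀ : E × Bool → ℂ} {ξ₀ : ∀ h, X h} {ρ c₁ c₂ δ₀ ε r : ℝ}

/-- The Taylor coefficients `c` in the necks are those of the differential with principal parts
`d`, and `d` is the family of principal parts of the singular parts in the necks given by `c`. -/
structure IsCoefficientSystem (hfin : G.LocallyFinite) (S : NodeData E) (t : E → ℂ)
    (p₀ : E × Bool → ℂ) (ε r : ℝ) (a : E × Bool → ℂ) (c d : E × Bool → ℕ → ℂ) : Prop where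
  taylor : ∀ h m, c h m = (2 * Real.pi * Complex.I : ℂ)⁻¹ * (r ^ m * ∮ w in C(p₀ h, ε / 2),
    (S.z h w ^ (m + 1))⁻¹ * vertexForm hfin p₀ (ε / 4) d (G.base h) w)
  principal : ∀ h j, d h j = (2 * Real.pi * Complex.I : ℂ)⁻¹ * ((((ε / 4 : ℝ) : ℂ) ^ j)⁻¹ *
    ∮ y in C(p₀ h, ε / 8),
      neckSingular S t a (fun k => scaledSeries r (c k)) h y * (y - p₀ h) ^ j)

/-- Eliminating `c` leaves the fixed point equation `d = L κ₀ A + L κ₁ (L κ₂ d)`, whose linear part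
has norm at most `‖L‖ ^ 2 δ / r ^ 2 < 1`. The radius `δ` is fixed before the residues are given. -/
theorem exists_analytic_coefficients (hN : AdmissibleNorms G NE NV) (hfin : G.LocallyFinite)
    (hc₁ : 0 < c₁) (hc₂ : 0 < c₂) (hδ₀ : 0 < δ₀)
    (hZ : ∀ h, AnalyticOnNhd ℂ (fun q : ℂ × X h => Z.map h q.1 q.2)
      {q | q.2 ∈ ball (ξ₀ h) δ₀ ∧ q.1 ∈ Z.dom h q.2})
    (hadm : ∀ η : lp X ∞, ‖η‖ < δ₀ → Admissible G ρ c₁ c₂ (Z.nodeData p₀ fun h => ξ₀ h + η h))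
    (hε : 0 < ε) (hερ : ε ≤ ρ * c₁) (hr : r = ε / (16 * c₂)) :
    ∃ δ : ℝ, 0 < δ ∧ (∀ x ∈ ball (0 : Param E X) δ,
        NeckConfig G (nodesAt Z p₀ ξ₀ x) x.2.1 p₀ ρ c₁ c₂ ε r ∧ ∀ e, 16 * ‖x.2.1 e‖ ≤ r ^ 2) ∧
      ∀ (a : E × Bool → ℂ) (A : CoeffSpace NE), coef A = headOnly a →
        ∃ c d : Param E X → CoeffSpace NE, AnalyticOnNhd ℂ d (ball 0 δ) ∧
          ∀ x ∈ ball (0 : Param E X) δ,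
            IsCoefficientSystem hfin (nodesAt Z p₀ ξ₀ x) x.2.1 p₀ ε r a (coef (c x)) (coef (d x)) ∧
            ∀ (c' d' : E × Bool → ℕ → ℂ) (u : E → ℝ), NE.toFun (fun e => (u e : ℂ)) < ∞ →
              (∀ h m, ‖c' h m‖ ≤ u h.1) →
              IsCoefficientSystem hfin (nodesAt Z p₀ ξ₀ x) x.2.1 p₀ ε r a c' d' →
              c' = coef (c x) ∧ d' = coef (d x) := by
  have hr0 : 0 < r := by rw [hr]; positivity
  obtain ⟨L, hL⟩ := exists_kernelOperator hN hfin
  -- The four bounds serve, in order, the admissibility of the coordinates, the closeness of the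
  -- node points to `p₀`, the a priori estimate for uniqueness, and the contraction.
  obtain ⟨δ, hδ, hδ₀', hδε, hδr, hδL⟩ : ∃ δ : ℝ, 0 < δ ∧ δ ≤ δ₀ ∧ δ ≤ ε / 16 ∧ δ ≤ r ^ 2 / 16 ∧
      δ ≤ r ^ 2 / (2 * (‖L‖ ^ 2 + 1)) :=
    ⟨min (min δ₀ (ε / 16)) (min (r ^ 2 / 16) (r ^ 2 / (2 * (‖L‖ ^ 2 + 1)))),
      by positivity, (min_le_left _ _).trans (min_le_left _ _),
      (min_le_left _ _).trans (min_le_right _ _), (min_le_right _ _).trans (min_le_left _ _),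
      (min_le_right _ _).trans (min_le_right _ _)⟩
  have hK : ∀ x ∈ ball (0 : Param E X) δ,
      NeckConfig G (nodesAt Z p₀ ξ₀ x) x.2.1 p₀ ρ c₁ c₂ ε r := fun x hx => by
    rw [mem_ball_zero_iff] at hx
    have h1 := neckConfig_nodesAt hc₁ hc₂ hadm hε hερ (hx.trans_le hδ₀') (hx.le.trans hδε)
    rw [← hr] at h1
    exact h1 (by nlinarith [sq_nonneg r])
  refine ⟨δ, hδ, fun x hx => ⟨hK x hx, fun e => ?_⟩, fun a A hA => ?_⟩
  · rw [mem_ball_zero_iff] at hx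
    linarith [Param.norm_snd_fst_apply_le x e]
  obtain ⟨κ₀, hκ₀, hκ₀'⟩ := exists_residueKernelFamily hε hK
  obtain ⟨κ₁, hκ₁, hκ₁', hn₁⟩ := exists_inversionKernelFamily hZ hδ₀' hδ hr0 hK
  obtain ⟨κ₂, hκ₂, hκ₂', hn₂⟩ := exists_taylorKernelFamily hZ hδ₀' hr0 hK
  have hT : ∀ x ∈ ball (0 : Param E X) δ, ‖(L (κ₁ x)).comp (L (κ₂ x))‖ < 1 := fun x hx => by
    have h1 : ‖L (κ₁ x)‖ ≤ ‖L‖ * (δ / r) := (L.le_opNorm _).trans (by gcongr; exact hn₁ x hx)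
    have h2 : ‖L (κ₂ x)‖ ≤ ‖L‖ * r⁻¹ := (L.le_opNorm _).trans (by gcongr; exact hn₂ x hx)
    refine (ContinuousLinearMap.opNorm_comp_le _ _).trans_lt ?_
    refine (mul_le_mul h1 h2 (norm_nonneg _) (by positivity)).trans_lt ?_
    have h3 : ‖L‖ * (δ / r) * (‖L‖ * r⁻¹) = ‖L‖ ^ 2 * δ / r ^ 2 := by
      field_simp
    rw [h3, div_lt_one (by positivity)]
    rw [le_div_iff₀ (by positivity)] at hδL
    nlinarith [mul_nonneg hδ.le (sq_nonneg ‖L‖)]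
  have hLκ : ∀ {κ : Param E X → KernelSpace E}, AnalyticOnNhd ℂ κ (ball 0 δ) →
      AnalyticOnNhd ℂ (fun x => L (κ x)) (ball 0 δ) := fun h => L.comp_analyticOnNhd h
  let d : Param E X → CoeffSpace NE := fun x =>
    Ring.inverse (1 - (L (κ₁ x)).comp (L (κ₂ x))) (L (κ₀ x) A)
  have hd : ∀ x ∈ ball (0 : Param E X) δ, ∀ d', d' = L (κ₀ x) A + L (κ₁ x) (L (κ₂ x) d') ↔
      d' = d x := fun x hx d' => exists_unique_solution_linear (hT x hx) _ _
  refine ⟨fun x => L (κ₂ x) (d x), d, ?_, fun x hx => ⟨⟨fun h m => ?_, fun h j => ?_⟩, ?_⟩⟩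
  · exact AnalyticOnNhd.inverse_one_sub_apply ((hLκ hκ₁).mul (hLκ hκ₂))
      (AnalyticOnNhd.clm_apply (hLκ hκ₀) analyticOnNhd_const) hT
  · exact coef_taylor_eq (hK x hx) hfin hL (hκ₂' x hx) (d x) h m
  · rw [← coef_principal_eq (hK x hx) hfin hL (hκ₀' x hx) (hκ₁' x hx) hA, ← (hd x hx _).2 rfl]
  · intro c' d' u hu hc' H
    -- Only `c'` is assumed to have finite norm; the second equation then shows that `d'` comes from
    -- the Banach space too.
    obtain ⟨c, rfl⟩ : ∃ c : CoeffSpace NE, coef c = c' := ⟨coeffOfBound c' u hc' hu, rfl⟩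
    have h1 : d' = coef (L (κ₀ x) A + L (κ₁ x) c) := by
      funext h j
      rw [H.principal, coef_principal_eq (hK x hx) hfin hL (hκ₀' x hx) (hκ₁' x hx) hA]
    have h2 : c = L (κ₂ x) (L (κ₀ x) A + L (κ₁ x) c) := coef_ext fun h m => by
      rw [coef_taylor_eq (hK x hx) hfin hL (hκ₂' x hx), ← h1, H.taylor]
    have h3 : L (κ₀ x) A + L (κ₁ x) c = d x := (hd x hx _).1 (by rw [← h2])
    rw [h3] at h1 h2
    exact ⟨congrArg coef h2, h1⟩

end OpenNodes

end

/-! ### Conclusion. -/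

theorem theorem4 {V E : Type*} (G : OrientedMultigraph V E) (hconn : G.Connected)
    (hfin : G.LocallyFinite)
    (NE : SeqNorm E) (NV : SeqNorm V) (hN : AdmissibleNorms G NE NV)
    (X : E × Bool → Type*) [∀ h, NormedAddCommGroup (X h)] [∀ h, NormedSpace ℂ (X h)]
    [∀ h, FiniteDimensional ℂ (X h)]
    (hdim : ∃ d : ℕ, ∀ h, Module.finrank ℂ (X h) ≤ d)
    (Z : CoordFamily E X) (p₀ : E × Bool → ℂ) (ξ₀ : ∀ h, X h)
    (ρ c₁ c₂ δ₀ : ℝ) (hρ : 0 < ρ) (hc₁ : 0 < c₁) (hc₂ : 0 < c₂) (hδ₀ : 0 < δ₀)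
    (hZ : ∀ h, AnalyticOnNhd ℂ (fun q : ℂ × X h => Z.map h q.1 q.2)
      {q | q.2 ∈ Metric.ball (ξ₀ h) δ₀ ∧ q.1 ∈ Z.dom h q.2})
    (hadm : ∀ η : lp X ⊤, ‖η‖ < δ₀ →
      Admissible G ρ c₁ c₂ (Z.nodeData p₀ (fun h => ξ₀ h + η h)))
    (ε : ℝ) (hε : 0 < ε) (hερ : ε ≤ ρ * c₁) :
    ∃ δ : ℝ, 0 < δ ∧ ∀ α : E → ℂ, NE.toFun α < ⊤ → G.Compatible α →
      ∃ ω : Param E X → V → ℂ → ℂ,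
        (∀ x ∈ Metric.ball (0 : Param E X) δ,
          (IsRegular G ρ (nodesAt Z p₀ ξ₀ x) x.2.1 (ω x) ∧
            domNorm NV (domainΩ G p₀ ε) (ω x) < ⊤ ∧
            HasPeriods G ρ (nodesAt Z p₀ ξ₀ x) x.2.1 (ω x) α) ∧
          (∀ ω' : V → ℂ → ℂ, IsRegular G ρ (nodesAt Z p₀ ξ₀ x) x.2.1 ω' →
            domNorm NV (domainΩ G p₀ ε) ω' < ⊤ →
            HasPeriods G ρ (nodesAt Z p₀ ξ₀ x) x.2.1 ω' α →
            ∀ v, Set.EqOn (ω' v) (ω x v) (piece G ρ (nodesAt Z p₀ ξ₀ x) x.2.1 v))) ∧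
        ∃ Φ : Param E X → HoloDiff NV (domainΩ G p₀ ε),
          (∀ x ∈ Metric.ball (0 : Param E X) δ, ∀ v, ∀ z ∈ domainΩ G p₀ ε v,
            z ∈ piece G ρ (nodesAt Z p₀ ξ₀ x) x.2.1 v ∧ (Φ x).coeff v z = ω x v z) ∧
          ContDiffOn ℂ (⊤ : ℕ∞) Φ (Metric.ball 0 δ) ∧
          AnalyticOnNhd ℂ Φ (Metric.ball 0 δ) := by
  have hr : 0 < ε / (16 * c₂) := by positivity
  obtain ⟨δ, hδ, hK, hcd⟩ :=
    exists_analytic_coefficients (r := ε / (16 * c₂)) hN hfin hc₁ hc₂ hδ₀ hZ hadm hε hερ rfl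
  refine ⟨δ, hδ, fun α hα hαc => ?_⟩
  have ha : ∀ e, nodeResidue α (e, false) = -nodeResidue α (e, true) := fun e => by
    simp [nodeResidue]
  have hsum := sum_nodeResidue hfin hαc
  have hper : (fun e => 2 * Real.pi * Complex.I * nodeResidue α (e, true)) = α :=
    funext (two_pi_I_mul_nodeResidue α)
  have hres := toFun_norm_nodeResidue_lt_top hα
  obtain ⟨A, hA⟩ : ∃ A : CoeffSpace NE, coef A = headOnly (nodeResidue α) :=
    ⟨coeffOfBound (headOnly (nodeResidue α)) (fun e => ‖nodeResidue α (e, true)‖) (fun h n => by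
      rw [headOnly]
      split_ifs
      · rw [norm_nodeResidue]
      · rw [norm_zero]; exact norm_nonneg _) hres, rfl⟩
  obtain ⟨c, d, hd, hsol⟩ := hcd (nodeResidue α) A hA
  obtain ⟨R, hR⟩ := exists_thickOperator (p₀ := p₀) hN hfin hε
  obtain ⟨W, hW⟩ := exists_residueDiff (p₀ := p₀) hN hfin hε
    (fun h => (norm_nodeResidue α h).le) hres hsum
  have hbc : ∀ x k n, ‖coef (c x) k n‖ ≤ ‖(c x).fam k.1‖ := fun x k n => norm_coef_le (c x) k n
  have hbd : ∀ x k n, ‖coef (d x) k n‖ ≤ ‖(d x).fam k.1‖ := fun x k n => norm_coef_le (d x) k n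
  -- On the thick part the solution is `vertexForm`, which splits into the part without heads,
  -- linear in `d x`, and the constant differential of the residues.
  have hΦ : ∀ x ∈ Metric.ball (0 : Param E X) δ, ∀ v, ∀ z ∈ domainΩ G p₀ ε v,
      (R (d x) + W).coeff v z = NeckConfig.solution hfin (nodesAt Z p₀ ξ₀ x) x.2.1 p₀ ε (ε / (16 * c₂))
        (nodeResidue α) (coef (c x)) (coef (d x)) v z := fun x hx v z hz => by
    have hz' : ∀ k, G.base k = v → ε / 4 < ‖z - p₀ k‖ := fun k hk => by
      have := hz k hk
      linarith
    have hh := (hK x hx).1.head_coefficient_eq (Bc := fun k => ‖(c x).fam k.1‖) (hbc x)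
      (hsol x hx).1.principal
    have h1 : (R (d x) + W).coeff v z = (R (d x)).coeff v z + W.coeff v z := rfl
    rw [h1, hR, hW, thickForm, thickForm, Set.indicator_of_mem hz, Set.indicator_of_mem hz,
      ← vertexForm_add (B := fun k => ‖(d x).fam k.1‖) (B' := fun k => ‖nodeResidue α k‖) hfin
        (by positivity) (norm_dropHead_le (u := fun e => ‖(d x).fam e‖) (hbd x)) (fun k n => ?_) hz',
      NeckConfig.solution, glued_of_outside hz']
    · congr 1
      funext k n
      rw [dropHead, headOnly]
      split_ifs with hn
      · rw [zero_add, hn, hh]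
      · rw [add_zero]
    · rw [headOnly]
      split_ifs
      · exact le_rfl
      · rw [norm_zero]; exact norm_nonneg _
  have hana : AnalyticOnNhd ℂ (fun x => R (d x) + W) (Metric.ball 0 δ) :=
    (R.comp_analyticOnNhd hd).add analyticOnNhd_const
  refine ⟨fun x => NeckConfig.solution hfin (nodesAt Z p₀ ξ₀ x) x.2.1 p₀ ε (ε / (16 * c₂))
    (nodeResidue α) (coef (c x)) (coef (d x)), fun x hx => ⟨?_, ?_⟩, fun x => R (d x) + W,
    fun x hx v z hz => ⟨(hK x hx).1.outside_subset_piece fun k hk => ?_, hΦ x hx v z hz⟩,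
    hana.contDiffOn Metric.isOpen_ball.uniqueDiffOn, hana⟩
  · have hspec := (hK x hx).1.solution_spec hfin ha hsum
      (Bc := fun k => ‖(c x).fam k.1‖) (Bd := fun k => ‖(d x).fam k.1‖) (hbc x) (hbd x)
      (hsol x hx).1.taylor (hsol x hx).1.principal
    rw [hper] at hspec
    refine ⟨hspec.1, ?_, hspec.2⟩
    rw [← domNorm_congr (hΦ x hx)]
    exact (R (d x) + W).domNorm_lt_top
  · intro ω' hreg hnorm hper'
    have K := (hK x hx).1
    -- The suprema `M v` on the thick part form a sequence of finite vertex norm; passing to the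
    -- ends of edges, they give the edge sequence of finite norm which dominates the Taylor
    -- coefficients of `ω'`.
    obtain ⟨M, hM0, hM, hMfin⟩ := exists_bound_of_domNorm hnorm
    rw [← hper] at hper'
    obtain ⟨c', d', Bd, hc', hd', hC, hD, hout, hann⟩ :=
      K.exists_coefficients hfin (hK x hx).2 hreg hper' ha hsum hM
    obtain ⟨C, hC0, hCb⟩ := hN.exists_ends_bound
    have hu1 := (hCb M hM0 hMfin).trans_lt (ENNReal.mul_lt_top ENNReal.ofReal_lt_top hMfin)
    have hu2 : NE.toFun (fun e => ((ε / (ε / (16 * c₂)) * (M (G.src e) + M (G.tgt e)) +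
        16 / (ε / (16 * c₂)) * ‖nodeResidue α (e, true)‖ : ℝ) : ℂ)) < ⊤ := by
      have h1 := NE.toFun_const_mul (c := ε / (ε / (16 * c₂))) (by positivity) hu1
      have h2 := NE.toFun_const_mul (c := 16 / (ε / (16 * c₂))) (by positivity) hres
      have h3 := NE.add_le' (fun e => ((ε / (ε / (16 * c₂)) * (M (G.src e) + M (G.tgt e)) : ℝ) : ℂ))
        (fun e => ((16 / (ε / (16 * c₂)) * ‖nodeResidue α (e, true)‖ : ℝ) : ℂ))
      rw [h1, h2] at h3
      refine lt_of_eq_of_lt ?_ (h3.trans_lt (ENNReal.add_lt_top.2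
        ⟨ENNReal.mul_lt_top ENNReal.ofReal_lt_top hu1,
          ENNReal.mul_lt_top ENNReal.ofReal_lt_top hres⟩))
      congr 1
      funext e
      rw [Pi.add_apply, ← Complex.ofReal_add]
    obtain ⟨rfl, rfl⟩ := (hsol x hx).2 c' d' _ hu2 hc' ⟨hC, hD⟩
    exact K.eq_solution hfin hout hann fun h => (K.vertexForm_eq_neckForm hfin hc' hd' hC hD h).2
  · have := hz k hk
    linarith
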